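/- **Conventions.** $[Y]$ denotes the closed linear span of a subset $Y$ of a normed space, and $\mathcal L(E,F)$ the bounded operators between Hilbert spaces. A *$C^*$-base* is a triple $\mathfrak b=(\mathfrak K,\mathfrak B,\mathfrak B^\dagger)$ of a Hilbert space $\mathfrak K$ and two commuting nondegenerate $C^*$-algebras $\mathfrak B,\mathfrak B^\dagger\subseteq\mathcal L(\mathfrak K)$; put $\mathfrak b^\dagger=(\mathfrak K,\mathfrak B^\dagger,\mathfrak B)$. A *$C^*$-$\mathfrak b$-module* is a Hilbert space $H$ with a closed subspace $\alpha\subseteq\mathcal L(\mathfrak K,H)$ such that $[\alpha\mathfrak K]=H$, $[\alpha\mathfrak B]=\alpha$, $[\alpha^*\alpha]=\mathfrak B$; then $\rho_\alpha:\mathfrak B^\dagger\to\mathcal L(H)$ is defined by $\rho_\alpha(c)\xi\zeta=\xi c\zeta$ for $\xi\in\alpha$, $\zeta\in\mathfrak K$. If $\mathfrak b_1,\dots,\mathfrak b_n$ are the bases $\mathfrak b$ or $\mathfrak b^\dagger$, a *$C^*$-$(\mathfrak b_1,\dots,\mathfrak b_n)$-module* is a tuple $(H,\alpha_1,\dots,\alpha_n)$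 such that each $(H,\alpha_i)$ is a $C^*$-$\mathfrak b_i$-module and $[\rho_{\alpha_i}(\mathfrak B_i^\dagger)\alpha_j]=\alpha_j$ for $i\ne j$. A *semi-morphism* $(H,\alpha_i)_i\to(K,\gamma_i)_i$ is an operator $T\in\mathcal L(H,K)$ with $T\alpha_i\subseteq\gamma_i$ for all $i$; it is a *morphism* if also $T^*\gamma_i\subseteq\alpha_i$ for all $i$. For a $C^*$-$\mathfrak b$-module $(H,\beta)$ and a $C^*$-$\mathfrak b^\dagger$-module $(K,\gamma)$, the *relative tensor product* $H\,{}_\beta\!\otimes_\gamma K$ is the Hilbert space densely spanned by elements $\xi\otimes\zeta\otimes\eta$ ($\xi\in\beta$, $\zeta\in\mathfrak K$, $\eta\in\gamma$) with $\langle\xi\otimes\zeta\otimes\eta|\xi'\otimes\zeta'\otimes\eta'\rangle=\langle\zeta|\xi^*\xi'\eta^*\eta'\zeta'\rangle$; the same applies with $\mathfrak b^\dagger$ in place of $\mathfrak b$. Let $|\xi\rangle_1\colon K\to H\,{}_\beta\!\otimes_\gamma K$, $\eta\zeta\mapsto\xi\otimes\zeta\otimes\eta$, and $|\eta\rangle_2\colon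 H\to H\,{}_\beta\!\otimes_\gamma K$, $\xi\zeta\mapsto\xi\otimes\zeta\otimes\eta$. For a further module structure $\alpha$ on $H$ or $\delta$ on $K$, put $\alpha\triangleleft\gamma=[|\gamma\rangle_2\alpha]$ and $\beta\triangleright\delta=[|\beta\rangle_1\delta]$. Write $S\otimes T$ for the operator $\xi\otimes\zeta\otimes\eta\mapsto S\xi\otimes\zeta\otimes T\eta$, and $\Sigma$ for the flip $\xi\otimes\zeta\otimes\eta\mapsto\eta\otimes\zeta\otimes\xi$. The canonical isomorphism $a\colon (H\,{}_\beta\!\otimes_\gamma K)\,{}_{\beta\triangleright\epsilon}\!\otimes_\phi L\to H\,{}_\beta\!\otimes_{\gamma\triangleleft\phi}(K\,{}_\epsilon\!\otimes_\phi L)$ is given by $|\eta\rangle_2|\xi\rangle_1\omega\mapsto|\xi\rangle_1|\eta\rangle_2\omega$ ($\omega\in K$, $\xi\in\beta$, $\eta\in\phi$). **The unitary.** Let $\mathfrak b$ be a $C^*$-base and $V$ a *$C^*$-pseudo-multiplicative unitary* over $\mathfrak b$: a $C^*$-$(\mathfrak b^\dagger,\mathfrak b,\mathfrak b^\dagger)$-module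 $(H,\hat\beta,\alpha,\beta)$ with a unitary $V\colon H\,{}_{\hat\beta}\!\otimes_\alpha H\to H\,{}_\alpha\!\otimes_\beta H$ such that $V(\alpha\triangleleft\alpha)=\alpha\triangleright\alpha$, $V(\hat\beta\triangleright\beta)=\hat\beta\triangleleft\beta$, $V(\hat\beta\triangleright\hat\beta)=\alpha\triangleright\hat\beta$, $V(\beta\triangleleft\alpha)=\beta\triangleleft\beta$ and $V_{23}V_{12}=V_{12}V_{13}V_{23}$. **Representations.** A *representation* of $V$ is a $C^*$-$(\mathfrak b,\mathfrak b^\dagger)$-module $(K,\gamma,\hat\delta)$ with a unitary $X\colon K\,{}_{\hat\delta}\!\otimes_\alpha H\to K\,{}_\gamma\!\otimes_\beta H$ such that $X(\gamma\triangleleft\alpha)=\gamma\triangleright\alpha$, $X(\hat\delta\triangleright\beta)=\hat\delta\triangleleft\beta$, $X(\hat\delta\triangleright\hat\beta)=\gamma\triangleright\hat\beta$ and $V_{23}X_{12}=X_{12}X_{13}V_{23}$. Here legs are formed with $a$, and for a space $L$ with a $C^*$-$\mathfrak b$-module structure $\epsilon$ the operator $$X_{13}\colon K\,{}_{\hat\delta}\!\otimes_{\epsilon\triangleright\alpha}(L\,{}_\epsilon\!\otimes_\beta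 H)\to(K\,{}_{\hat\delta}\!\otimes_\epsilon L)\,{}_{\gamma\triangleleft\epsilon}\!\otimes_\beta H$$ acts like $X$ on the first and last factor, i.e. $X_{13}=\Sigma_{23}(X\otimes\mathrm{Id})\,a^{-1}(\mathrm{Id}\otimes\Sigma)$ with $\Sigma_{23}|\eta\rangle_2|\xi\rangle_2\omega=|\xi\rangle_2|\eta\rangle_2\omega$ for $\omega\in K$, $\xi\in\beta$, $\eta\in\epsilon$ (in the equation for representations, $L=H$ and $\epsilon=\alpha$). A *(semi-)morphism* from $(K,\gamma,\hat\delta,X)$ to $(L,\epsilon,\hat\phi,Y)$ is a (semi-)morphism $T$ of the underlying $C^*$-$(\mathfrak b,\mathfrak b^\dagger)$-modules with $Y(T\otimes\mathrm{Id})=(T\otimes\mathrm{Id})X$. Let $\mathbf{C^*\text{-}rep}_V$ and $\mathbf{C^*\text{-}rep}^s_V$ be the categories of all representations with all morphisms and with all semi-morphisms, respectively. **Theorem.** The following data are well defined in $\mathbf{C^*\text{-}rep}_V$ and in $\mathbf{C^*\text{-}rep}^s_V$: * for representations $X$ on $(K,\gamma,\hat\delta)$ and $Y$ on $(L,\epsilon,\hat\phi)$,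 the tensor product $X\boxtimes Y=X_{13}Y_{23}$, a representation on $(K\,{}_{\hat\delta}\!\otimes_\epsilon L,\ \gamma\triangleleft\epsilon,\ \hat\delta\triangleright\hat\phi)$; for (semi-)morphisms $S,T$, the tensor product $S\otimes T$; * the trivial representation $\mathbf 1_V=\Psi^*\Phi$ on $(\mathfrak K,\mathfrak B,\mathfrak B^\dagger)$, where $\Phi\colon\mathfrak K\,{}_{\mathfrak B^\dagger}\!\otimes_\alpha H\to H$, $b^\dagger\otimes\omega\mapsto\rho_\alpha(b^\dagger)\omega$, and $\Psi\colon\mathfrak K\,{}_{\mathfrak B}\!\otimes_\beta H\to H$, $b\otimes\omega\mapsto\rho_\beta(b)\omega$; * the associativity isomorphisms $(X\boxtimes Y)\boxtimes Z\to X\boxtimes(Y\boxtimes Z)$ given by the unitaries $a$ above; * the unit isomorphisms $l_X\colon\mathbf 1_V\boxtimes X\to X$ and $r_X\colon X\boxtimes\mathbf 1_V\to X$ given, for $X$ on $(K,\gamma,\hat\delta)$, by the unitaries $b^\dagger\otimes\zeta\otimes\eta\mapsto\eta b^\dagger\zeta$ ($b^\dagger\in\mathfrak B^\dagger$, $\eta\in\gamma$)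 and $\xi\otimes\zeta\otimes b\mapsto\xi b\zeta$ ($\xi\in\hat\delta$, $b\in\mathfrak B$). With these data, $\mathbf{C^*\text{-}rep}^s_V$ is a tensor category, that is, a monoidal category, with complex linear spaces of arrows and bilinear tensor product. With these data, the operator norm and the adjoint, $\mathbf{C^*\text{-}rep}_V$ is a $C^*$-tensor category, that is: * it is a $C^*$-category: a complex linear category whose spaces of arrows are Banach spaces with $\|gf\|\le\|g\|\|f\|$, with a conjugate-linear contravariant involution $*$ such that $\|f^*f\|=\|f\|^2$ and $f^*f$ is of the form $g^*g$ with $g\in\mathrm{End}(X)$ for every $f\colon X\to Y$; * it is monoidal with bilinear tensor product, $(S\otimes T)^*=S^*\otimes T^*$, and its associativity and unit isomorphisms are unitary. -/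

import Mathlib

open ContinuousLinearMap CategoryTheory
open scoped InnerProductSpace ComplexOrder

universe u

noncomputable section

namespace CStarPMU

section Operators

variable {E F : Type u}
  [NormedAddCommGroup E] [InnerProductSpace ℂ E] [CompleteSpace E]
  [NormedAddCommGroup F] [InnerProductSpace ℂ F] [CompleteSpace F]

/-- The closed linear span `[S]` of a subset `S` of a normed space. -/
def clSpan {M : Type*} [NormedAddCommGroup M] [NormedSpace ℂ M] (S : Set M) : Submodule ℂ M :=
  (Submodule.span ℂ S).topologicalClosure

open scoped Classical in
/-- The bounded operator given by the formula `x ↦ y` for all `(x, y) ∈ G`. It is used only where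
the first components of `G` span a dense subspace and where such an operator exists, so that it is
the unique one; the value `0` is a default. -/
def opOfGraph (G : Set (E × F)) : E →L[ℂ] F :=
  if h : ∃ T : E →L[ℂ] F, ∀ p ∈ G, T p.1 = p.2 then h.choose else 0

/-- `T` is a unitary operator. -/
def IsUnitaryOp (T : E →L[ℂ] F) : Prop :=
  adjoint T ∘L T = ContinuousLinearMap.id ℂ E ∧ T ∘L adjoint T = ContinuousLinearMap.id ℂ F

theorem ext_of_dense {E F : Type*} [NormedAddCommGroup E] [NormedSpace ℂ E]
    [NormedAddCommGroup F] [NormedSpace ℂ F] {x : Set E} (hx : clSpan x = ⊤) {S T : E →L[ℂ] F}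
    (h : ∀ v ∈ x, S v = T v) : S = T := by
  have hd : Dense (Submodule.span ℂ x : Set E) := by
    rw [Submodule.dense_iff_topologicalClosure_eq_top]; exact hx
  ext v
  have hc : Set.EqOn S T (Submodule.span ℂ x : Set E) := by
    intro w hw
    exact LinearMap.eqOn_span (f := S.toLinearMap) (g := T.toLinearMap) h hw
  exact congrFun (Continuous.ext_on hd S.continuous T.continuous hc) v

theorem opOfGraph_spec {G : Set (E × F)} (h : ∃ T : E →L[ℂ] F, ∀ p ∈ G, T p.1 = p.2) :
    ∀ p ∈ G, opOfGraph G p.1 = p.2 := by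
  unfold opOfGraph
  rw [dif_pos h]
  exact h.choose_spec

end Operators

/-! ### `C*`-bases and `C*`-modules -/

/-- A `C*`-base on the Hilbert space `𝔎`: two commuting nondegenerate `C*`-algebras
`𝔅, 𝔅† ⊆ L(𝔎)`. -/
structure CStarBase (𝔎 : Type u) [NormedAddCommGroup 𝔎] [InnerProductSpace ℂ 𝔎]
    [CompleteSpace 𝔎] where
  alg : NonUnitalStarSubalgebra ℂ (𝔎 →L[ℂ] 𝔎)
  algd : NonUnitalStarSubalgebra ℂ (𝔎 →L[ℂ] 𝔎)
  isClosed_alg : IsClosed (alg : Set (𝔎 →L[ℂ] 𝔎))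
  isClosed_algd : IsClosed (algd : Set (𝔎 →L[ℂ] 𝔎))
  nondeg_alg : clSpan {v : 𝔎 | ∃ a ∈ alg, ∃ ζ : 𝔎, v = a ζ} = ⊤
  nondeg_algd : clSpan {v : 𝔎 | ∃ a ∈ algd, ∃ ζ : 𝔎, v = a ζ} = ⊤
  comm : ∀ a ∈ alg, ∀ c ∈ algd, a * c = c * a

variable {𝔎 : Type u} [NormedAddCommGroup 𝔎] [InnerProductSpace ℂ 𝔎] [CompleteSpace 𝔎]

/-- The base `𝔟† = (𝔎, 𝔅†, 𝔅)`. -/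
def CStarBase.dag (b : CStarBase 𝔎) : CStarBase 𝔎 where
  alg := b.algd
  algd := b.alg
  isClosed_alg := b.isClosed_algd
  isClosed_algd := b.isClosed_alg
  nondeg_alg := b.nondeg_algd
  nondeg_algd := b.nondeg_alg
  comm := fun a ha c hc => (b.comm c hc a ha).symm

/-- The underlying subspace of `L(𝔎)` of the algebra `𝔅`. -/
def CStarBase.B (b : CStarBase 𝔎) : Submodule ℂ (𝔎 →L[ℂ] 𝔎) := b.alg.toSubmodule

/-- The underlying subspace of `L(𝔎)` of the algebra `𝔅†`. -/
def CStarBase.Bd (b : CStarBase 𝔎) : Submodule ℂ (𝔎 →L[ℂ] 𝔎) := b.algd.toSubmodule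

/-- Subspaces of `L(𝔎, H)`. -/
abbrev Leg (𝔎 H : Type u) [NormedAddCommGroup 𝔎] [InnerProductSpace ℂ 𝔎]
    [NormedAddCommGroup H] [InnerProductSpace ℂ H] : Type u := Submodule ℂ (𝔎 →L[ℂ] H)

variable {H K L M H' K' : Type u}
  [NormedAddCommGroup H] [InnerProductSpace ℂ H] [CompleteSpace H]
  [NormedAddCommGroup K] [InnerProductSpace ℂ K] [CompleteSpace K]
  [NormedAddCommGroup L] [InnerProductSpace ℂ L] [CompleteSpace L]
  [NormedAddCommGroup M] [InnerProductSpace ℂ M] [CompleteSpace M]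
  [NormedAddCommGroup H'] [InnerProductSpace ℂ H'] [CompleteSpace H']
  [NormedAddCommGroup K'] [InnerProductSpace ℂ K'] [CompleteSpace K']

/-- `(H, α)` is a `C*`-`𝔟`-module: `α` is closed, `[α𝔎] = H`, `[α𝔅] = α` and `[α*α] = 𝔅`. -/
structure IsModule (b : CStarBase 𝔎) (α : Leg 𝔎 H) : Prop where
  isClosed : IsClosed (α : Set (𝔎 →L[ℂ] H))
  total : clSpan {v : H | ∃ ξ ∈ α, ∃ ζ : 𝔎, v = ξ ζ} = ⊤
  right : clSpan {T : 𝔎 →L[ℂ] H | ∃ ξ ∈ α, ∃ a ∈ b.alg, T = ξ ∘L a} = α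
  full : clSpan {T : 𝔎 →L[ℂ] 𝔎 | ∃ ξ ∈ α, ∃ ξ' ∈ α, T = adjoint ξ ∘L ξ'} = b.B

/-- `ρ_α(c) ∈ L(H)`, determined by `ρ_α(c)(ξ ζ) = ξ (c ζ)`. -/
def rho (α : Leg 𝔎 H) (c : 𝔎 →L[ℂ] 𝔎) : H →L[ℂ] H :=
  opOfGraph {p | ∃ ξ ∈ α, ∃ ζ : 𝔎, p = (ξ ζ, ξ (c ζ))}

/-- `[ρ_α(𝔅†) β] = β`, where `(H, α)` is a module over the base `b`. -/
def Normalizes (b : CStarBase 𝔎) (α β : Leg 𝔎 H) : Prop :=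
  clSpan {T : 𝔎 →L[ℂ] H | ∃ c ∈ b.algd, ∃ ξ ∈ β, T = rho α c ∘L ξ} = β

/-- `(H, α, β)` is a `C*`-`(𝔟₁, 𝔟₂)`-module. -/
structure IsBimodule (b₁ b₂ : CStarBase 𝔎) (α β : Leg 𝔎 H) : Prop where
  left : IsModule b₁ α
  right : IsModule b₂ β
  left_right : Normalizes b₁ α β
  right_left : Normalizes b₂ β α

/-! ### The relative tensor product -/

/-- The inner products of `β` commute with those of `γ`. This is automatic if `β` is a module over
a base `𝔟` and `γ` is a module over `𝔟†`. -/
def LegsCommute (β : Leg 𝔎 H) (γ : Leg 𝔎 K) : Prop :=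
  ∀ ξ ∈ β, ∀ ξ' ∈ β, ∀ η ∈ γ, ∀ η' ∈ γ,
    Commute (adjoint ξ ∘L ξ' : 𝔎 →L[ℂ] 𝔎) (adjoint η ∘L η')

theorem LegsCommute.of_isModule {b : CStarBase 𝔎} {β : Leg 𝔎 H} {γ : Leg 𝔎 K}
    (hβ : IsModule b β) (hγ : IsModule b.dag γ) : LegsCommute β γ := by
  intro ξ hξ ξ' hξ' η hη η' hη'
  have h1 : (adjoint ξ ∘L ξ' : 𝔎 →L[ℂ] 𝔎) ∈ b.B := by
    rw [← hβ.full]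
    exact Submodule.le_topologicalClosure _ (Submodule.subset_span ⟨ξ, hξ, ξ', hξ', rfl⟩)
  have h2 : (adjoint η ∘L η' : 𝔎 →L[ℂ] 𝔎) ∈ b.dag.B := by
    rw [← hγ.full]
    exact Submodule.le_topologicalClosure _ (Submodule.subset_span ⟨η, hη, η', hη', rfl⟩)
  exact b.comm _ h1 _ h2

open scoped Classical in
/-- The operator-valued kernel `((ξ, η), (ξ', η')) ↦ ξ*ξ' η*η'` on `β × γ` (and `0` if the inner
products of `β` and `γ` do not commute, a case that never occurs below). -/
def rtpKernel (β : Leg 𝔎 H) (γ : Leg 𝔎 K) : Matrix (β × γ) (β × γ) (𝔎 →L[ℂ] 𝔎) :=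
  if LegsCommute β γ then
    Matrix.of fun p q => (adjoint p.1.1 ∘L q.1.1) ∘L (adjoint p.2.1 ∘L q.2.1)
  else 0

theorem exists_sqrt {E : Type*} [NormedAddCommGroup E] [InnerProductSpace ℂ E] [CompleteSpace E]
    (T : E →L[ℂ] E) (hT : 0 ≤ T) :
    ∃ R : E →L[ℂ] E, adjoint R = R ∧ R * R = T ∧ ∀ D, Commute T D → Commute R D := by
  refine ⟨CFC.sqrt T, (CFC.sqrt_nonneg T).isSelfAdjoint.star_eq, CFC.sqrt_mul_sqrt_self T hT,
    fun D hD => ?_⟩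
  have : CFC.sqrt T = cfc NNReal.sqrt T := CFC.sqrt_eq_cfc
  rw [this]
  exact hD.cfc_nnreal _

theorem exists_coordinates (𝔎 : Type u) [NormedAddCommGroup 𝔎] [InnerProductSpace ℂ 𝔎]
    [CompleteSpace 𝔎] (ι : Type*) [Fintype ι] [DecidableEq ι] :
    ∃ P : ι → PiLp 2 (fun _ : ι => 𝔎) →L[ℂ] 𝔎,
      (∀ i j v, P i (adjoint (P j) v) = if i = j then v else 0) ∧
      (∀ x, ∑ k, adjoint (P k) (P k x) = x) := by
  let P : ι → PiLp 2 (fun _ : ι => 𝔎) →L[ℂ] 𝔎 := fun i => PiLp.proj 2 (fun _ => 𝔎) i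
  have hP : ∀ i x, P i x = x i := fun i x => rfl
  have hPa : ∀ i v, adjoint (P i) v = PiLp.single 2 i v := by
    intro i v
    refine ext_inner_left ℂ fun x => ?_
    rw [adjoint_inner_right, PiLp.inner_apply]
    simp [hP, apply_ite]
  have hPP : ∀ i j v, P i (adjoint (P j) v) = if i = j then v else 0 := by
    intro i j v
    rw [hPa, hP]
    by_cases h : i = j
    · subst h; simp
    · simp [h]
  refine ⟨P, hPP, fun x => ?_⟩
  ext i
  have : P i (∑ k, adjoint (P k) (P k x)) = P i x := by
    rw [map_sum]
    simp only [hPP]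
    simp
  exact this

/-- Square root of the matrix of inner products of finitely many elements of `L(𝔎, K)`. -/
theorem exists_gram_factor {ι : Type*} [Fintype ι] (η : ι → 𝔎 →L[ℂ] K) :
    ∃ Q : ι → ι → 𝔎 →L[ℂ] 𝔎,
      (∀ i j, adjoint (η i) ∘L η j = ∑ k, adjoint (Q k i) ∘L Q k j) ∧
      ∀ a : 𝔎 →L[ℂ] 𝔎, (∀ i j, Commute a (adjoint (η i) ∘L η j)) → ∀ k i, Commute a (Q k i) := by
  classical
  obtain ⟨P, hPP, hsum⟩ := exists_coordinates 𝔎 ι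
  obtain ⟨W, hWP⟩ : ∃ W : PiLp 2 (fun _ : ι => 𝔎) →L[ℂ] K,
      ∀ j v, W (adjoint (P j) v) = η j v := by
    refine ⟨∑ i, η i ∘L P i, fun j v => ?_⟩
    simp only [sum_apply, coe_comp, Function.comp_apply, hPP, apply_ite, map_zero]
    simp
  obtain ⟨T, hT, hTW⟩ : ∃ T : PiLp 2 (fun _ : ι => 𝔎) →L[ℂ] PiLp 2 (fun _ : ι => 𝔎),
      0 ≤ T ∧ T = adjoint W ∘L W :=
    ⟨_, (nonneg_iff_isPositive _).2 (isPositive_adjoint_comp_self W), rfl⟩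
  obtain ⟨R, hRsa, hR, hRcomm⟩ := exists_sqrt T hT
  have hentry : ∀ i j v, P i (T (adjoint (P j) v)) = (adjoint (η i) ∘L η j) v := by
    intro i j v
    refine ext_inner_left ℂ fun w => ?_
    rw [hTW]
    simp only [coe_comp, Function.comp_apply]
    rw [← adjoint_inner_left, adjoint_inner_right, adjoint_inner_right, hWP, hWP]
  refine ⟨fun k i => P k ∘L R ∘L adjoint (P i), ?_, ?_⟩
  · intro i j
    ext v
    rw [← hentry i j]
    refine ext_inner_left ℂ fun w => ?_
    have h1 : T (adjoint (P j) v) = R (R (adjoint (P j) v)) := by rw [← hR]; rfl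
    have h2 : R (adjoint (P j) v) = ∑ k, adjoint (P k) (P k (R (adjoint (P j) v))) :=
      (hsum _).symm
    rw [h1, ← adjoint_inner_left, ← adjoint_inner_left R, hRsa, h2, inner_sum, sum_apply,
      inner_sum]
    refine Finset.sum_congr rfl fun k _ => ?_
    simp only [coe_comp, Function.comp_apply, adjoint_inner_right]
  · intro a ha k i
    obtain ⟨D, hDP, hDPa⟩ : ∃ D : PiLp 2 (fun _ : ι => 𝔎) →L[ℂ] PiLp 2 (fun _ : ι => 𝔎),
        (∀ i x, P i (D x) = a (P i x)) ∧ ∀ i v, D (adjoint (P i) v) = adjoint (P i) (a v) := by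
      refine ⟨∑ j, adjoint (P j) ∘L a ∘L P j, fun i x => ?_, fun i v => ?_⟩
      · simp only [sum_apply, coe_comp, Function.comp_apply, map_sum, hPP]
        simp
      · simp only [sum_apply, coe_comp, Function.comp_apply, hPP, apply_ite, map_zero]
        simp
    have hinj : ∀ x y, (∀ i, P i x = P i y) → x = y := by
      intro x y h
      rw [← hsum x, ← hsum y]
      exact Finset.sum_congr rfl fun k _ => by rw [h]
    have hcomm : Commute T D := by
      have : ∀ x, T (D x) = D (T x) := by
        intro x
        refine hinj _ _ fun i => ?_
        rw [hDP, ← hsum x]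
        simp only [map_sum]
        refine Finset.sum_congr rfl fun j _ => ?_
        rw [hDPa, hentry, hentry]
        exact (DFunLike.congr_fun (ha i j) (P j x)).symm
      exact ContinuousLinearMap.ext this
    have hRD := hRcomm D hcomm
    have hRD' : ∀ x, R (D x) = D (R x) := fun x => DFunLike.congr_fun hRD x
    refine ContinuousLinearMap.ext fun v => ?_
    change a (P k (R (adjoint (P i) v))) = P k (R (adjoint (P i) (a v)))
    rw [← hDP, ← hDPa, hRD']

theorem sum_inner_eq {ι κ : Type*} [Fintype ι] [Fintype κ] (x : ι → κ → H) :
    ∑ i, ∑ j, ∑ k, ⟪x i k, x j k⟫_ℂ = ((∑ k, ‖∑ i, x i k‖ ^ 2 : ℝ) : ℂ) := by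
  have h : ∀ k, ((‖∑ i, x i k‖ ^ 2 : ℝ) : ℂ) = ∑ i, ∑ j, ⟪x i k, x j k⟫_ℂ := by
    intro k
    have h0 : ((‖∑ i, x i k‖ ^ 2 : ℝ) : ℂ) = ⟪∑ i, x i k, ∑ i, x i k⟫_ℂ := by
      rw [Complex.ofReal_pow]
      exact (inner_self_eq_norm_sq_to_K (𝕜 := ℂ) (∑ i, x i k)).symm
    rw [h0, sum_inner]
    refine Finset.sum_congr rfl fun i _ => ?_
    rw [inner_sum]
  rw [Complex.ofReal_sum, Finset.sum_congr rfl fun k _ => h k, Finset.sum_comm (γ := κ)]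
  exact Finset.sum_congr rfl fun i _ => Finset.sum_comm

theorem gram_formula {ι : Type*} [Fintype ι] {Q : ι → ι → 𝔎 →L[ℂ] 𝔎} {η : ι → 𝔎 →L[ℂ] K}
    (hQ : ∀ i j, adjoint (η i) ∘L η j = ∑ k, adjoint (Q k i) ∘L Q k j)
    (hQ' : ∀ a : 𝔎 →L[ℂ] 𝔎, (∀ i j, Commute a (adjoint (η i) ∘L η j)) → ∀ k i, Commute a (Q k i))
    (ξ : ι → 𝔎 →L[ℂ] H)
    (hc : ∀ i j i' j', Commute (adjoint (ξ i) ∘L ξ j : 𝔎 →L[ℂ] 𝔎) (adjoint (η i') ∘L η j'))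
    (ζ : ι → 𝔎) :
    ∑ i, ∑ j, ⟪ζ i, (adjoint (ξ i) ∘L ξ j) ((adjoint (η i) ∘L η j) (ζ j))⟫_ℂ =
      ((∑ k, ‖∑ i, ξ i (Q k i (ζ i))‖ ^ 2 : ℝ) : ℂ) := by
  have key : ∀ i j k, ⟪ζ i, (adjoint (ξ i) ∘L ξ j) (adjoint (Q k i) (Q k j (ζ j)))⟫_ℂ =
      ⟪ξ i (Q k i (ζ i)), ξ j (Q k j (ζ j))⟫_ℂ := by
    intro i j k
    have hcomm : Commute (adjoint (ξ j) ∘L ξ i : 𝔎 →L[ℂ] 𝔎) (Q k i) :=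
      hQ' _ (fun i' j' => hc j i i' j') k i
    have e2 : adjoint (ξ j) (ξ i (Q k i (ζ i))) = Q k i (adjoint (ξ j) (ξ i (ζ i))) :=
      DFunLike.congr_fun hcomm (ζ i)
    rw [ContinuousLinearMap.comp_apply, adjoint_inner_right, ← adjoint_inner_left, adjoint_inner_right, ← e2,
      adjoint_inner_left]
  have step : ∀ i j, ⟪ζ i, (adjoint (ξ i) ∘L ξ j) ((adjoint (η i) ∘L η j) (ζ j))⟫_ℂ =
      ∑ k, ⟪ξ i (Q k i (ζ i)), ξ j (Q k j (ζ j))⟫_ℂ := by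
    intro i j
    rw [hQ i j, sum_apply, map_sum, inner_sum]
    exact Finset.sum_congr rfl fun k _ => key i j k
  rw [← sum_inner_eq fun i k => ξ i (Q k i (ζ i))]
  exact Finset.sum_congr rfl fun i _ => Finset.sum_congr rfl fun j _ => step i j

theorem rtpKernel_apply {β : Leg 𝔎 H} {γ : Leg 𝔎 K} (h : LegsCommute β γ) (p q : β × γ) :
    rtpKernel β γ p q = (adjoint p.1.1 ∘L q.1.1) ∘L (adjoint p.2.1 ∘L q.2.1) := by
  simp [rtpKernel, if_pos h]

theorem rtpKernel_posSemidef (β : Leg 𝔎 H) (γ : Leg 𝔎 K) : (rtpKernel β γ).PosSemidef := by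
  by_cases h : LegsCommute β γ
  · have tfae := (RKHS.posSemidef_tfae (K := rtpKernel β γ)).out 0 2
    refine tfae.2 ⟨?_, ?_⟩
    · ext1 p q
      rw [Matrix.conjTranspose_apply, rtpKernel_apply h, rtpKernel_apply h]
      have hs : ∀ {E : Type u} [NormedAddCommGroup E] [InnerProductSpace ℂ E] [CompleteSpace E]
          (S T : 𝔎 →L[ℂ] E), star (adjoint S ∘L T) = adjoint T ∘L S := by
        intro E _ _ _ S T
        rw [star_eq_adjoint, adjoint_comp, adjoint_adjoint]
      simp only [← mul_def, star_mul, hs]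
      exact (h _ p.1.2 _ q.1.2 _ p.2.2 _ q.2.2).symm
    · intro vv
      obtain ⟨Q, hQ, hQ'⟩ := exists_gram_factor (fun p : vv.support => (p.1.2.1 : 𝔎 →L[ℂ] K))
      have hf := gram_formula hQ hQ' (fun p : vv.support => (p.1.1.1 : 𝔎 →L[ℂ] H))
        (fun i j i' j' => h _ i.1.1.2 _ j.1.1.2 _ i'.1.2.2 _ j'.1.2.2) (fun p => vv p.1)
      have : (vv.sum fun x w => vv.sum fun x' w' => ⟪rtpKernel β γ x' x w, w'⟫_ℂ) =
          starRingEnd ℂ (∑ i : vv.support, ∑ j : vv.support, ⟪vv i.1,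
            (adjoint i.1.1.1 ∘L j.1.1.1) ((adjoint i.1.2.1 ∘L j.1.2.1) (vv j.1))⟫_ℂ) := by
        rw [Finset.sum_comm]
        simp only [map_sum, inner_conj_symm, Finsupp.sum, rtpKernel_apply h, ContinuousLinearMap.comp_apply]
        rw [← Finset.sum_coe_sort vv.support]
        refine Finset.sum_congr rfl fun i _ => ?_
        rw [← Finset.sum_coe_sort vv.support]
      rw [this, hf, Complex.conj_ofReal]
      rw [RCLike.re_eq_complex_re, Complex.ofReal_re]
      positivity
  · rw [rtpKernel, if_neg h]
    exact Matrix.PosSemidef.zero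

instance (β : Leg 𝔎 H) (γ : Leg 𝔎 K) : Fact (rtpKernel β γ).PosSemidef :=
  ⟨rtpKernel_posSemidef β γ⟩

/-- The relative tensor product `H_β ⊗ _γK`: the Hilbert space that is densely spanned by elements
`ξ ⊗ ζ ⊗ η` with `ξ ∈ β`, `ζ ∈ 𝔎`, `η ∈ γ` and
`⟨ξ ⊗ ζ ⊗ η | ξ' ⊗ ζ' ⊗ η'⟩ = ⟨ζ | ξ*ξ' η*η' ζ'⟩`. -/
def RTP (β : Leg 𝔎 H) (γ : Leg 𝔎 K) : Type u := RKHS.OfKernel (rtpKernel β γ)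

instance (β : Leg 𝔎 H) (γ : Leg 𝔎 K) : NormedAddCommGroup (RTP β γ) :=
  inferInstanceAs (NormedAddCommGroup (RKHS.OfKernel (rtpKernel β γ)))

instance (β : Leg 𝔎 H) (γ : Leg 𝔎 K) : InnerProductSpace ℂ (RTP β γ) :=
  inferInstanceAs (InnerProductSpace ℂ (RKHS.OfKernel (rtpKernel β γ)))

instance (β : Leg 𝔎 H) (γ : Leg 𝔎 K) : CompleteSpace (RTP β γ) :=
  inferInstanceAs (CompleteSpace (RKHS.OfKernel (rtpKernel β γ)))

/-- The element `ξ ⊗ ζ ⊗ η`. -/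
def tmul {β : Leg 𝔎 H} {γ : Leg 𝔎 K} (ξ : β) (ζ : 𝔎) (η : γ) : RTP β γ :=
  RKHS.kerFun (RKHS.OfKernel (rtpKernel β γ)) (ξ, η) ζ

theorem inner_tmul {β : Leg 𝔎 H} {γ : Leg 𝔎 K} (h : LegsCommute β γ)
    (ξ ξ' : β) (ζ ζ' : 𝔎) (η η' : γ) :
    ⟪tmul ξ ζ η, tmul ξ' ζ' η'⟫_ℂ =
      ⟪ζ, (adjoint ξ.1 ∘L ξ'.1) ((adjoint η.1 ∘L η'.1) ζ')⟫_ℂ := by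
  have := RKHS.kerFun_inner (𝕜 := ℂ) (H := RKHS.OfKernel (rtpKernel β γ)) (ξ, η) ζ
    (RKHS.kerFun (RKHS.OfKernel (rtpKernel β γ)) (ξ', η') ζ')
  refine Eq.trans this ?_
  rw [RKHS.kerFun_apply, RKHS.OfKernel.kernel_ofKernel, rtpKernel_apply h]
  rfl

theorem tmul_dense (β : Leg 𝔎 H) (γ : Leg 𝔎 K) :
    clSpan {v : RTP β γ | ∃ (ξ : β) (ζ : 𝔎) (η : γ), v = tmul ξ ζ η} = ⊤ := by
  have := RKHS.kerFun_dense (𝕜 := ℂ) (RKHS.OfKernel (rtpKernel β γ))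
  have hset : {v : RTP β γ | ∃ (ξ : β) (ζ : 𝔎) (η : γ), v = tmul ξ ζ η} =
      {x : RTP β γ | ∃ p v, RKHS.kerFun (RKHS.OfKernel (rtpKernel β γ)) p v = x} := by
    ext v
    constructor
    · rintro ⟨ξ, ζ, η, rfl⟩
      exact ⟨(ξ, η), ζ, rfl⟩
    · rintro ⟨⟨ξ, η⟩, ζ, rfl⟩
      exact ⟨ξ, ζ, η, rfl⟩
  rw [hset]
  exact this

/-- The operator `|ξ⟩₁ : K → H_β ⊗ _γK`, `η ζ ↦ ξ ⊗ ζ ⊗ η`. -/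
def ket1 {β : Leg 𝔎 H} {γ : Leg 𝔎 K} (ξ : β) : K →L[ℂ] RTP β γ :=
  opOfGraph {p | ∃ (ζ : 𝔎) (η : γ), p = (η.1 ζ, tmul ξ ζ η)}

/-- The operator `|η⟩₂ : H → H_β ⊗ _γK`, `ξ ζ ↦ ξ ⊗ ζ ⊗ η`. -/
def ket2 {β : Leg 𝔎 H} {γ : Leg 𝔎 K} (η : γ) : H →L[ℂ] RTP β γ :=
  opOfGraph {p | ∃ (ξ : β) (ζ : 𝔎), p = (ξ.1 ζ, tmul ξ ζ η)}

/-- `α ◁ γ = [|γ⟩₂ α] ⊆ L(𝔎, H_β ⊗ _γK)` for `α ⊆ L(𝔎, H)`. -/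
def ltri (β : Leg 𝔎 H) (γ : Leg 𝔎 K) (α : Leg 𝔎 H) : Leg 𝔎 (RTP β γ) :=
  clSpan {T | ∃ (η : γ) (ξ : α), T = ket2 η ∘L ξ.1}

/-- `β ▷ δ = [|β⟩₁ δ] ⊆ L(𝔎, H_β ⊗ _γK)` for `δ ⊆ L(𝔎, K)`. -/
def rtri (β : Leg 𝔎 H) (γ : Leg 𝔎 K) (δ : Leg 𝔎 K) : Leg 𝔎 (RTP β γ) :=
  clSpan {T | ∃ (ξ : β) (η : δ), T = ket1 ξ ∘L η.1}

/-- `S ⊗ T : H_β ⊗ _γK → H'_β' ⊗ _γ'K'`, `ξ ⊗ ζ ⊗ η ↦ Sξ ⊗ ζ ⊗ Tη`, where `Sβ ⊆ β'` and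
`Tγ ⊆ γ'`. -/
def rtpMap (β : Leg 𝔎 H) (γ : Leg 𝔎 K) (β' : Leg 𝔎 H') (γ' : Leg 𝔎 K')
    (S : H →L[ℂ] H') (T : K →L[ℂ] K') : RTP β γ →L[ℂ] RTP β' γ' :=
  opOfGraph {p | ∃ (ξ : β) (ζ : 𝔎) (η : γ) (ξ' : β') (η' : γ'),
    ξ'.1 = S ∘L ξ.1 ∧ η'.1 = T ∘L η.1 ∧ p = (tmul ξ ζ η, tmul ξ' ζ η')}

/-- The flip `Σ : H_β ⊗ _γK → K_γ ⊗ _βH`, `ξ ⊗ ζ ⊗ η ↦ η ⊗ ζ ⊗ ξ`. -/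
def flip (β : Leg 𝔎 H) (γ : Leg 𝔎 K) : RTP β γ →L[ℂ] RTP γ β :=
  opOfGraph {p | ∃ (ξ : β) (ζ : 𝔎) (η : γ), p = (tmul ξ ζ η, tmul η ζ ξ)}

/-- The associativity isomorphism `(H_β ⊗ _γK)_{β ▷ ε} ⊗ _φL → H_β ⊗ _{γ ◁ φ}(K_ε ⊗ _φL)`,
`|η⟩₂ |ξ⟩₁ ω ↦ |ξ⟩₁ |η⟩₂ ω`, for `ω ∈ K`, `ξ ∈ β`, `η ∈ φ`. -/
def assoc (β : Leg 𝔎 H) (γ ε : Leg 𝔎 K) (φ : Leg 𝔎 L) :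
    RTP (rtri β γ ε) φ →L[ℂ] RTP β (ltri ε φ γ) :=
  opOfGraph {p | ∃ (ω : K) (ξ : β) (η : φ), p = (ket2 η (ket1 ξ ω), ket1 ξ (ket2 η ω))}

/-- The isomorphism `Σ₂₃ : (K_γ ⊗ _βH)_{δ ◁ β} ⊗ _εL → (K_δ ⊗ _εL)_{γ ◁ ε} ⊗ _βH`,
`(ω ⊗ ξ) ⊗ η ↦ (ω ⊗ η) ⊗ ξ`, for `ω ∈ K`, `ξ ∈ β`, `η ∈ ε`. -/
def flip23 (γ δ : Leg 𝔎 K) (β : Leg 𝔎 H) (ε : Leg 𝔎 L) :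
    RTP (ltri γ β δ) ε →L[ℂ] RTP (ltri δ ε γ) β :=
  opOfGraph {p | ∃ (ω : K) (ξ : β) (η : ε), p = (ket2 η (ket2 ξ ω), ket2 ξ (ket2 η ω))}

/-- `A ⊗ K → K`, `a ⊗ ζ ⊗ η ↦ η a ζ`, for a subspace `A ⊆ L(𝔎)` (one of the algebras of the base);
equivalently, `a ⊗ ω ↦ ρ_γ(a) ω`. -/
def unitL (A : Leg 𝔎 𝔎) (γ : Leg 𝔎 K) : RTP A γ →L[ℂ] K :=
  opOfGraph {p | ∃ (a : A) (ζ : 𝔎) (η : γ), p = (tmul a ζ η, η.1 (a.1 ζ))}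

/-- `H ⊗ A → H`, `ξ ⊗ ζ ⊗ a ↦ ξ a ζ`, for a subspace `A ⊆ L(𝔎)` (one of the algebras of the
base). -/
def unitR (β : Leg 𝔎 H) (A : Leg 𝔎 𝔎) : RTP β A →L[ℂ] H :=
  opOfGraph {p | ∃ (ξ : β) (ζ : 𝔎) (a : A), p = (tmul ξ ζ a, ξ.1 (a.1 ζ))}

/-! ### Pseudo-multiplicative unitaries and their representations -/

/-- `X α = β` for subspaces `α ⊆ L(𝔎, H)`, `β ⊆ L(𝔎, K)` and `X ∈ L(H, K)`. -/
def MapsLegOnto (X : H →L[ℂ] K) (α : Leg 𝔎 H) (β : Leg 𝔎 K) : Prop :=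
  (fun ξ : 𝔎 →L[ℂ] H => X ∘L ξ) '' (α : Set (𝔎 →L[ℂ] H)) = (β : Set (𝔎 →L[ℂ] K))

/-- `X₁₃`: for `X : K_δ ⊗ _αH → K_γ ⊗ _βH` and a space `L` with subspace `ε`, the operator
`K_δ ⊗ _{ε ▷ α}(L_ε ⊗ _βH) → (K_δ ⊗ _εL)_{γ ◁ ε} ⊗ _βH` that is the composition of
`Id ⊗ Σ : K_δ ⊗ _{ε ▷ α}(L_ε ⊗ _βH) → K_δ ⊗ _{α ◁ ε}(H_β ⊗ _εL)`, of the identification with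
`(K_δ ⊗ _αH)_{δ ▷ β} ⊗ _εL`, of `X ⊗ Id` to `(K_γ ⊗ _βH)_{δ ◁ β} ⊗ _εL`, and of `Σ₂₃`. -/
def leg13 (α β : Leg 𝔎 H) (γ δ : Leg 𝔎 K) (ε : Leg 𝔎 L) (X : RTP δ α →L[ℂ] RTP γ β) :
    RTP δ (rtri ε β α) →L[ℂ] RTP (ltri δ ε γ) β :=
  flip23 γ δ β ε
    ∘L rtpMap (rtri δ α β) ε (ltri γ β δ) ε X (ContinuousLinearMap.id ℂ L)
    ∘L adjoint (assoc δ α β ε)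
    ∘L rtpMap δ (rtri ε β α) δ (ltri β ε α) (ContinuousLinearMap.id ℂ K) (flip ε β)

/-- The pentagon equation for `X : K_δ ⊗ _αH → K_γ ⊗ _βH`: equality of
`V₂₃ X₁₂` and `X₁₂ X₁₃ V₂₃` as operators
`(K_δ ⊗ _αH)_{δ ▷ β̂} ⊗ _αH → K_γ ⊗ _{β ◁ β}(H_α ⊗ _βH)`. -/
def Pentagon (βh α β : Leg 𝔎 H) (V : RTP βh α →L[ℂ] RTP α β)
    (γ δ : Leg 𝔎 K) (X : RTP δ α →L[ℂ] RTP γ β) : Prop :=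
  rtpMap γ (ltri βh α β) γ (ltri α β β) (ContinuousLinearMap.id ℂ K) V
      ∘L assoc γ β βh α
      ∘L rtpMap (rtri δ α βh) α (rtri γ β βh) α X (ContinuousLinearMap.id ℂ H) =
    assoc γ β α β
      ∘L rtpMap (ltri δ α γ) β (rtri γ β α) β X (ContinuousLinearMap.id ℂ H)
      ∘L leg13 α β γ δ α X
      ∘L rtpMap δ (ltri βh α α) δ (rtri α β α) (ContinuousLinearMap.id ℂ K) V
      ∘L assoc δ α βh α

/-- A `C*`-pseudo-multiplicative unitary over the base `b` on the Hilbert space `H`. -/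
structure PMU (b : CStarBase 𝔎) (H : Type u) [NormedAddCommGroup H] [InnerProductSpace ℂ H]
    [CompleteSpace H] where
  βh : Leg 𝔎 H
  α : Leg 𝔎 H
  β : Leg 𝔎 H
  /-- `(H, β̂, α, β)` is a `C*`-`(𝔟†, 𝔟, 𝔟†)`-module. -/
  bimodule_βh_α : IsBimodule b.dag b βh α
  bimodule_α_β : IsBimodule b b.dag α β
  bimodule_βh_β : IsBimodule b.dag b.dag βh β
  V : RTP βh α →L[ℂ] RTP α β
  unitary : IsUnitaryOp V
  map_α_α : MapsLegOnto V (ltri βh α α) (rtri α β α)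
  map_βh_β : MapsLegOnto V (rtri βh α β) (ltri α β βh)
  map_βh_βh : MapsLegOnto V (rtri βh α βh) (rtri α β βh)
  map_β_α : MapsLegOnto V (ltri βh α β) (ltri α β β)
  pentagon : Pentagon βh α β V α βh V

variable {b : CStarBase 𝔎}

/-- The data underlying a representation of `V`: a Hilbert space `K` with subspaces
`γ, δ ⊆ L(𝔎, K)` and an operator `X : K_δ ⊗ _αH → K_γ ⊗ _βH`. -/
structure RepData (V : PMU b H) where
  K : Type u
  [grp : NormedAddCommGroup K]
  [ips : InnerProductSpace ℂ K]
  [cpl : CompleteSpace K]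
  γ : Leg 𝔎 K
  δ : Leg 𝔎 K
  X : RTP δ V.α →L[ℂ] RTP γ V.β

attribute [instance] RepData.grp RepData.ips RepData.cpl

/-- The axioms of a representation of `V`. -/
structure IsRep (V : PMU b H) (R : RepData V) : Prop where
  bimodule : IsBimodule b b.dag R.γ R.δ
  unitary : IsUnitaryOp R.X
  map_γ_α : MapsLegOnto R.X (ltri R.δ V.α R.γ) (rtri R.γ V.β V.α)
  map_δ_β : MapsLegOnto R.X (rtri R.δ V.α V.β) (ltri R.γ V.β R.δ)
  map_δ_βh : MapsLegOnto R.X (rtri R.δ V.α V.βh) (rtri R.γ V.β V.βh)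
  pentagon : Pentagon V.βh V.α V.β V.V R.γ R.δ R.X

/-- The trivial representation `1_V = Ψ*Φ` on `(𝔎, 𝔅, 𝔅†)`, where `Φ : 𝔎 ⊗ _αH → H`,
`b† ⊗ ω ↦ ρ_α(b†) ω` and `Ψ : 𝔎 ⊗ _βH → H`, `b ⊗ ω ↦ ρ_β(b) ω`. -/
def RepData.triv (V : PMU b H) : RepData V where
  K := 𝔎
  γ := b.B
  δ := b.Bd
  X := adjoint (unitL b.B V.β) ∘L unitL b.Bd V.α

/-- The tensor product `X ⊠ Y = X₁₃ Y₂₃` on `(K_δ ⊗ _εL, γ ◁ ε, δ ▷ φ)` for `X` on `(K, γ, δ)` and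
`Y` on `(L, ε, φ)`. -/
def RepData.tensor {V : PMU b H} (R S : RepData V) : RepData V where
  K := RTP R.δ S.γ
  γ := ltri R.δ S.γ R.γ
  δ := rtri R.δ S.γ S.δ
  X := leg13 V.α V.β R.γ R.δ S.γ R.X
    ∘L rtpMap R.δ (ltri S.δ V.α S.γ) R.δ (rtri S.γ V.β V.α) (ContinuousLinearMap.id ℂ R.K) S.X
    ∘L assoc R.δ S.γ S.δ V.α

/-- The two kinds of maps between representations. -/
inductive MorKind
  | morphism
  | semi

/-- `T` is a (semi-)morphism between representations: `Tγ ⊆ ε`, `Tδ ⊆ φ` and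
`Y (T ⊗ Id) = (T ⊗ Id) X`, and for morphisms also `T*ε ⊆ γ` and `T*φ ⊆ δ`. -/
structure IsMor {V : PMU b H} (k : MorKind) (R S : RepData V) (T : R.K →L[ℂ] S.K) : Prop where
  map_γ : ∀ ξ ∈ R.γ, T ∘L ξ ∈ S.γ
  map_δ : ∀ ξ ∈ R.δ, T ∘L ξ ∈ S.δ
  adjoint_γ : k = MorKind.morphism → ∀ ξ ∈ S.γ, adjoint T ∘L ξ ∈ R.γ
  adjoint_δ : k = MorKind.morphism → ∀ ξ ∈ S.δ, adjoint T ∘L ξ ∈ R.δ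
  intertwines :
    S.X ∘L rtpMap R.δ V.α S.δ V.α T (ContinuousLinearMap.id ℂ H) =
      rtpMap R.γ V.β S.γ V.β T (ContinuousLinearMap.id ℂ H) ∘L R.X

theorem norm_tmul_sum_le {β : Leg 𝔎 H} {γ : Leg 𝔎 K} {β' : Leg 𝔎 H'}
    (h : LegsCommute β γ) (h' : LegsCommute β' γ) (S : H →L[ℂ] H')
    (hS : ∀ ξ ∈ β, S ∘L ξ ∈ β') (c : (β × 𝔎 × γ) →₀ ℂ) :
    ‖Finsupp.linearCombination ℂ
        (fun p : β × 𝔎 × γ => tmul (⟨S ∘L p.1.1, hS _ p.1.2⟩ : β') p.2.1 p.2.2) c‖ ≤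
      ‖S‖ * ‖Finsupp.linearCombination ℂ
        (fun p : β × 𝔎 × γ => tmul p.1 p.2.1 p.2.2) c‖ := by
  obtain ⟨Q, hQ, hQ'⟩ := exists_gram_factor (fun p : c.support => (p.1.2.2.1 : 𝔎 →L[ℂ] K))
  let ζ : c.support → 𝔎 := fun p => c p.1 • p.1.2.1
  have formula : ∀ {E : Type u} [NormedAddCommGroup E] [InnerProductSpace ℂ E] [CompleteSpace E]
      (β₀ : Leg 𝔎 E) (_ : LegsCommute β₀ γ) (f : β → β₀),
      ‖Finsupp.linearCombination ℂ
        (fun p : β × 𝔎 × γ => tmul (f p.1) p.2.1 p.2.2) c‖ ^ 2 =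
      ∑ k, ‖∑ i : c.support, (f i.1.1).1 (Q k i (ζ i))‖ ^ 2 := by
    intro E _ _ _ β₀ h₀ f
    have hf := gram_formula hQ hQ' (fun p : c.support => ((f p.1.1).1 : 𝔎 →L[ℂ] E))
        (fun i j i' j' => h₀ _ (f i.1.1).2 _ (f j.1.1).2 _ i'.1.2.2.2 _ j'.1.2.2.2) ζ
    have hin := inner_self_eq_norm_sq_to_K (𝕜 := ℂ) (Finsupp.linearCombination ℂ
        (fun p : β × 𝔎 × γ => tmul (f p.1) p.2.1 p.2.2) c)
    have hl : Finsupp.linearCombination ℂ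
        (fun p : β × 𝔎 × γ => tmul (f p.1) p.2.1 p.2.2) c =
        ∑ i : c.support, c i.1 • tmul (f i.1.1) i.1.2.1 i.1.2.2 := by
      rw [Finsupp.linearCombination_apply, Finsupp.sum, ← Finset.sum_coe_sort c.support]
    have : (∑ i : c.support, ∑ j : c.support, ⟪ζ i,
        (adjoint (f i.1.1).1 ∘L (f j.1.1).1) ((adjoint i.1.2.2.1 ∘L j.1.2.2.1) (ζ j))⟫_ℂ) =
        ⟪Finsupp.linearCombination ℂ (fun p : β × 𝔎 × γ => tmul (f p.1) p.2.1 p.2.2) c,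
        Finsupp.linearCombination ℂ (fun p : β × 𝔎 × γ => tmul (f p.1) p.2.1 p.2.2) c⟫_ℂ := by
      rw [hl, sum_inner]
      refine Finset.sum_congr rfl fun i _ => ?_
      rw [inner_sum]
      refine Finset.sum_congr rfl fun j _ => ?_
      have hl1 : ⟪c i.1 • tmul (f i.1.1) i.1.2.1 i.1.2.2,
          c j.1 • tmul (f j.1.1) j.1.2.1 j.1.2.2⟫_ℂ = starRingEnd ℂ (c i.1) * (c j.1 *
            ⟪tmul (f i.1.1) i.1.2.1 i.1.2.2, tmul (f j.1.1) j.1.2.1 j.1.2.2⟫_ℂ) := by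
        rw [inner_smul_left, inner_smul_right]
      rw [hl1, inner_tmul h₀]
      simp only [ζ, map_smul, inner_smul_left, inner_smul_right]
      ring
    rw [this, hin] at hf
    exact Complex.ofReal_injective ((Complex.ofReal_pow _ _).trans hf)
  have e1 := formula β' h' (fun ξ => ⟨S ∘L ξ.1, hS _ ξ.2⟩)
  have e2 := formula β h (fun ξ => ξ)
  refine abs_le_of_sq_le_sq' ?_ (by positivity) |>.2
  rw [mul_pow, e1, e2, Finset.mul_sum]
  refine Finset.sum_le_sum fun k _ => ?_
  have : ∑ i : c.support, (S ∘L i.1.1.1) (Q k i (ζ i)) =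
      S (∑ i : c.support, i.1.1.1 (Q k i (ζ i))) := by
    rw [map_sum]; rfl
  rw [this, ← mul_pow]
  gcongr
  exact S.le_opNorm _

/-- The operator `S ⊗ Id` exists and is given by the expected formula. -/
theorem rtpMap_tmul {β : Leg 𝔎 H} {γ : Leg 𝔎 K} {β' : Leg 𝔎 H'}
    (h : LegsCommute β γ) (h' : LegsCommute β' γ) (S : H →L[ℂ] H')
    (hS : ∀ ξ ∈ β, S ∘L ξ ∈ β') (ξ : β) (ζ : 𝔎) (η : γ) :
    rtpMap β γ β' γ S (ContinuousLinearMap.id ℂ K) (tmul ξ ζ η) =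
      tmul (⟨S ∘L ξ.1, hS _ ξ.2⟩ : β') ζ η := by
  refine opOfGraph_spec ?_ (tmul ξ ζ η, tmul (⟨S ∘L ξ.1, hS _ ξ.2⟩ : β') ζ η)
    ⟨ξ, ζ, η, ⟨S ∘L ξ.1, hS _ ξ.2⟩, η, rfl, rfl, rfl⟩
  let e := Finsupp.linearCombination ℂ (fun p : β × 𝔎 × γ => tmul p.1 p.2.1 p.2.2)
  let f := Finsupp.linearCombination ℂ
        (fun p : β × 𝔎 × γ => tmul (⟨S ∘L p.1.1, hS _ p.1.2⟩ : β') p.2.1 p.2.2)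
  have hd : DenseRange e := by
    have h1 := tmul_dense β γ
    unfold clSpan at h1
    rw [← Submodule.dense_iff_topologicalClosure_eq_top] at h1
    refine h1.mono ?_
    have : {v : RTP β γ | ∃ (ξ : β) (ζ : 𝔎) (η : γ), v = tmul ξ ζ η} =
        Set.range (fun p : β × 𝔎 × γ => tmul p.1 p.2.1 p.2.2) := by
      ext v
      constructor
      · rintro ⟨ξ, ζ, η, rfl⟩
        exact ⟨(ξ, ζ, η), rfl⟩
      · rintro ⟨⟨ξ, ζ, η⟩, rfl⟩
        exact ⟨ξ, ζ, η, rfl⟩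
    rw [this, ← Finsupp.range_linearCombination]
    exact subset_rfl
  refine ⟨f.extendOfNorm e, ?_⟩
  rintro p ⟨ξ, ζ, η, ξ', η', h1, h2, rfl⟩
  have hx := LinearMap.extendOfNorm_eq (f := f) (e := e) hd
    ⟨‖S‖, fun c => norm_tmul_sum_le h h' S hS c⟩ (Finsupp.single (ξ, ζ, η) 1)
  simp only [e, f, Finsupp.linearCombination_single, one_smul] at hx
  rw [hx]
  have a1 : ξ' = ⟨S ∘L ξ.1, hS _ ξ.2⟩ := Subtype.ext h1
  have a2 : η' = η := Subtype.ext (by rw [h2]; rfl)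
  rw [a1, a2]

theorem rtp_ext {β : Leg 𝔎 H} {γ : Leg 𝔎 K} {S T : RTP β γ →L[ℂ] L}
    (h : ∀ (ξ : β) (ζ : 𝔎) (η : γ), S (tmul ξ ζ η) = T (tmul ξ ζ η)) : S = T := by
  refine ext_of_dense (tmul_dense β γ) ?_
  rintro v ⟨ξ, ζ, η, rfl⟩
  exact h ξ ζ η

theorem tmul_add_left {β : Leg 𝔎 H} {γ : Leg 𝔎 K} (h : LegsCommute β γ)
    (ξ ξ' : β) (ζ : 𝔎) (η : γ) : tmul (ξ + ξ') ζ η = tmul ξ ζ η + tmul ξ' ζ η := by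
  have : innerSL ℂ (tmul (ξ + ξ') ζ η) = innerSL ℂ (tmul ξ ζ η + tmul ξ' ζ η) := by
    refine ext_of_dense (tmul_dense β γ) ?_
    rintro v ⟨ξ'', ζ'', η'', rfl⟩
    simp only [innerSL_apply_apply, inner_add_left, inner_tmul h]
    simp [add_comp]
  refine ext_inner_right ℂ fun v => ?_
  exact DFunLike.congr_fun this v

theorem tmul_smul_left {β : Leg 𝔎 H} {γ : Leg 𝔎 K} (h : LegsCommute β γ)
    (c : ℂ) (ξ : β) (ζ : 𝔎) (η : γ) : tmul (c • ξ) ζ η = c • tmul ξ ζ η := by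
  have : innerSL ℂ (tmul (c • ξ) ζ η) = innerSL ℂ (c • tmul ξ ζ η) := by
    refine ext_of_dense (tmul_dense β γ) ?_
    rintro v ⟨ξ'', ζ'', η'', rfl⟩
    simp only [innerSL_apply_apply, inner_smul_left, inner_tmul h]
    simp [map_smulₛₗ]
  refine ext_inner_right ℂ fun v => ?_
  exact DFunLike.congr_fun this v

/-! ### The categories of representations -/

/-- The class of representations of `V`, considered as the objects of the category whose arrows are
all morphisms or all semi-morphisms. -/
structure Rep (V : PMU b H) (k : MorKind) where
  data : RepData V
  isRep : IsRep V data

variable {V : PMU b H} {k : MorKind}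

theorem Rep.commute_δ (R : Rep V k) : LegsCommute R.data.δ V.α :=
  LegsCommute.of_isModule (b := b.dag) R.isRep.bimodule.right V.bimodule_α_β.left

theorem Rep.commute_γ (R : Rep V k) : LegsCommute R.data.γ V.β :=
  LegsCommute.of_isModule (b := b) R.isRep.bimodule.left V.bimodule_α_β.right

theorem rtpMap_add {β : Leg 𝔎 H} {γ : Leg 𝔎 K} {β' : Leg 𝔎 H'}
    (h : LegsCommute β γ) (h' : LegsCommute β' γ) {S T : H →L[ℂ] H'}
    (hS : ∀ ξ ∈ β, S ∘L ξ ∈ β') (hT : ∀ ξ ∈ β, T ∘L ξ ∈ β') :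
    rtpMap β γ β' γ (S + T) (ContinuousLinearMap.id ℂ K) =
      rtpMap β γ β' γ S (ContinuousLinearMap.id ℂ K) +
        rtpMap β γ β' γ T (ContinuousLinearMap.id ℂ K) := by
  have hST : ∀ ξ ∈ β, (S + T) ∘L ξ ∈ β' := fun ξ hξ => by
    rw [add_comp]; exact add_mem (hS ξ hξ) (hT ξ hξ)
  refine rtp_ext fun ξ ζ η => ?_
  rw [add_apply, rtpMap_tmul h h' _ hST, rtpMap_tmul h h' _ hS, rtpMap_tmul h h' _ hT,
    ← tmul_add_left h']
  congr 1

theorem rtpMap_smul {β : Leg 𝔎 H} {γ : Leg 𝔎 K} {β' : Leg 𝔎 H'}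
    (h : LegsCommute β γ) (h' : LegsCommute β' γ) (c : ℂ) {S : H →L[ℂ] H'}
    (hS : ∀ ξ ∈ β, S ∘L ξ ∈ β') :
    rtpMap β γ β' γ (c • S) (ContinuousLinearMap.id ℂ K) =
      c • rtpMap β γ β' γ S (ContinuousLinearMap.id ℂ K) := by
  have hcS : ∀ ξ ∈ β, (c • S) ∘L ξ ∈ β' := fun ξ hξ => by
    rw [smul_comp]; exact Submodule.smul_mem _ _ (hS ξ hξ)
  refine rtp_ext fun ξ ζ η => ?_
  rw [smul_apply, rtpMap_tmul h h' _ hcS, rtpMap_tmul h h' _ hS, ← tmul_smul_left h']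
  congr 1

theorem rtpMap_zero {β : Leg 𝔎 H} {γ : Leg 𝔎 K} {β' : Leg 𝔎 H'}
    (h : LegsCommute β γ) (h' : LegsCommute β' γ) :
    rtpMap β γ β' γ 0 (ContinuousLinearMap.id ℂ K) = 0 := by
  have h0 : ∀ ξ ∈ β, (0 : H →L[ℂ] H') ∘L ξ ∈ β' := fun ξ _ => by
    rw [zero_comp]; exact Submodule.zero_mem _
  have := rtpMap_smul h h' (0 : ℂ) h0
  rwa [zero_smul, zero_smul] at this

theorem rtpMap_id {β : Leg 𝔎 H} {γ : Leg 𝔎 K} (h : LegsCommute β γ) :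
    rtpMap β γ β γ (ContinuousLinearMap.id ℂ H) (ContinuousLinearMap.id ℂ K) =
      ContinuousLinearMap.id ℂ (RTP β γ) := by
  refine rtp_ext fun ξ ζ η => ?_
  rw [rtpMap_tmul h h _ (fun ξ hξ => by rwa [id_comp])]
  rfl

theorem rtpMap_comp {β : Leg 𝔎 H} {γ : Leg 𝔎 K} {β' : Leg 𝔎 H'} {β'' : Leg 𝔎 L}
    (h : LegsCommute β γ) (h' : LegsCommute β' γ) (h'' : LegsCommute β'' γ)
    {S : H →L[ℂ] H'} {T : H' →L[ℂ] L}
    (hS : ∀ ξ ∈ β, S ∘L ξ ∈ β') (hT : ∀ ξ ∈ β', T ∘L ξ ∈ β'') :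
    rtpMap β γ β'' γ (T ∘L S) (ContinuousLinearMap.id ℂ K) =
      rtpMap β' γ β'' γ T (ContinuousLinearMap.id ℂ K) ∘L
        rtpMap β γ β' γ S (ContinuousLinearMap.id ℂ K) := by
  refine rtp_ext fun ξ ζ η => ?_
  rw [rtpMap_tmul h h'' _ (fun ξ hξ => by rw [comp_assoc]; exact hT _ (hS ξ hξ)),
    ContinuousLinearMap.comp_apply, rtpMap_tmul h h' _ hS, rtpMap_tmul h' h'' _ hT]
  rfl

/-- The space of (semi-)morphisms, according to `k`, between two representations. -/
def homs (R S : Rep V k) : Submodule ℂ (R.data.K →L[ℂ] S.data.K) where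
  carrier := {T | IsMor k R.data S.data T}
  add_mem' {S T} hS hT :=
    { map_γ := fun ξ hξ => by rw [add_comp]; exact add_mem (hS.map_γ ξ hξ) (hT.map_γ ξ hξ)
      map_δ := fun ξ hξ => by rw [add_comp]; exact add_mem (hS.map_δ ξ hξ) (hT.map_δ ξ hξ)
      adjoint_γ := fun hk ξ hξ => by
        rw [map_add, add_comp]; exact add_mem (hS.adjoint_γ hk ξ hξ) (hT.adjoint_γ hk ξ hξ)
      adjoint_δ := fun hk ξ hξ => by
        rw [map_add, add_comp]; exact add_mem (hS.adjoint_δ hk ξ hξ) (hT.adjoint_δ hk ξ hξ)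
      intertwines := by
        rw [rtpMap_add R.commute_δ (Rep.commute_δ _) hS.map_δ hT.map_δ,
          rtpMap_add R.commute_γ (Rep.commute_γ _) hS.map_γ hT.map_γ, comp_add, add_comp,
          hS.intertwines, hT.intertwines] }
  zero_mem' :=
    { map_γ := fun ξ _ => by rw [zero_comp]; exact Submodule.zero_mem _
      map_δ := fun ξ _ => by rw [zero_comp]; exact Submodule.zero_mem _
      adjoint_γ := fun _ ξ _ => by rw [map_zero, zero_comp]; exact Submodule.zero_mem _
      adjoint_δ := fun _ ξ _ => by rw [map_zero, zero_comp]; exact Submodule.zero_mem _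
      intertwines := by
        rw [rtpMap_zero R.commute_δ S.commute_δ, rtpMap_zero R.commute_γ S.commute_γ, comp_zero,
          zero_comp] }
  smul_mem' c S hS :=
    { map_γ := fun ξ hξ => by rw [smul_comp]; exact Submodule.smul_mem _ _ (hS.map_γ ξ hξ)
      map_δ := fun ξ hξ => by rw [smul_comp]; exact Submodule.smul_mem _ _ (hS.map_δ ξ hξ)
      adjoint_γ := fun hk ξ hξ => by
        rw [map_smulₛₗ, smul_comp]; exact Submodule.smul_mem _ _ (hS.adjoint_γ hk ξ hξ)
      adjoint_δ := fun hk ξ hξ => by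
        rw [map_smulₛₗ, smul_comp]; exact Submodule.smul_mem _ _ (hS.adjoint_δ hk ξ hξ)
      intertwines := by
        rw [rtpMap_smul R.commute_δ (Rep.commute_δ _) c hS.map_δ,
          rtpMap_smul R.commute_γ (Rep.commute_γ _) c hS.map_γ, comp_smul, smul_comp,
          hS.intertwines] }

theorem id_mem_homs (R : Rep V k) : ContinuousLinearMap.id ℂ R.data.K ∈ homs R R where
  map_γ := fun ξ hξ => by rwa [id_comp]
  map_δ := fun ξ hξ => by rwa [id_comp]
  adjoint_γ := fun _ ξ hξ => by rwa [adjoint_id, id_comp]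
  adjoint_δ := fun _ ξ hξ => by rwa [adjoint_id, id_comp]
  intertwines := by
    rw [rtpMap_id R.commute_δ, rtpMap_id R.commute_γ, id_comp, comp_id]

theorem comp_mem_homs {P R S : Rep V k} {A : P.data.K →L[ℂ] R.data.K} {B : R.data.K →L[ℂ] S.data.K}
    (hA : A ∈ homs P R) (hB : B ∈ homs R S) : B ∘L A ∈ homs P S where
  map_γ := fun ξ hξ => by rw [comp_assoc]; exact hB.map_γ _ (hA.map_γ ξ hξ)
  map_δ := fun ξ hξ => by rw [comp_assoc]; exact hB.map_δ _ (hA.map_δ ξ hξ)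
  adjoint_γ := fun hk ξ hξ => by
    rw [adjoint_comp, comp_assoc]; exact hA.adjoint_γ hk _ (hB.adjoint_γ hk ξ hξ)
  adjoint_δ := fun hk ξ hξ => by
    rw [adjoint_comp, comp_assoc]; exact hA.adjoint_δ hk _ (hB.adjoint_δ hk ξ hξ)
  intertwines := by
    rw [rtpMap_comp P.commute_δ R.commute_δ S.commute_δ hA.map_δ hB.map_δ,
      rtpMap_comp P.commute_γ R.commute_γ S.commute_γ hA.map_γ hB.map_γ, ← comp_assoc,
      hB.intertwines, comp_assoc, hA.intertwines, comp_assoc]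

/-- The category of representations of `V` and morphisms (`k = morphism`) or semi-morphisms
(`k = semi`). -/
instance : Category (Rep V k) where
  Hom R S := homs R S
  id R := ⟨ContinuousLinearMap.id ℂ R.data.K, id_mem_homs R⟩
  comp f g := ⟨g.1 ∘L f.1, comp_mem_homs f.2 g.2⟩

/-- The operator underlying a (semi-)morphism. -/
def op {R S : Rep V k} (f : R ⟶ S) : R.data.K →L[ℂ] S.data.K := f.1

theorem op_mem {R S : Rep V k} (f : R ⟶ S) : op f ∈ homs R S := f.2

instance : Preadditive (Rep V k) where
  homGroup R S := inferInstanceAs (AddCommGroup (homs R S))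
  add_comp _ _ _ f f' g := Subtype.ext (comp_add g.1 f.1 f'.1)
  comp_add _ _ _ f g g' := Subtype.ext (add_comp g.1 g'.1 f.1)

instance : Linear ℂ (Rep V k) where
  homModule R S := inferInstanceAs (Module ℂ (homs R S))
  smul_comp _ _ _ c f g := Subtype.ext (comp_smul g.1 c f.1)
  comp_smul _ _ _ f c g := Subtype.ext (smul_comp c g.1 f.1)

/-- The proposition that the following formulas define objects, arrows and isomorphisms of the
category of representations of `V` with (semi-)morphisms: the tensor product `X ⊠ Y`, the trivial
representation `1_V`, the tensor product `S ⊗ T` of arrows, the associativity isomorphisms and the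
unit isomorphisms of the relative tensor product (which are unitary operators). -/
structure TensorStructureWellDefined (V : PMU b H) (k : MorKind) : Prop where
  tensor_isRep : ∀ R S : RepData V, IsRep V R → IsRep V S → IsRep V (R.tensor S)
  triv_isRep : IsRep V (RepData.triv V)
  tensorHom_isMor : ∀ (R S R' S' : Rep V k) (f : R ⟶ R') (g : S ⟶ S'),
    IsMor k (R.data.tensor S.data) (R'.data.tensor S'.data)
      (rtpMap R.data.δ S.data.γ R'.data.δ S'.data.γ (op f) (op g))
  tensorHom_apply : ∀ (R S R' S' : Rep V k) (f : R ⟶ R') (g : S ⟶ S')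
    (ξ : R.data.δ) (ζ : 𝔎) (η : S.data.γ),
    rtpMap R.data.δ S.data.γ R'.data.δ S'.data.γ (op f) (op g) (tmul ξ ζ η) =
      tmul (⟨op f ∘L ξ.1, (op_mem f).map_δ _ ξ.2⟩ : R'.data.δ) ζ
        (⟨op g ∘L η.1, (op_mem g).map_γ _ η.2⟩ : S'.data.γ)
  assoc_unitary : ∀ P R S : Rep V k,
    IsUnitaryOp (assoc P.data.δ R.data.γ R.data.δ S.data.γ)
  assoc_apply : ∀ (P R S : Rep V k) (ω : R.data.K) (ξ : P.data.δ) (η : S.data.γ),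
    assoc P.data.δ R.data.γ R.data.δ S.data.γ (ket2 η (ket1 ξ ω)) = ket1 ξ (ket2 η ω)
  assoc_isMor : ∀ P R S : Rep V k,
    IsMor k ((P.data.tensor R.data).tensor S.data) (P.data.tensor (R.data.tensor S.data))
      (assoc P.data.δ R.data.γ R.data.δ S.data.γ)
  assoc_inv_isMor : ∀ P R S : Rep V k,
    IsMor k (P.data.tensor (R.data.tensor S.data)) ((P.data.tensor R.data).tensor S.data)
      (adjoint (assoc P.data.δ R.data.γ R.data.δ S.data.γ))
  unitL_unitary : ∀ R : Rep V k, IsUnitaryOp (unitL b.Bd R.data.γ)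
  unitL_apply : ∀ (R : Rep V k) (a : b.Bd) (ζ : 𝔎) (η : R.data.γ),
    unitL b.Bd R.data.γ (tmul a ζ η) = η.1 (a.1 ζ)
  unitL_isMor : ∀ R : Rep V k,
    IsMor k ((RepData.triv V).tensor R.data) R.data (unitL b.Bd R.data.γ)
  unitL_inv_isMor : ∀ R : Rep V k,
    IsMor k R.data ((RepData.triv V).tensor R.data) (adjoint (unitL b.Bd R.data.γ))
  unitR_unitary : ∀ R : Rep V k, IsUnitaryOp (unitR R.data.δ b.B)
  unitR_apply : ∀ (R : Rep V k) (ξ : R.data.δ) (ζ : 𝔎) (a : b.B),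
    unitR R.data.δ b.B (tmul ξ ζ a) = ξ.1 (a.1 ζ)
  unitR_isMor : ∀ R : Rep V k,
    IsMor k (R.data.tensor (RepData.triv V)) R.data (unitR R.data.δ b.B)
  unitR_inv_isMor : ∀ R : Rep V k,
    IsMor k R.data (R.data.tensor (RepData.triv V)) (adjoint (unitR R.data.δ b.B))

/-- The data of a monoidal category given by the formulas above. -/
@[reducible] def TensorStructureWellDefined.monoidalStruct (h : TensorStructureWellDefined V k) :
    MonoidalCategoryStruct (Rep V k) where
  tensorObj R S := ⟨R.data.tensor S.data, h.tensor_isRep _ _ R.isRep S.isRep⟩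
  tensorUnit := ⟨RepData.triv V, h.triv_isRep⟩
  tensorHom {R R' S S'} f g := ⟨_, h.tensorHom_isMor R S R' S' f g⟩
  whiskerLeft R _ _ f := ⟨_, h.tensorHom_isMor R _ R _ (𝟙 R) f⟩
  whiskerRight f S := ⟨_, h.tensorHom_isMor _ S _ S f (𝟙 S)⟩
  associator P R S :=
    { hom := ⟨_, h.assoc_isMor P R S⟩
      inv := ⟨_, h.assoc_inv_isMor P R S⟩
      hom_inv_id := Subtype.ext (h.assoc_unitary P R S).1
      inv_hom_id := Subtype.ext (h.assoc_unitary P R S).2 }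
  leftUnitor R :=
    { hom := ⟨_, h.unitL_isMor R⟩
      inv := ⟨_, h.unitL_inv_isMor R⟩
      hom_inv_id := Subtype.ext (h.unitL_unitary R).1
      inv_hom_id := Subtype.ext (h.unitL_unitary R).2 }
  rightUnitor R :=
    { hom := ⟨_, h.unitR_isMor R⟩
      inv := ⟨_, h.unitR_inv_isMor R⟩
      hom_inv_id := Subtype.ext (h.unitR_unitary R).1
      inv_hom_id := Subtype.ext (h.unitR_unitary R).2 }

/-! ### `C*`-tensor categories -/

/-- A `C*`-category: a complex linear category whose spaces of arrows are Banach spaces, with a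
conjugate-linear involution `f ↦ f*` that reverses arrows, such that `‖gf‖ ≤ ‖g‖ ‖f‖`,
`‖f*f‖ = ‖f‖²`, and `f*f` is a positive element of `End(X)` for every `f : X ⟶ Y`. -/
class CStarCategory (C : Type*) [Category C] [Preadditive C] [Linear ℂ C] where
  nrm : ∀ {X Y : C}, (X ⟶ Y) → ℝ
  inv : ∀ {X Y : C}, (X ⟶ Y) → (Y ⟶ X)
  nrm_eq_zero_iff : ∀ {X Y : C} (f : X ⟶ Y), nrm f = 0 ↔ f = 0
  nrm_add_le : ∀ {X Y : C} (f g : X ⟶ Y), nrm (f + g) ≤ nrm f + nrm g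
  nrm_smul : ∀ {X Y : C} (c : ℂ) (f : X ⟶ Y), nrm (c • f) = ‖c‖ * nrm f
  complete : ∀ {X Y : C} (f : ℕ → (X ⟶ Y)),
    (∀ ε > (0 : ℝ), ∃ N, ∀ m ≥ N, ∀ n ≥ N, nrm (f m - f n) < ε) →
      ∃ g : X ⟶ Y, ∀ ε > (0 : ℝ), ∃ N, ∀ n ≥ N, nrm (f n - g) < ε
  nrm_comp_le : ∀ {X Y Z : C} (f : X ⟶ Y) (g : Y ⟶ Z), nrm (f ≫ g) ≤ nrm g * nrm f
  inv_inv : ∀ {X Y : C} (f : X ⟶ Y), inv (inv f) = f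
  inv_add : ∀ {X Y : C} (f g : X ⟶ Y), inv (f + g) = inv f + inv g
  inv_smul : ∀ {X Y : C} (c : ℂ) (f : X ⟶ Y), inv (c • f) = starRingEnd ℂ c • inv f
  inv_comp : ∀ {X Y Z : C} (f : X ⟶ Y) (g : Y ⟶ Z), inv (f ≫ g) = inv g ≫ inv f
  nrm_inv_comp : ∀ {X Y : C} (f : X ⟶ Y), nrm (f ≫ inv f) = nrm f ^ 2
  positive : ∀ {X Y : C} (f : X ⟶ Y), ∃ g : X ⟶ X, f ≫ inv f = g ≫ inv g

open scoped MonoidalCategory in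
/-- A `C*`-tensor category: a `C*`-category with a monoidal structure whose tensor product is
bilinear on arrows and satisfies `(f ⊗ g)* = f* ⊗ g*`, and whose associativity and unit isomorphisms
are unitary. -/
class CStarTensorCategory (C : Type*) [Category C] [Preadditive C] [Linear ℂ C]
    [MonoidalCategory C] extends CStarCategory C where
  bilinear : ∃ _ : MonoidalPreadditive C, MonoidalLinear ℂ C
  inv_tensor : ∀ {X Y X' Y' : C} (f : X ⟶ X') (g : Y ⟶ Y'), inv (f ⊗ₘ g) = inv f ⊗ₘ inv g
  inv_associator : ∀ X Y Z : C, inv (α_ X Y Z).hom = (α_ X Y Z).inv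
  inv_leftUnitor : ∀ X : C, inv (λ_ X).hom = (λ_ X).inv
  inv_rightUnitor : ∀ X : C, inv (ρ_ X).hom = (ρ_ X).inv

end CStarPMU

end

set_option linter.unusedSectionVars false

noncomputable section

namespace CStarPMU

variable {𝔎 : Type u} [NormedAddCommGroup 𝔎] [InnerProductSpace ℂ 𝔎] [CompleteSpace 𝔎]
variable {H K L M H' K' L' : Type u}
  [NormedAddCommGroup H] [InnerProductSpace ℂ H] [CompleteSpace H]
  [NormedAddCommGroup K] [InnerProductSpace ℂ K] [CompleteSpace K]
  [NormedAddCommGroup L] [InnerProductSpace ℂ L] [CompleteSpace L]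
  [NormedAddCommGroup M] [InnerProductSpace ℂ M] [CompleteSpace M]
  [NormedAddCommGroup H'] [InnerProductSpace ℂ H'] [CompleteSpace H']
  [NormedAddCommGroup K'] [InnerProductSpace ℂ K'] [CompleteSpace K']
  [NormedAddCommGroup L'] [InnerProductSpace ℂ L'] [CompleteSpace L']

section

/-! ### Closed linear spans and unitary operators -/

/-! The operators of the statement are prescribed on total sets of vectors. The flips, the
rebracketings and the unit maps exist and are unitary because their formulas preserve inner products
(`exists_clm_of_inner_eq`, `isUnitaryOp_of_inner_eq`); for `S ⊗ Id` a norm estimate replaces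
isometry. Inner products are computed with kets: `|ξ⟩₁* |ξ'⟩₁ = ρ_γ(ξ*ξ')` and `|η⟩₂* |η'⟩₂ =
ρ_β(η*η')`. Compatible module structures on one space have commuting `ρ`'s (`rho_comm`), and this is
why rebracketing and `Σ₂₃` are isometric. The same formulas, together with `[γ*γ] = 𝔅†`, turn `α ◁
γ` and `β ▷ δ` into module structures (`mod_ltri`, `mod_rtri`). All conditions on legs are
propagated through compositions as statements that a unitary maps one leg onto another (`LegU`).

The operator `X₁₃` is determined by `X₁₃ (Id ⊗ |η⟩₁) = (|η⟩₂ ⊗ Id) X` for `η ∈ ε`, since these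
insertions have total range (`leg13_rtpMap_ket1`, `leg13_ext`). So identities for `X₁₃` reduce to
identities for `X`: it is natural in the middle space, the pentagon equation survives an idle middle
factor (`pentagon_leg`), and `X ⊠ Y` with an idle middle factor splits into its two constituents
(`leg13_tensorX`). If the factors `K, L, H, H` are numbered 1 to 4, the pentagon equation for `X ⊠
Y` becomes `V₃₄ X₁₃ Y₂₃ = X₁₃ X₁₄ V₃₄ Y₂₃ = X₁₃ X₁₄ Y₂₃ Y₂₄ V₃₄ = X₁₃ Y₂₃ X₁₄ Y₂₄ V₃₄`: the
equations for `X` and for `Y`, then naturality of `X₁₄` along `Y₂₃`.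

After its domain and its target are identified with `H` through `Φ` and `Ψ`, the trivial
representation is the identity of `H`. Its pentagon equation and the intertwining property of the
unit isomorphisms then follow from naturality of the unit maps and from the fact that `V` and `X`,
which respect legs, commute with the corresponding `ρ`'s (`comp_rho`).

The coherence identities are checked on kets. For the `C*`-structure, spaces of arrows are closed
subspaces of spaces of operators (`isClosed_homs`), morphisms are stable under adjoints because the
`X`'s are unitary, and `f*f` has its square root in the closed `*`-algebra of endomorphisms. -/

theorem subset_clSpan {M : Type*} [NormedAddCommGroup M] [NormedSpace ℂ M] {S : Set M} {x : M}
    (hx : x ∈ S) : x ∈ clSpan S :=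
  Submodule.le_topologicalClosure _ (Submodule.subset_span hx)

theorem isClosed_clSpan {M : Type*} [NormedAddCommGroup M] [NormedSpace ℂ M] (S : Set M) :
    IsClosed (clSpan S : Set M) :=
  Submodule.isClosed_topologicalClosure _

theorem clSpan_le {M : Type*} [NormedAddCommGroup M] [NormedSpace ℂ M] {S : Set M}
    {N : Submodule ℂ M} (hN : IsClosed (N : Set M)) (h : ∀ x ∈ S, x ∈ N) : clSpan S ≤ N :=
  Submodule.topologicalClosure_minimal _ (Submodule.span_le.2 h) hN

/-- A continuous linear map sends a closed linear span into a closed subspace as soon as it sends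
the generators there. -/
theorem map_mem_of_mem_clSpan {M N : Type*} [NormedAddCommGroup M] [NormedSpace ℂ M]
    [NormedAddCommGroup N] [NormedSpace ℂ N] {S : Set M} {P : Submodule ℂ N}
    (hP : IsClosed (P : Set N)) (f : M →L[ℂ] N) (h : ∀ x ∈ S, f x ∈ P) {x : M}
    (hx : x ∈ clSpan S) : f x ∈ P :=
  clSpan_le (N := P.comap f.toLinearMap) (hP.preimage f.continuous) h hx

theorem clSpan_eq_top_iff_dense {M : Type*} [NormedAddCommGroup M] [NormedSpace ℂ M] {S : Set M} :
    clSpan S = ⊤ ↔ Dense (Submodule.span ℂ S : Set M) := by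
  rw [Submodule.dense_iff_topologicalClosure_eq_top]; rfl

theorem ext_inner_of_dense {S : Set H} (hS : clSpan S = ⊤) {x y : H}
    (h : ∀ v ∈ S, ⟪x, v⟫_ℂ = ⟪y, v⟫_ℂ) : x = y := by
  have : innerSL ℂ x = innerSL ℂ y := ext_of_dense hS h
  exact ext_inner_right ℂ fun v => DFunLike.congr_fun this v

/-- The bound says that a linear relation among the `x i` also holds among the `y i`, so the
assignment descends to the dense span and extends by continuity. -/
theorem exists_clm_of_norm_le {ι : Type*} (x : ι → H) (y : ι → K) (C : ℝ)
    (hx : clSpan (Set.range x) = ⊤)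
    (h : ∀ c : ι →₀ ℂ, ‖Finsupp.linearCombination ℂ y c‖ ≤
      C * ‖Finsupp.linearCombination ℂ x c‖) :
    ∃ T : H →L[ℂ] K, ∀ i, T (x i) = y i := by
  have hd : DenseRange (Finsupp.linearCombination ℂ x) := by
    rw [clSpan_eq_top_iff_dense, ← Finsupp.range_linearCombination] at hx
    exact hx
  refine ⟨(Finsupp.linearCombination ℂ y).extendOfNorm (Finsupp.linearCombination ℂ x),
    fun i => ?_⟩
  have := LinearMap.extendOfNorm_eq (f := Finsupp.linearCombination ℂ y) hd ⟨C, h⟩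
    (Finsupp.single i 1)
  simpa using this

/-- Equal Gram matrices give linear combinations of equal norm. This is the source of existence for
the flips, the unit maps and the rebracketings, all of which are defined by formulas on generators.
-/
theorem exists_clm_of_inner_eq {ι : Type*} (x : ι → H) (y : ι → K)
    (hx : clSpan (Set.range x) = ⊤) (h : ∀ i j, ⟪x i, x j⟫_ℂ = ⟪y i, y j⟫_ℂ) :
    ∃ T : H →L[ℂ] K, ∀ i, T (x i) = y i := by
  refine exists_clm_of_norm_le x y 1 hx fun c => ?_
  have : ⟪Finsupp.linearCombination ℂ y c, Finsupp.linearCombination ℂ y c⟫_ℂ =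
      ⟪Finsupp.linearCombination ℂ x c, Finsupp.linearCombination ℂ x c⟫_ℂ := by
    simp only [Finsupp.linearCombination_apply, Finsupp.sum, sum_inner, inner_sum,
      inner_smul_left, inner_smul_right, h]
  rw [inner_self_eq_norm_sq_to_K, inner_self_eq_norm_sq_to_K] at this
  have h2 : ‖Finsupp.linearCombination ℂ y c‖ ^ 2 = ‖Finsupp.linearCombination ℂ x c‖ ^ 2 := by
    exact_mod_cast this
  rw [one_mul]
  exact (abs_le_of_sq_le_sq' h2.le (norm_nonneg _)).2

/-- Equality of Gram matrices gives `T*T = 1`; totality of the image vectors is needed only for `TT*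
= 1`. -/
theorem isUnitaryOp_of_inner_eq {ι : Type*} {x : ι → H} {y : ι → K}
    (hx : clSpan (Set.range x) = ⊤) (hy : clSpan (Set.range y) = ⊤)
    (h : ∀ i j, ⟪x i, x j⟫_ℂ = ⟪y i, y j⟫_ℂ) {T : H →L[ℂ] K} (hT : ∀ i, T (x i) = y i) :
    IsUnitaryOp T := by
  have h1 : adjoint T ∘L T = ContinuousLinearMap.id ℂ H := by
    refine ext_of_dense hx ?_
    rintro _ ⟨j, rfl⟩
    refine ext_inner_of_dense hx ?_
    rintro _ ⟨i, rfl⟩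
    simp only [coe_comp, Function.comp_apply, adjoint_inner_left, hT]
    exact (h j i).symm
  refine ⟨h1, ext_of_dense hy ?_⟩
  rintro _ ⟨j, rfl⟩
  rw [← hT]
  exact congrArg T (DFunLike.congr_fun h1 (x j))

namespace IsUnitaryOp

variable {T : H →L[ℂ] K}

theorem adjoint_apply_apply (h : IsUnitaryOp T) (x : H) : adjoint T (T x) = x :=
  DFunLike.congr_fun h.1 x

theorem apply_adjoint_apply (h : IsUnitaryOp T) (x : K) : T (adjoint T x) = x :=
  DFunLike.congr_fun h.2 x

theorem adjoint_eq_iff (h : IsUnitaryOp T) {x : H} {y : K} : adjoint T y = x ↔ T x = y :=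
  ⟨fun e => by rw [← e, h.apply_adjoint_apply], fun e => by rw [← e, h.adjoint_apply_apply]⟩

theorem injective (h : IsUnitaryOp T) : Function.Injective T :=
  Function.LeftInverse.injective h.adjoint_apply_apply

protected theorem adjoint (h : IsUnitaryOp T) : IsUnitaryOp (adjoint T) := by
  constructor
  · rw [adjoint_adjoint]; exact h.2
  · rw [adjoint_adjoint]; exact h.1

theorem comp {S : K →L[ℂ] L} (hS : IsUnitaryOp S) (h : IsUnitaryOp T) : IsUnitaryOp (S ∘L T) := by
  constructor
  · ext x
    simp [adjoint_comp, h.adjoint_apply_apply, hS.adjoint_apply_apply]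
  · ext x
    simp [adjoint_comp, h.apply_adjoint_apply, hS.apply_adjoint_apply]

theorem norm_apply (h : IsUnitaryOp T) (x : H) : ‖T x‖ = ‖x‖ := by
  have h1 : ⟪T x, T x⟫_ℂ = ⟪x, x⟫_ℂ := by
    rw [← adjoint_inner_right, h.adjoint_apply_apply]
  rw [inner_self_eq_norm_sq_to_K, inner_self_eq_norm_sq_to_K] at h1
  have h2 : ‖T x‖ ^ 2 = ‖x‖ ^ 2 := by exact_mod_cast h1
  exact (pow_left_inj₀ (norm_nonneg _) (norm_nonneg _) two_ne_zero).1 h2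

end IsUnitaryOp

theorem isUnitaryOp_id : IsUnitaryOp (ContinuousLinearMap.id ℂ H) := by
  constructor <;> simp [adjoint_id]

/-! ### Classes for legs -/

/-- The elements of `α` span a dense subspace. -/
class Tot (α : Leg 𝔎 H) : Prop where
  out : clSpan {v : H | ∃ ξ ∈ α, ∃ ζ : 𝔎, v = ξ ζ} = ⊤

/-- The relative tensor product along `β` and `γ` is meaningful. -/
class LC (β : Leg 𝔎 H) (γ : Leg 𝔎 K) : Prop where
  out : LegsCommute β γ

theorem LC.symm (β : Leg 𝔎 H) (γ : Leg 𝔎 K) [h : LC β γ] : LC γ β :=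
  ⟨fun ξ hξ ξ' hξ' η hη η' hη' => (h.out η hη η' hη' ξ hξ ξ' hξ').symm⟩

/-- `T α ⊆ β`. -/
class Maps (T : H →L[ℂ] K) (α : Leg 𝔎 H) (β : Leg 𝔎 K) : Prop where
  out : ∀ ξ ∈ α, T ∘L ξ ∈ β

instance (α : Leg 𝔎 H) : Maps (ContinuousLinearMap.id ℂ H) α α := ⟨fun ξ hξ => by rwa [id_comp]⟩

theorem Maps.comp {T : H →L[ℂ] K} {S : K →L[ℂ] L} {α : Leg 𝔎 H} {β : Leg 𝔎 K} {γ : Leg 𝔎 L}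
    (hS : Maps S β γ) (hT : Maps T α β) : Maps (S ∘L T) α γ :=
  ⟨fun ξ hξ => by rw [comp_assoc]; exact hS.out _ (hT.out ξ hξ)⟩

/-- Composing maps of the form `S ⊗ Id` produces identities inside each tensor factor; these
instances let the leg conditions be recognized before such identities are removed. -/
instance Maps.id_comp {T : H →L[ℂ] K} {α : Leg 𝔎 H} {β : Leg 𝔎 K} [h : Maps T α β] :
    Maps (ContinuousLinearMap.id ℂ K ∘L T) α β := h

instance Maps.comp_id {T : H →L[ℂ] K} {α : Leg 𝔎 H} {β : Leg 𝔎 K} [h : Maps T α β] :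
    Maps (T ∘L ContinuousLinearMap.id ℂ H) α β := h

/-- The map `ξ ↦ T ξ` between legs. -/
def mapLeg (T : H →L[ℂ] K) {α : Leg 𝔎 H} {β : Leg 𝔎 K} [h : Maps T α β] (ξ : α) : β :=
  ⟨T ∘L ξ.1, h.out _ ξ.2⟩

@[simp] theorem mapLeg_apply (T : H →L[ℂ] K) {α : Leg 𝔎 H} {β : Leg 𝔎 K} [Maps T α β] (ξ : α)
    (ζ : 𝔎) : (mapLeg T ξ : β).1 ζ = T (ξ.1 ζ) := rfl

@[simp] theorem mapLeg_id {α : Leg 𝔎 H} (ξ : α) :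
    (mapLeg (ContinuousLinearMap.id ℂ H) ξ : α) = ξ := rfl

theorem tot_range (α : Leg 𝔎 H) [h : Tot α] :
    clSpan (Set.range fun p : α × 𝔎 => p.1.1 p.2) = ⊤ := by
  rw [← h.out]
  congr 1
  ext v
  constructor
  · rintro ⟨p, rfl⟩
    exact ⟨p.1.1, p.1.2, p.2, rfl⟩
  · rintro ⟨ξ, hξ, ζ, rfl⟩
    exact ⟨(⟨ξ, hξ⟩, ζ), rfl⟩

theorem ext_of_tot {S T : H →L[ℂ] K} (α : Leg 𝔎 H) [Tot α]
    (h : ∀ (ξ : α) (ζ : 𝔎), S (ξ.1 ζ) = T (ξ.1 ζ)) : S = T := by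
  refine ext_of_dense (tot_range α) ?_
  rintro _ ⟨p, rfl⟩
  exact h _ _

theorem tmul_range (β : Leg 𝔎 H) (γ : Leg 𝔎 K) :
    clSpan (Set.range fun p : β × 𝔎 × γ => tmul p.1 p.2.1 p.2.2) = ⊤ := by
  rw [← tmul_dense β γ]
  congr 1
  ext v
  constructor
  · rintro ⟨p, rfl⟩
    exact ⟨_, _, _, rfl⟩
  · rintro ⟨ξ, ζ, η, rfl⟩
    exact ⟨(ξ, ζ, η), rfl⟩

/-! ### Elementary operators between relative tensor products -/

section Elementary

variable (β : Leg 𝔎 H) (γ : Leg 𝔎 K) [hc : LC β γ]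

include hc in
-- The two orders of the factors `ξ*ξ'` and `η*η'` agree exactly because the legs commute.
theorem inner_tmul_flip (ξ ξ' : β) (ζ ζ' : 𝔎) (η η' : γ) :
    ⟪tmul ξ ζ η, tmul ξ' ζ' η'⟫_ℂ = ⟪tmul η ζ ξ, tmul η' ζ' ξ'⟫_ℂ := by
  rw [inner_tmul hc.out, inner_tmul (LC.symm β γ).out]
  exact congrArg _ (DFunLike.congr_fun (hc.out _ ξ.2 _ ξ'.2 _ η.2 _ η'.2) ζ')

end Elementary

variable {β : Leg 𝔎 H} {γ : Leg 𝔎 K} {β' : Leg 𝔎 H'} {γ' : Leg 𝔎 K'}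

@[simp] theorem flip_tmul [LC β γ] (ξ : β) (ζ : 𝔎) (η : γ) :
    flip β γ (tmul ξ ζ η) = tmul η ζ ξ := by
  obtain ⟨T, hT⟩ := exists_clm_of_inner_eq _
    (fun p : β × 𝔎 × γ => tmul p.2.2 p.2.1 p.1) (tmul_range β γ)
    (fun i j => inner_tmul_flip β γ _ _ _ _ _ _)
  refine opOfGraph_spec ⟨T, ?_⟩ (tmul ξ ζ η, tmul η ζ ξ) ⟨ξ, ζ, η, rfl⟩
  rintro _ ⟨ξ, ζ, η, rfl⟩
  exact hT (ξ, ζ, η)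

theorem flip_flip [LC β γ] : flip γ β ∘L flip β γ = ContinuousLinearMap.id ℂ _ := by
  have := LC.symm β γ
  exact rtp_ext fun ξ ζ η => by simp

theorem adjoint_flip [LC β γ] : adjoint (flip β γ) = flip γ β := by
  have := LC.symm β γ
  refine rtp_ext fun η ζ ξ => ext_inner_of_dense (tmul_range β γ) ?_
  rintro _ ⟨⟨ξ', ζ', η'⟩, rfl⟩
  rw [adjoint_inner_left, flip_tmul, flip_tmul]
  exact inner_tmul_flip _ _ _ _ _ _ _ _

theorem isUnitaryOp_flip [LC β γ] : IsUnitaryOp (flip β γ) := by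
  have := LC.symm β γ
  exact ⟨by rw [adjoint_flip, flip_flip], by rw [adjoint_flip, flip_flip]⟩

/-- The operator `S ⊗ T` is given by the expected formula. -/
@[simp] theorem rtpMap_tmul' [hc : LC β γ] [hc' : LC β' γ'] [hm : LC β' γ] (S : H →L[ℂ] H')
    (T : K →L[ℂ] K') [hS : Maps S β β'] [hT : Maps T γ γ'] (ξ : β) (ζ : 𝔎) (η : γ) :
    rtpMap β γ β' γ' S T (tmul ξ ζ η) = tmul (mapLeg S ξ : β') ζ (mapLeg T η : γ') := by
  have := LC.symm β' γ
  have := LC.symm β' γ'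
  -- Only `S ⊗ Id` is available so far. The factor `Id ⊗ T` is obtained by conjugating `T ⊗ Id` with
  -- flips, which is why the intermediate product along `β'` and `γ` must make sense.
  refine opOfGraph_spec ⟨flip γ' β' ∘L rtpMap γ β' γ' β' T (ContinuousLinearMap.id ℂ H') ∘L
    flip β' γ ∘L rtpMap β γ β' γ S (ContinuousLinearMap.id ℂ K), ?_⟩
    (tmul ξ ζ η, tmul (mapLeg S ξ : β') ζ (mapLeg T η : γ')) ⟨ξ, ζ, η, _, _, rfl, rfl, rfl⟩
  rintro _ ⟨ξ, ζ, η, ξ', η', h1, h2, rfl⟩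
  simp only [coe_comp, Function.comp_apply]
  rw [rtpMap_tmul hc.out hm.out _ hS.out, flip_tmul,
    rtpMap_tmul (LC.symm β' γ).out (LC.symm β' γ').out _ hT.out, flip_tmul]
  congr 1
  · exact Subtype.ext h1.symm
  · exact Subtype.ext h2.symm

/-- The estimate holds on finite sums of elementary tensors by `norm_tmul_sum_le`, and these are
dense. It gives the bounds for `ρ` and for the kets, and later continuity of `S ↦ S ⊗ Id`. -/
theorem norm_rtpMap_le [hc : LC β γ] [hc' : LC β' γ] (S : H →L[ℂ] H') [hS : Maps S β β'] :
    ‖rtpMap β γ β' γ S (ContinuousLinearMap.id ℂ K)‖ ≤ ‖S‖ := by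
  refine opNorm_le_bound _ (norm_nonneg _) fun x => ?_
  have hd : Dense (Set.range (Finsupp.linearCombination ℂ
      (fun p : β × 𝔎 × γ => tmul p.1 p.2.1 p.2.2))) := by
    have := tmul_range β γ
    rw [clSpan_eq_top_iff_dense, ← Finsupp.range_linearCombination] at this
    exact this
  refine hd.induction (P := fun x => ‖rtpMap β γ β' γ S (ContinuousLinearMap.id ℂ K) x‖ ≤
    ‖S‖ * ‖x‖) ?_ (isClosed_le (by fun_prop) (by fun_prop)) x
  rintro _ ⟨c, rfl⟩
  refine le_trans (le_of_eq ?_) (norm_tmul_sum_le hc.out hc'.out S hS.out c)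
  congr 1
  simp only [Finsupp.linearCombination_apply, Finsupp.sum, map_sum, map_smul, rtpMap_tmul',
    mapLeg_id]
  rfl

/-- The multiplication `A ⊗ K → K` is unitary for every nondegenerate subspace `A` that commutes
with the inner products of `γ`. -/
theorem unitL_spec {A : Leg 𝔎 𝔎} [hA : LC A γ]
    (hcomm : ∀ a : A, ∀ η η' : γ, Commute a.1 (adjoint η.1 ∘L η'.1))
    (htot : clSpan (Set.range fun p : A × 𝔎 × γ => p.2.2.1 (p.1.1 p.2.1)) = ⊤) :
    (∀ (a : A) (ζ : 𝔎) (η : γ), unitL A γ (tmul a ζ η) = η.1 (a.1 ζ)) ∧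
      IsUnitaryOp (unitL A γ) := by
  -- The inner product on the left is `⟨ζ | a*a' η*η' ζ'⟩`; moving `a'` past `η*η'` turns it into
  -- `⟨η a ζ | η' a' ζ'⟩`.
  have hin : ∀ i j : A × 𝔎 × γ, ⟪tmul i.1 i.2.1 i.2.2, tmul j.1 j.2.1 j.2.2⟫_ℂ =
      ⟪i.2.2.1 (i.1.1 i.2.1), j.2.2.1 (j.1.1 j.2.1)⟫_ℂ := by
    rintro ⟨a, ζ, η⟩ ⟨a', ζ', η'⟩
    rw [inner_tmul hA.out]
    simp only [coe_comp, Function.comp_apply, adjoint_inner_right]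
    rw [← adjoint_inner_right η.1]
    exact congrArg _ (DFunLike.congr_fun (hcomm a' η η') ζ')
  have hspec : ∀ (a : A) (ζ : 𝔎) (η : γ), unitL A γ (tmul a ζ η) = η.1 (a.1 ζ) := by
    intro a ζ η
    obtain ⟨T, hT⟩ := exists_clm_of_inner_eq _ _ (tmul_range A γ) hin
    refine opOfGraph_spec ⟨T, ?_⟩ (tmul a ζ η, η.1 (a.1 ζ)) ⟨a, ζ, η, rfl⟩
    rintro _ ⟨ξ, ζ, η, rfl⟩
    exact hT (ξ, ζ, η)
  exact ⟨hspec, isUnitaryOp_of_inner_eq (tmul_range A γ) htot hin fun i => hspec _ _ _⟩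

/-! ### The operators `ρ` and the kets -/

/-- The operators on `𝔎` that commute with all inner products of elements of `γ`. -/
def legComm (γ : Leg 𝔎 K) : Leg 𝔎 𝔎 where
  carrier := {c | ∀ η ∈ γ, ∀ η' ∈ γ, Commute c (adjoint η ∘L η')}
  add_mem' ha hb η hη η' hη' := (ha η hη η' hη').add_left (hb η hη η' hη')
  zero_mem' _ _ _ _ := Commute.zero_left _
  smul_mem' c _ ha η hη η' hη' := (ha η hη η' hη').smul_left c

theorem adjoint_mem_legComm {γ : Leg 𝔎 K} {c : 𝔎 →L[ℂ] 𝔎} (hc : c ∈ legComm γ) :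
    adjoint c ∈ legComm γ := by
  intro η hη η' hη'
  have := (hc η' hη' η hη).star_star
  simp only [star_eq_adjoint, adjoint_comp, adjoint_adjoint] at this
  exact this

theorem mul_mem_legComm {γ : Leg 𝔎 K} {c d : 𝔎 →L[ℂ] 𝔎} (hc : c ∈ legComm γ)
    (hd : d ∈ legComm γ) : c ∘L d ∈ legComm γ :=
  fun η hη η' hη' => (hc η hη η' hη').mul_left (hd η hη η' hη')

theorem id_mem_legComm (γ : Leg 𝔎 K) : ContinuousLinearMap.id ℂ 𝔎 ∈ legComm γ :=
  fun _ _ _ _ => Commute.one_left _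

instance (γ : Leg 𝔎 K) : LC (legComm γ) γ :=
  ⟨fun _ ha _ hb η hη η' hη' =>
    mul_mem_legComm (adjoint_mem_legComm ha) hb η hη η' hη'⟩

/-- The commutant contains the identity, so the vectors `η ζ` alone already make the range total. -/
theorem unitL_legComm (γ : Leg 𝔎 K) [Tot γ] :
    (∀ (a : legComm γ) (ζ : 𝔎) (η : γ), unitL (legComm γ) γ (tmul a ζ η) = η.1 (a.1 ζ)) ∧
      IsUnitaryOp (unitL (legComm γ) γ) := by
  refine unitL_spec (fun a η η' => a.2 _ η.2 _ η'.2) ?_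
  rw [← top_le_iff, ← tot_range γ]
  refine clSpan_le (isClosed_clSpan _) ?_
  rintro _ ⟨⟨η, ζ⟩, rfl⟩
  exact subset_clSpan ⟨(⟨_, id_mem_legComm γ⟩, ζ, η), rfl⟩

/-- Identify `K` with `legComm γ ⊗ K` through multiplication. Left multiplication by `c` on the
first factor then becomes the required operator, and its norm bound is that of `c ⊗ Id`. -/
theorem exists_rho (γ : Leg 𝔎 K) [Tot γ] {c : 𝔎 →L[ℂ] 𝔎} (hc : c ∈ legComm γ) :
    ∃ T : K →L[ℂ] K, (∀ (η : γ) ζ, T (η.1 ζ) = η.1 (c ζ)) ∧ ‖T‖ ≤ ‖c‖ := by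
  obtain ⟨h1, h2⟩ := unitL_legComm γ
  have : Maps c (legComm γ) (legComm γ) := ⟨fun d hd => mul_mem_legComm hc hd⟩
  refine ⟨unitL (legComm γ) γ ∘L rtpMap (legComm γ) γ (legComm γ) γ c (ContinuousLinearMap.id ℂ K)
    ∘L adjoint (unitL (legComm γ) γ), fun η ζ => ?_, ?_⟩
  · have e : adjoint (unitL (legComm γ) γ) (η.1 ζ) =
        tmul (⟨_, id_mem_legComm γ⟩ : legComm γ) ζ η := by
      rw [h2.adjoint_eq_iff, h1]; rfl
    simp only [coe_comp, Function.comp_apply, e, rtpMap_tmul', h1, mapLeg_id]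
    rfl
  · refine opNorm_le_bound _ (norm_nonneg _) fun x => ?_
    simp only [coe_comp, Function.comp_apply]
    rw [h2.norm_apply]
    refine (le_opNorm _ _).trans ?_
    rw [h2.adjoint.norm_apply]
    gcongr
    exact norm_rtpMap_le c

theorem rho_apply [Tot γ] {c : 𝔎 →L[ℂ] 𝔎} (hc : c ∈ legComm γ) (η : γ) (ζ : 𝔎) :
    rho γ c (η.1 ζ) = η.1 (c ζ) := by
  obtain ⟨T, hT, -⟩ := exists_rho γ hc
  refine opOfGraph_spec ⟨T, ?_⟩ (η.1 ζ, η.1 (c ζ)) ⟨η.1, η.2, ζ, rfl⟩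
  rintro _ ⟨ξ, hξ, ζ, rfl⟩
  exact hT ⟨ξ, hξ⟩ ζ

theorem norm_rho_le [Tot γ] {c : 𝔎 →L[ℂ] 𝔎} (hc : c ∈ legComm γ) : ‖rho γ c‖ ≤ ‖c‖ := by
  obtain ⟨T, hT, h⟩ := exists_rho γ hc
  rwa [ext_of_tot (S := rho γ c) (T := T) γ fun η ζ => by rw [hT, rho_apply hc]]

/-- Under `K ≅ ℂ·1 ⊗ K` the ket is `ξ ⊗ Id`, with `ξ` regarded as an operator from `𝔎` to `H`;
existence and the norm bound come from there. -/
theorem exists_ket1 (β : Leg 𝔎 H) (γ : Leg 𝔎 K) [hc : LC β γ] [Tot γ] (ξ : β) :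
    ∃ T : K →L[ℂ] RTP β γ, (∀ (η : γ) ζ, T (η.1 ζ) = tmul ξ ζ η) ∧ ‖T‖ ≤ ‖ξ.1‖ := by
  -- The scalars are used rather than the whole commutant because `ξ A ⊆ β` is required, and `β`
  -- need not be stable under right multiplication by the commutant of the inner products of `γ`.
  let A : Leg 𝔎 𝔎 := Submodule.span ℂ {ContinuousLinearMap.id ℂ 𝔎}
  have hA : A ≤ legComm γ :=
    Submodule.span_le.2 (Set.singleton_subset_iff.2 (id_mem_legComm γ))
  have hid : ContinuousLinearMap.id ℂ 𝔎 ∈ A := Submodule.mem_span_singleton_self _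
  have : LC A γ := ⟨fun a ha b hb => LC.out a (hA ha) b (hA hb)⟩
  obtain ⟨h1, h2⟩ : (∀ (a : A) (ζ : 𝔎) (η : γ), unitL A γ (tmul a ζ η) = η.1 (a.1 ζ)) ∧
      IsUnitaryOp (unitL A γ) := by
    refine unitL_spec (fun a η η' => hA a.2 _ η.2 _ η'.2) ?_
    rw [← top_le_iff, ← tot_range γ]
    refine clSpan_le (isClosed_clSpan _) ?_
    rintro _ ⟨⟨η, ζ⟩, rfl⟩
    exact subset_clSpan ⟨(⟨_, hid⟩, ζ, η), rfl⟩
  have : Maps ξ.1 A β := by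
    refine ⟨fun a ha => ?_⟩
    obtain ⟨c, rfl⟩ := Submodule.mem_span_singleton.1 ha
    rw [comp_smul, comp_id]
    exact Submodule.smul_mem _ _ ξ.2
  refine ⟨rtpMap A γ β γ ξ.1 (ContinuousLinearMap.id ℂ K)
    ∘L adjoint (unitL A γ), fun η ζ => ?_, ?_⟩
  · have e : adjoint (unitL A γ) (η.1 ζ) = tmul (⟨_, hid⟩ : A) ζ η := by
      rw [h2.adjoint_eq_iff, h1]; rfl
    simp only [coe_comp, Function.comp_apply, e, rtpMap_tmul', mapLeg_id]
    rfl
  · refine opNorm_le_bound _ (norm_nonneg _) fun x => ?_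
    simp only [coe_comp, Function.comp_apply]
    refine (le_opNorm _ _).trans ?_
    rw [h2.adjoint.norm_apply]
    gcongr
    exact norm_rtpMap_le ξ.1

theorem ket1_apply [LC β γ] [Tot γ] (ξ : β) (η : γ) (ζ : 𝔎) :
    (ket1 ξ : K →L[ℂ] RTP β γ) (η.1 ζ) = tmul ξ ζ η := by
  obtain ⟨T, hT, -⟩ := exists_ket1 β γ ξ
  refine opOfGraph_spec ⟨T, ?_⟩ (η.1 ζ, tmul ξ ζ η) ⟨ζ, η, rfl⟩
  rintro _ ⟨ζ, η, rfl⟩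
  exact hT η ζ

theorem norm_ket1_le [LC β γ] [Tot γ] (ξ : β) : ‖(ket1 ξ : K →L[ℂ] RTP β γ)‖ ≤ ‖ξ.1‖ := by
  obtain ⟨T, hT, h⟩ := exists_ket1 β γ ξ
  rwa [ext_of_tot (S := ket1 ξ) (T := T) γ fun η ζ => by rw [hT, ket1_apply]]

theorem ket2_eq_flip_ket1 [LC β γ] [Tot β] (η : γ) :
    (ket2 η : H →L[ℂ] RTP β γ) = flip γ β ∘L ket1 η := by
  have := LC.symm β γ
  have h : ∀ (ξ : β) ζ, (flip γ β ∘L ket1 η : H →L[ℂ] RTP β γ) (ξ.1 ζ) = tmul ξ ζ η := by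
    intro ξ ζ
    rw [coe_comp, Function.comp_apply, ket1_apply, flip_tmul]
  refine ext_of_tot β fun ξ ζ => ?_
  rw [h]
  refine opOfGraph_spec ⟨flip γ β ∘L ket1 η, ?_⟩ (ξ.1 ζ, tmul ξ ζ η) ⟨ξ, ζ, rfl⟩
  rintro _ ⟨ξ, ζ, rfl⟩
  exact h ξ ζ

theorem ket2_apply [LC β γ] [Tot β] (η : γ) (ξ : β) (ζ : 𝔎) :
    (ket2 η : H →L[ℂ] RTP β γ) (ξ.1 ζ) = tmul ξ ζ η := by
  have := LC.symm β γ
  rw [ket2_eq_flip_ket1, coe_comp, Function.comp_apply, ket1_apply, flip_tmul]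

theorem ket1_leg_apply [LC β γ] [Tot β] [Tot γ] (ξ : β) (η : γ) (ζ : 𝔎) :
    (ket1 ξ : K →L[ℂ] RTP β γ) (η.1 ζ) = ket2 η (ξ.1 ζ) := by
  rw [ket1_apply, ket2_apply]

/-- `ξ ↦ |ξ⟩₁` as a continuous linear map. -/
def ket1L (β : Leg 𝔎 H) (γ : Leg 𝔎 K) [hc : LC β γ] [Tot γ] : β →L[ℂ] K →L[ℂ] RTP β γ :=
  LinearMap.mkContinuous
    { toFun := fun ξ => ket1 ξ
      map_add' := fun ξ ξ' => ext_of_tot γ fun η ζ => by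
        rw [add_apply, ket1_apply, ket1_apply, ket1_apply, tmul_add_left hc.out]
      map_smul' := fun c ξ => ext_of_tot γ fun η ζ => by
        rw [smul_apply, ket1_apply, ket1_apply, RingHom.id_apply, tmul_smul_left hc.out] }
    1 fun ξ => by rw [one_mul]; exact norm_ket1_le ξ

@[simp] theorem ket1L_apply [LC β γ] [Tot γ] (ξ : β) : ket1L β γ ξ = ket1 ξ := rfl

/-- `η ↦ |η⟩₂` as a continuous linear map. -/
def ket2L (β : Leg 𝔎 H) (γ : Leg 𝔎 K) [hc : LC β γ] [Tot β] : γ →L[ℂ] H →L[ℂ] RTP β γ :=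
  haveI := LC.symm β γ
  compL ℂ H _ _ (flip γ β) ∘L ket1L γ β

@[simp] theorem ket2L_apply [LC β γ] [Tot β] (η : γ) : ket2L β γ η = ket2 η := by
  rw [ket2_eq_flip_ket1]; rfl

theorem rtp_ext1 [LC β γ] [Tot γ] {S T : RTP β γ →L[ℂ] L}
    (h : ∀ (ξ : β) (v : K), S (ket1 ξ v) = T (ket1 ξ v)) : S = T :=
  rtp_ext fun ξ ζ η => by rw [← ket1_apply, h]

theorem rtp_ext2 [LC β γ] [Tot β] {S T : RTP β γ →L[ℂ] L}
    (h : ∀ (η : γ) (v : H), S (ket2 η v) = T (ket2 η v)) : S = T :=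
  rtp_ext fun ξ ζ η => by rw [← ket2_apply, h]

@[simp] theorem flip_ket1 [LC β γ] [Tot γ] (ξ : β) (v : K) :
    flip β γ (ket1 ξ v) = ket2 ξ v := by
  have := LC.symm β γ
  rw [ket2_eq_flip_ket1]; rfl

@[simp] theorem flip_ket2 [LC β γ] [Tot β] (η : γ) (v : H) :
    flip β γ (ket2 η v) = ket1 η v := by
  have := LC.symm β γ
  rw [ket2_eq_flip_ket1, coe_comp, Function.comp_apply]
  exact DFunLike.congr_fun flip_flip _

@[simp] theorem rtpMap_ket1 [LC β γ] [LC β' γ'] [LC β' γ] [Tot γ] [Tot γ'] (S : H →L[ℂ] H')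
    (T : K →L[ℂ] K') [Maps S β β'] [Maps T γ γ'] (ξ : β) (v : K) :
    rtpMap β γ β' γ' S T (ket1 ξ v) = ket1 (mapLeg S ξ : β') (T v) := by
  have : rtpMap β γ β' γ' S T ∘L ket1 ξ = ket1 (mapLeg S ξ : β') ∘L T := by
    refine ext_of_tot γ fun η ζ => ?_
    simp only [coe_comp, Function.comp_apply, ket1_apply, rtpMap_tmul']
    rw [← ket1_apply, mapLeg_apply]
  exact DFunLike.congr_fun this v

@[simp] theorem rtpMap_ket2 [LC β γ] [LC β' γ'] [LC β' γ] [Tot β] [Tot β'] (S : H →L[ℂ] H')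
    (T : K →L[ℂ] K') [Maps S β β'] [Maps T γ γ'] (η : γ) (v : H) :
    rtpMap β γ β' γ' S T (ket2 η v) = ket2 (mapLeg T η : γ') (S v) := by
  have : rtpMap β γ β' γ' S T ∘L ket2 η = ket2 (mapLeg T η : γ') ∘L S := by
    refine ext_of_tot β fun η ζ => ?_
    simp only [coe_comp, Function.comp_apply, ket2_apply, rtpMap_tmul']
    rw [← ket2_apply, mapLeg_apply]
  exact DFunLike.congr_fun this v

theorem inner_mem_legComm [hc : LC β γ] (ξ ξ' : β) : adjoint ξ.1 ∘L ξ'.1 ∈ legComm γ :=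
  fun η hη η' hη' => hc.out _ ξ.2 _ ξ'.2 η hη η' hη'

/-- Testing against vectors `η ζ` turns both sides into the defining inner product of the relative
tensor product. Through this formula inner products of iterated kets are evaluated by moving `ρ`'s
inwards. -/
theorem adjoint_ket1_ket1 [hc : LC β γ] [Tot γ] (ξ ξ' : β) (v : K) :
    adjoint (ket1 ξ : K →L[ℂ] RTP β γ) (ket1 ξ' v) = rho γ (adjoint ξ.1 ∘L ξ'.1) v := by
  have : adjoint (ket1 ξ : K →L[ℂ] RTP β γ) ∘L ket1 ξ' = rho γ (adjoint ξ.1 ∘L ξ'.1) := by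
    refine ext_of_tot γ fun η ζ => ?_
    refine ext_inner_of_dense (tot_range γ) ?_
    rintro _ ⟨⟨η', ζ'⟩, rfl⟩
    rw [coe_comp, Function.comp_apply,
      adjoint_inner_left, ket1_apply, ket1_apply, inner_tmul hc.out,
      rho_apply (inner_mem_legComm ξ ξ')]
    rw [← adjoint_inner_right η.1]
    simp only [coe_comp, Function.comp_apply, adjoint_inner_right]
    rw [← adjoint_inner_left, adjoint_inner_right]
  exact DFunLike.congr_fun this v

theorem adjoint_ket2_ket2 [hc : LC β γ] [Tot β] (η η' : γ) (v : H) :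
    adjoint (ket2 η : H →L[ℂ] RTP β γ) (ket2 η' v) = rho β (adjoint η.1 ∘L η'.1) v := by
  have := LC.symm β γ
  rw [← adjoint_ket1_ket1, ket2_eq_flip_ket1, ket2_eq_flip_ket1, adjoint_comp, adjoint_flip]
  simp only [coe_comp, Function.comp_apply]
  exact congrArg _ (DFunLike.congr_fun flip_flip _)

/-- On generators both sides give `(Tξ)(cζ)`. Every commutation of an operator with some `ρ` used
below is an instance: it suffices that the operator respects the leg defining `ρ`. -/
theorem comp_rho {T : H →L[ℂ] K} [Tot β] [Tot γ] [hT : Maps T β γ] {c : 𝔎 →L[ℂ] 𝔎}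
    (hβ : c ∈ legComm β) (hγ : c ∈ legComm γ) : T ∘L rho β c = rho γ c ∘L T := by
  refine ext_of_tot β fun ξ ζ => ?_
  simp only [coe_comp, Function.comp_apply]
  rw [rho_apply hβ, ← mapLeg_apply T ξ ζ (β := γ), rho_apply hγ]
  rfl

end

section

/-! ### Modules and normalizing legs as classes -/

/-- `(H, α)` is a module over `b`. -/
class Mod (b : outParam (CStarBase 𝔎)) (α : Leg 𝔎 H) : Prop where
  out : IsModule b α

/-- `[ρ_α(𝔅†) β] = β`. -/
class Nm (b : outParam (CStarBase 𝔎)) (α β : Leg 𝔎 H) : Prop where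
  out : Normalizes b α β

/-- The bases `b` and `c` are opposite. -/
class Dual (b c : CStarBase 𝔎) : Prop where
  out : c = b.dag

instance (b : CStarBase 𝔎) : Dual b b.dag := ⟨rfl⟩
instance (b : CStarBase 𝔎) : Dual b.dag b := ⟨rfl⟩

theorem Dual.symm (b c : CStarBase 𝔎) [h : Dual b c] : Dual c b :=
  ⟨by rw [h.out]; rfl⟩

variable {b c d e : CStarBase 𝔎}

instance Mod.tot {α : Leg 𝔎 H} [h : Mod b α] : Tot α := ⟨h.out.total⟩

instance Mod.lc {β : Leg 𝔎 H} {γ : Leg 𝔎 K} [h : Mod b β] [h' : Mod c γ] [hd : Dual b c] :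
    LC β γ := by
  obtain rfl := hd.out
  exact ⟨LegsCommute.of_isModule h.out h'.out⟩

theorem adjoint_comp_mem_alg {α : Leg 𝔎 H} [h : Mod b α] {ξ ξ' : 𝔎 →L[ℂ] H} (hξ : ξ ∈ α)
    (hξ' : ξ' ∈ α) : adjoint ξ ∘L ξ' ∈ b.alg := by
  have : adjoint ξ ∘L ξ' ∈ b.B := by
    rw [← h.out.full]
    exact subset_clSpan ⟨ξ, hξ, ξ', hξ', rfl⟩
  exact this

theorem mem_legComm {α : Leg 𝔎 H} [h : Mod b α] {x : 𝔎 →L[ℂ] 𝔎} (hx : x ∈ b.algd) :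
    x ∈ legComm α :=
  fun _ hξ _ hξ' => (b.comm _ (adjoint_comp_mem_alg hξ hξ') x hx).symm

theorem comp_mem_of_mod {α : Leg 𝔎 H} [h : Mod b α] {ξ : 𝔎 →L[ℂ] H} (hξ : ξ ∈ α)
    {x : 𝔎 →L[ℂ] 𝔎} (hx : x ∈ b.alg) : ξ ∘L x ∈ α := by
  rw [← h.out.right]
  exact subset_clSpan ⟨ξ, hξ, x, hx, rfl⟩

theorem maps_rho {α β : Leg 𝔎 H} [h : Nm b α β] {x : 𝔎 →L[ℂ] 𝔎} (hx : x ∈ b.algd) :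
    Maps (rho α x) β β := by
  refine ⟨fun ξ hξ => ?_⟩
  have := h.out
  unfold Normalizes at this
  rw [← this]
  exact subset_clSpan ⟨x, hx, ξ, hξ, rfl⟩

theorem normalizes_of_maps {α β : Leg 𝔎 H} (hβ : IsClosed (β : Set (𝔎 →L[ℂ] H)))
    (h1 : ∀ x ∈ b.algd, Maps (rho α x) β β)
    (h2 : β ≤ clSpan {T : 𝔎 →L[ℂ] H | ∃ c ∈ b.algd, ∃ ξ ∈ β, T = rho α c ∘L ξ}) :
    Normalizes b α β := by
  refine le_antisymm (clSpan_le hβ ?_) h2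
  rintro _ ⟨c, hc, ξ, hξ, rfl⟩
  exact (h1 c hc).out ξ hξ

/-- Here the map is defined only on `Q`, as is the case for `ξ ↦ |ξ⟩₁` and for `ρ`. Closedness of
`Q` ensures that the elements with image in `P` still form a closed subspace of the ambient space,
so checking generators suffices. -/
theorem clSpan_subtype_induction {M N : Type*} [NormedAddCommGroup M] [NormedSpace ℂ M]
    [NormedAddCommGroup N] [NormedSpace ℂ N] {S : Set M} {Q : Submodule ℂ M}
    (hQ : IsClosed (Q : Set M)) (hS : S ⊆ Q) {P : Submodule ℂ N} (hP : IsClosed (P : Set N))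
    (f : Q →L[ℂ] N) (h : ∀ x (hx : x ∈ S), f ⟨x, hS hx⟩ ∈ P) {x : M} (hx : x ∈ clSpan S)
    (hx' : x ∈ Q) : f ⟨x, hx'⟩ ∈ P := by
  have hc : IsClosed (((P.comap f.toLinearMap).map Q.subtype : Submodule ℂ M) : Set M) := by
    rw [Submodule.map_coe]
    exact hQ.isClosedEmbedding_subtypeVal.isClosedMap _ (hP.preimage f.continuous)
  have : clSpan S ≤ (P.comap f.toLinearMap).map Q.subtype :=
    clSpan_le hc fun y hy => ⟨⟨y, hS hy⟩, h y hy, rfl⟩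
  obtain ⟨⟨y, hy⟩, hyP, hyx⟩ := this hx
  change y = x at hyx
  subst hyx
  exact hyP

/-- `c ↦ ρ_α(c)` as a continuous linear map on `𝔅†`. -/
def rhoL (α : Leg 𝔎 H) [h : Mod b α] : b.Bd →L[ℂ] H →L[ℂ] H :=
  LinearMap.mkContinuous
    { toFun := fun c => rho α c.1
      map_add' := fun c d => ext_of_tot α fun η ζ => by
        rw [add_apply, rho_apply (mem_legComm (c + d).2), rho_apply (mem_legComm c.2),
          rho_apply (mem_legComm d.2)]
        simp
      map_smul' := fun x c => ext_of_tot α fun η ζ => by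
        rw [smul_apply, rho_apply (mem_legComm (x • c).2), RingHom.id_apply,
          rho_apply (mem_legComm c.2)]
        simp }
    1 fun c => by rw [one_mul]; exact norm_rho_le (mem_legComm c.2)

/-! ### Unitary operators that map one leg onto another -/

/-- `T` is a unitary operator that maps `α` onto `α'`. -/
class LegU (T : H →L[ℂ] K) (α : Leg 𝔎 H) (α' : Leg 𝔎 K) : Prop where
  unitary : IsUnitaryOp T
  maps : Maps T α α'
  maps_adjoint : Maps (adjoint T) α' α

instance LegU.toMaps {T : H →L[ℂ] K} {α : Leg 𝔎 H} {α' : Leg 𝔎 K} [h : LegU T α α'] :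
    Maps T α α' := h.maps

instance LegU.toMapsAdjoint {T : H →L[ℂ] K} {α : Leg 𝔎 H} {α' : Leg 𝔎 K} [h : LegU T α α'] :
    Maps (adjoint T) α' α := h.maps_adjoint

theorem LegU.comp {T : H →L[ℂ] K} {S : K →L[ℂ] L} {α : Leg 𝔎 H} {α' : Leg 𝔎 K} {α'' : Leg 𝔎 L}
    (hS : LegU S α' α'') (hT : LegU T α α') : LegU (S ∘L T) α α'' :=
  ⟨hS.unitary.comp hT.unitary, hS.maps.comp hT.maps,
    by rw [adjoint_comp]; exact hT.maps_adjoint.comp hS.maps_adjoint⟩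

theorem LegU.adjoint {T : H →L[ℂ] K} {α : Leg 𝔎 H} {α' : Leg 𝔎 K} (h : LegU T α α') :
    LegU (adjoint T) α' α :=
  ⟨h.unitary.adjoint, h.maps_adjoint, by rw [adjoint_adjoint]; exact h.maps⟩

instance (α : Leg 𝔎 H) : LegU (ContinuousLinearMap.id ℂ H) α α :=
  ⟨isUnitaryOp_id, inferInstance, by rw [adjoint_id]; infer_instance⟩

theorem LegU.mapsLegOnto {T : H →L[ℂ] K} {α : Leg 𝔎 H} {α' : Leg 𝔎 K} (h : LegU T α α') :
    MapsLegOnto T α α' := by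
  ext x
  constructor
  · rintro ⟨ξ, hξ, rfl⟩
    exact h.maps.out ξ hξ
  · intro hx
    refine ⟨_, h.maps_adjoint.out x hx, ?_⟩
    simp only [← comp_assoc, h.unitary.2, id_comp]

theorem LegU.of_mapsLegOnto {T : H →L[ℂ] K} {α : Leg 𝔎 H} {α' : Leg 𝔎 K} (hT : IsUnitaryOp T)
    (h : MapsLegOnto T α α') : LegU T α α' := by
  refine ⟨hT, ⟨fun ξ hξ => ?_⟩, ⟨fun x hx => ?_⟩⟩
  · rw [← SetLike.mem_coe, ← h]
    exact ⟨ξ, hξ, rfl⟩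
  · rw [← SetLike.mem_coe, ← h] at hx
    obtain ⟨ξ, hξ, rfl⟩ := hx
    simp only [← comp_assoc, hT.1, id_comp]
    exact hξ

theorem LegU.mem_iff {T : H →L[ℂ] K} {α : Leg 𝔎 H} {α' : Leg 𝔎 K} (h : LegU T α α')
    {x : 𝔎 →L[ℂ] K} : x ∈ α' ↔ ContinuousLinearMap.adjoint T ∘L x ∈ α := by
  refine ⟨fun hx => h.maps_adjoint.out x hx, fun hx => ?_⟩
  simpa only [← comp_assoc, h.unitary.2, id_comp] using h.maps.out _ hx

/-- Transport of structure: inner products `ξ*ξ'` are unchanged by a unitary, and the spans in the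
module axioms are carried along by `T`. Together with `LegU.nm` it spares separate proofs for `▷`
once those for `◁` are done. -/
theorem LegU.mod {T : H →L[ℂ] K} {α : Leg 𝔎 H} {α' : Leg 𝔎 K} (h : LegU T α α') [hα : Mod b α] :
    Mod b α' := by
  have hA : ∀ x : 𝔎 →L[ℂ] K, T ∘L ContinuousLinearMap.adjoint T ∘L x = x := fun x => by
    rw [← comp_assoc, h.unitary.2, id_comp]
  have hcl : IsClosed (α' : Set (𝔎 →L[ℂ] K)) := by
    have : (α' : Set (𝔎 →L[ℂ] K)) = (fun x => ContinuousLinearMap.adjoint T ∘L x) ⁻¹' α := by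
      ext x
      exact h.mem_iff
    rw [this]
    exact hα.out.isClosed.preimage (by fun_prop)
  refine ⟨hcl, ?_, ?_, ?_⟩
  · refine top_le_iff.1 fun v _ => ?_
    rw [← h.unitary.apply_adjoint_apply v]
    refine map_mem_of_mem_clSpan (S := {v : H | ∃ ξ ∈ α, ∃ ζ : 𝔎, v = ξ ζ}) (isClosed_clSpan _) T
      ?_ (by rw [hα.out.total]; trivial)
    rintro _ ⟨ξ, hξ, ζ, rfl⟩
    exact subset_clSpan ⟨T ∘L ξ, h.maps.out ξ hξ, ζ, rfl⟩
  · refine le_antisymm (clSpan_le hcl ?_) fun x hx => ?_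
    · rintro _ ⟨x, hx, a, ha, rfl⟩
      rw [h.mem_iff, ← comp_assoc]
      exact comp_mem_of_mod (h.mem_iff.1 hx) ha
    · rw [← hA x]
      have hx' := h.mem_iff.1 hx
      rw [← hα.out.right] at hx'
      refine map_mem_of_mem_clSpan (isClosed_clSpan _) (compL ℂ 𝔎 H K T) ?_ hx'
      rintro _ ⟨ξ, hξ, a, ha, rfl⟩
      exact subset_clSpan ⟨T ∘L ξ, h.maps.out ξ hξ, a, ha, rfl⟩
  · rw [← hα.out.full]
    congr 1
    ext x
    constructor
    · rintro ⟨ξ, hξ, ξ', hξ', rfl⟩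
      refine ⟨_, h.mem_iff.1 hξ, _, h.mem_iff.1 hξ', ?_⟩
      rw [adjoint_comp, adjoint_adjoint, comp_assoc, hA]
    · rintro ⟨ξ, hξ, ξ', hξ', rfl⟩
      refine ⟨_, h.maps.out _ hξ, _, h.maps.out _ hξ', ?_⟩
      rw [adjoint_comp, comp_assoc, ← comp_assoc (ContinuousLinearMap.adjoint T), h.unitary.1,
        id_comp]

/-- Since `T` respects the first leg, it intertwines the two `ρ`'s; the normalization condition is
then the image under `T` of the old one. -/
theorem LegU.nm {T : H →L[ℂ] K} {α β : Leg 𝔎 H} {α' β' : Leg 𝔎 K} (h : LegU T α α')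
    (h' : LegU T β β') [hα : Mod b α] [hβ : Mod c β] [hn : Nm b α β] : Nm b α' β' := by
  have := h.mod (b := b)
  have := h'.mod (b := c)
  have hT : ∀ x ∈ b.algd, T ∘L rho α x = rho α' x ∘L T := fun x hx =>
    comp_rho (mem_legComm hx) (mem_legComm hx)
  refine ⟨normalizes_of_maps Mod.out.isClosed (fun x hx => ⟨fun ξ hξ => ?_⟩) fun ξ hξ => ?_⟩
  · have e : ξ = T ∘L ContinuousLinearMap.adjoint T ∘L ξ := by
      rw [← comp_assoc, h.unitary.2, id_comp]
    rw [e, ← comp_assoc, ← hT x hx, comp_assoc]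
    exact h'.maps.out _ ((maps_rho hx).out _ (h'.mem_iff.1 hξ))
  · have e : ξ = T ∘L ContinuousLinearMap.adjoint T ∘L ξ := by
      rw [← comp_assoc, h.unitary.2, id_comp]
    have hξ' := h'.mem_iff.1 hξ
    have hn' := hn.out
    unfold Normalizes at hn'
    rw [← hn'] at hξ'
    rw [e]
    refine map_mem_of_mem_clSpan (isClosed_clSpan _) (compL ℂ 𝔎 H K T) ?_ hξ'
    rintro _ ⟨x, hx, η, hη, rfl⟩
    refine subset_clSpan ⟨x, hx, T ∘L η, h'.maps.out η hη, ?_⟩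
    rw [← comp_assoc, ← hT x hx]
    rfl

/-! ### Legs of relative tensor products -/

section Legs

variable {β α : Leg 𝔎 H} {γ δ : Leg 𝔎 K}

theorem isClosed_ltri (β α : Leg 𝔎 H) (γ : Leg 𝔎 K) :
    IsClosed (ltri β γ α : Set (𝔎 →L[ℂ] RTP β γ)) := isClosed_clSpan _

theorem isClosed_rtri (β : Leg 𝔎 H) (γ δ : Leg 𝔎 K) :
    IsClosed (rtri β γ δ : Set (𝔎 →L[ℂ] RTP β γ)) := isClosed_clSpan _

instance maps_ket2 (η : γ) : Maps (ket2 η : H →L[ℂ] RTP β γ) α (ltri β γ α) :=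
  ⟨fun ξ hξ => subset_clSpan ⟨η, ⟨ξ, hξ⟩, rfl⟩⟩

instance maps_ket1 (ξ : β) : Maps (ket1 ξ : K →L[ℂ] RTP β γ) δ (rtri β γ δ) :=
  ⟨fun η hη => subset_clSpan ⟨ξ, ⟨η, hη⟩, rfl⟩⟩

theorem maps_ltri {T : RTP β γ →L[ℂ] L} {P : Leg 𝔎 L} (hP : IsClosed (P : Set (𝔎 →L[ℂ] L)))
    (h : ∀ η : γ, Maps (T ∘L ket2 η) α P) : Maps T (ltri β γ α) P := by
  refine ⟨fun x hx => map_mem_of_mem_clSpan hP (compL ℂ 𝔎 _ _ T) ?_ hx⟩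
  rintro _ ⟨η, ξ, rfl⟩
  exact (h η).out ξ.1 ξ.2

theorem maps_rtri {T : RTP β γ →L[ℂ] L} {P : Leg 𝔎 L} (hP : IsClosed (P : Set (𝔎 →L[ℂ] L)))
    (h : ∀ ξ : β, Maps (T ∘L ket1 ξ) δ P) : Maps T (rtri β γ δ) P := by
  refine ⟨fun x hx => map_mem_of_mem_clSpan hP (compL ℂ 𝔎 _ _ T) ?_ hx⟩
  rintro _ ⟨η, ξ, rfl⟩
  exact (h η).out ξ.1 ξ.2

/-- To check `T (α ◁ γ) ⊆ P` it suffices to consider kets of generators of `γ`. -/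
theorem maps_ltri_of_clSpan [LC β γ] [Tot β] {S : Set (𝔎 →L[ℂ] K)} (hγ : γ = clSpan S)
    {T : RTP β γ →L[ℂ] L} {P : Leg 𝔎 L} (hP : IsClosed (P : Set (𝔎 →L[ℂ] L)))
    (h : ∀ η : γ, η.1 ∈ S → Maps (T ∘L ket2 η) α P) : Maps T (ltri β γ α) P := by
  refine maps_ltri hP fun η => ⟨fun a ha => ?_⟩
  have hcl : IsClosed (γ : Set (𝔎 →L[ℂ] K)) := by rw [hγ]; exact isClosed_clSpan S
  have hS : S ⊆ γ := fun x hx => by rw [hγ]; exact subset_clSpan hx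
  have key := clSpan_subtype_induction hcl hS hP
    ((compL ℂ 𝔎 _ _).flip a ∘L compL ℂ _ _ _ T ∘L ket2L β γ) ?_ (x := η.1)
    (hγ.le η.2) η.2
  · simp only [coe_comp, Function.comp_apply, ket2L_apply] at key
    exact key
  intro x hx
  simp only [coe_comp, Function.comp_apply, ket2L_apply]
  exact (h ⟨x, hS hx⟩ hx).out a ha

theorem maps_rtri_of_clSpan [LC β γ] [Tot γ] {S : Set (𝔎 →L[ℂ] H)} (hβ : β = clSpan S)
    {T : RTP β γ →L[ℂ] L} {P : Leg 𝔎 L} (hP : IsClosed (P : Set (𝔎 →L[ℂ] L)))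
    (h : ∀ ξ : β, ξ.1 ∈ S → Maps (T ∘L ket1 ξ) δ P) : Maps T (rtri β γ δ) P := by
  refine maps_rtri hP fun ξ => ⟨fun a ha => ?_⟩
  have hcl : IsClosed (β : Set (𝔎 →L[ℂ] H)) := by rw [hβ]; exact isClosed_clSpan S
  have hS : S ⊆ β := fun x hx => by rw [hβ]; exact subset_clSpan hx
  refine clSpan_subtype_induction hcl hS hP
    ((compL ℂ 𝔎 _ _).flip a ∘L compL ℂ _ _ _ T ∘L ket1L β γ) ?_ (x := ξ.1)
    (hβ.le ξ.2) ξ.2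
  intro x hx
  simp only [coe_comp, Function.comp_apply, ket1L_apply]
  exact (h ⟨x, hS hx⟩ hx).out a ha

/-- The flip exchanges `|η⟩₂` and `|η⟩₁`, hence the generators of `α ◁ γ` and of `γ ▷ α`. Several
facts on `▷` are deduced from those on `◁` through it. -/
instance legU_flip_ltri [LC β γ] [Tot β] : LegU (flip β γ) (ltri β γ α) (rtri γ β α) := by
  have := LC.symm β γ
  refine ⟨isUnitaryOp_flip, maps_ltri (isClosed_rtri _ _ _) fun η => ?_, ?_⟩
  · rw [show flip β γ ∘L ket2 η = ket1 η from ContinuousLinearMap.ext fun v => flip_ket2 η v]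
    infer_instance
  · rw [adjoint_flip]
    refine maps_rtri (isClosed_ltri _ _ _) fun η => ?_
    rw [show flip γ β ∘L ket1 η = ket2 η from ContinuousLinearMap.ext fun v => flip_ket1 η v]
    infer_instance

instance legU_flip_rtri [LC β γ] [Tot γ] : LegU (flip β γ) (rtri β γ δ) (ltri γ β δ) := by
  have := LC.symm β γ
  rw [← adjoint_flip (β := γ) (γ := β)]
  exact LegU.adjoint inferInstance

/-- The decisive axiom is fullness: `(|η⟩₂ ξ)* |η'⟩₂ ξ' = ξ* ρ_β(η*η') ξ'`, and `[γ*γ]` is the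
algebra acting through `ρ_β`, which normalizes `α`. Thus the inner products span `[α* ρ_β(𝔅†) α] =
[α*α]`. The other axioms are inherited from `α`. -/
instance mod_ltri [hβ : Mod b β] [hγ : Mod c γ] [hα : Mod d α] [hn : Nm b β α]
    [hd : Dual b c] : Mod d (ltri β γ α) := by
  obtain rfl := hd.out
  have hgen : ∀ (η : γ) {ξ}, ξ ∈ α → ket2 η ∘L ξ ∈ ltri β γ α := fun η ξ hξ =>
    (maps_ket2 η).out ξ hξ
  have hadj : ∀ {ξ ξ' : 𝔎 →L[ℂ] H} (η η' : γ),
      adjoint (ket2 η ∘L ξ : 𝔎 →L[ℂ] RTP β γ) ∘L ket2 η' ∘L ξ' =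
        adjoint ξ ∘L rho β (adjoint η.1 ∘L η'.1) ∘L ξ' := fun η η' => by
    ext v
    simp only [adjoint_comp, coe_comp, Function.comp_apply, adjoint_ket2_ket2]
  have hBcl : IsClosed (d.B : Set (𝔎 →L[ℂ] 𝔎)) := d.isClosed_alg
  have hstar : ∀ x y : 𝔎 →L[ℂ] RTP β γ, adjoint x ∘L y ∈ d.B → adjoint y ∘L x ∈ d.B := by
    intro x y h
    have h' : star (adjoint x ∘L y) ∈ d.alg := star_mem h
    rw [star_eq_adjoint, adjoint_comp, adjoint_adjoint] at h'
    exact h'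
  refine ⟨isClosed_ltri _ _ _, ?_, ?_, ?_⟩
  · rw [← top_le_iff, ← tmul_dense β γ]
    refine clSpan_le (isClosed_clSpan _) ?_
    rintro _ ⟨ξ, ζ, η, rfl⟩
    rw [← ket2_apply]
    refine map_mem_of_mem_clSpan (S := {v : H | ∃ ξ ∈ α, ∃ ζ : 𝔎, v = ξ ζ}) (isClosed_clSpan _)
      (ket2 η) ?_ (by rw [hα.out.total]; trivial)
    rintro _ ⟨ξ, hξ, ζ, rfl⟩
    exact subset_clSpan ⟨_, hgen η hξ, ζ, rfl⟩
  · refine le_antisymm (clSpan_le (isClosed_ltri _ _ _) ?_) (clSpan_le (isClosed_clSpan _) ?_)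
    · rintro _ ⟨x, hx, a, ha, rfl⟩
      refine map_mem_of_mem_clSpan (isClosed_ltri _ _ _) ((compL ℂ 𝔎 𝔎 _).flip a) ?_ hx
      rintro _ ⟨η, ξ, rfl⟩
      exact hgen η (comp_mem_of_mod ξ.2 ha)
    · rintro _ ⟨η, ⟨ξ, hξ⟩, rfl⟩
      rw [← hα.out.right] at hξ
      refine map_mem_of_mem_clSpan (isClosed_clSpan _) (compL ℂ 𝔎 H _ (ket2 η)) ?_ hξ
      rintro _ ⟨ξ, hξ, a, ha, rfl⟩
      exact subset_clSpan ⟨_, hgen η hξ, a, ha, rfl⟩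
  · refine le_antisymm (clSpan_le hBcl ?_) ?_
    · rintro _ ⟨x, hx, y, hy, rfl⟩
      refine map_mem_of_mem_clSpan hBcl (compL ℂ 𝔎 _ 𝔎 (adjoint x)) ?_ hy
      rintro _ ⟨η', ξ', rfl⟩
      -- The density argument works in the second, linear argument only; passing to the adjoint lets
      -- it be applied to the first argument as well.
      refine hstar _ _ ?_
      refine map_mem_of_mem_clSpan hBcl (compL ℂ 𝔎 _ 𝔎 (adjoint (ket2 η' ∘L ξ'.1))) ?_ hx
      rintro _ ⟨η, ξ, rfl⟩
      change adjoint (ket2 η' ∘L ξ'.1 : 𝔎 →L[ℂ] RTP β γ) ∘L ket2 η ∘L ξ.1 ∈ d.B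
      rw [hadj]
      exact adjoint_comp_mem_alg ξ'.2
        ((maps_rho (b := b) (adjoint_comp_mem_alg (b := b.dag) η'.2 η.2)).out _ ξ.2)
    · rw [← hα.out.full]
      refine clSpan_le (isClosed_clSpan _) ?_
      rintro _ ⟨ξ, hξ, ξ', hξ', rfl⟩
      have hn' := hn.out
      unfold Normalizes at hn'
      rw [← hn'] at hξ'
      refine map_mem_of_mem_clSpan (isClosed_clSpan _) (compL ℂ 𝔎 H 𝔎 (adjoint ξ)) ?_ hξ'
      rintro _ ⟨x, hx, ξ'', hξ'', rfl⟩
      -- Since `𝔅† = [γ*γ]`, the element `x` may be replaced by some `η*η'`, for which `ξ* ρ_β(x)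
      -- ξ''` is an inner product of generators of `α ◁ γ`.
      have hx' : x ∈ b.dag.B := hx
      rw [← hγ.out.full] at hx'
      refine clSpan_subtype_induction (Q := b.Bd) b.isClosed_algd ?_ (isClosed_clSpan _)
        (compL ℂ 𝔎 H 𝔎 (adjoint ξ) ∘L (compL ℂ 𝔎 H H).flip ξ'' ∘L rhoL β) ?_ hx' hx
      · rintro _ ⟨η, hη, η', hη', rfl⟩
        exact adjoint_comp_mem_alg (b := b.dag) hη hη'
      · rintro _ ⟨η, hη, η', hη', rfl⟩
        refine subset_clSpan ⟨_, hgen ⟨η, hη⟩ hξ, _, hgen ⟨η', hη'⟩ hξ'', ?_⟩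
        rw [hadj]
        rfl

instance mod_rtri [hβ : Mod b β] [hγ : Mod c γ] [hδ : Mod d δ] [hn : Nm c γ δ]
    [hd : Dual b c] : Mod d (rtri β γ δ) := by
  have := Dual.symm b c
  exact LegU.mod (legU_flip_ltri (β := γ) (γ := β) (α := δ))

theorem rho_ltri_ket2 [LC β γ] [Tot β] [Tot α] [Tot (ltri β γ α)] {x : 𝔎 →L[ℂ] 𝔎}
    (h : x ∈ legComm α) (h' : x ∈ legComm (ltri β γ α)) (η : γ) :
    rho (ltri β γ α) x ∘L ket2 η = ket2 η ∘L rho α x :=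
  (comp_rho h h').symm

theorem rho_rtri_ket1 [LC β γ] [Tot γ] [Tot δ] [Tot (rtri β γ δ)] {x : 𝔎 →L[ℂ] 𝔎}
    (h : x ∈ legComm δ) (h' : x ∈ legComm (rtri β γ δ)) (ξ : β) :
    rho (rtri β γ δ) x ∘L ket1 ξ = ket1 ξ ∘L rho δ x :=
  (comp_rho h h').symm

theorem rho_ltri_eq [LC β γ] [Tot β] [Tot α] [Tot (ltri β γ α)] {x : 𝔎 →L[ℂ] 𝔎}
    (h : x ∈ legComm α) (h' : x ∈ legComm (ltri β γ α)) [Maps (rho α x) β β] :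
    rho (ltri β γ α) x = rtpMap β γ β γ (rho α x) (ContinuousLinearMap.id ℂ K) := by
  refine rtp_ext2 fun η v => ?_
  rw [rtpMap_ket2]
  exact DFunLike.congr_fun (rho_ltri_ket2 h h' η) v

theorem rho_rtri_eq [LC β γ] [Tot β] [Tot γ] [Tot δ] [Tot (rtri β γ δ)] {x : 𝔎 →L[ℂ] 𝔎}
    (h : x ∈ legComm δ) (h' : x ∈ legComm (rtri β γ δ)) [Maps (rho δ x) γ γ] :
    rho (rtri β γ δ) x = rtpMap β γ β γ (ContinuousLinearMap.id ℂ H) (rho δ x) := by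
  refine rtp_ext1 fun η v => ?_
  rw [rtpMap_ket1]
  exact DFunLike.congr_fun (rho_rtri_ket1 h h' η) v

/-- The operator `ρ` of `α ◁ γ` slides through `|η⟩₂` and becomes `ρ_α`, so the condition is the one
for `α` and `α'` with a ket in front. -/
instance nm_ltri_ltri {α' : Leg 𝔎 H} [hβ : Mod b β] [hγ : Mod c γ] [hα : Mod d α] [hn : Nm b β α]
    [hn' : Nm d α α'] [hd : Dual b c] : Nm d (ltri β γ α) (ltri β γ α') := by
  have hr : ∀ x ∈ d.algd, ∀ η : γ, rho (ltri β γ α) x ∘L ket2 η = ket2 η ∘L rho α x :=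
    fun x hx η => rho_ltri_ket2 (mem_legComm hx) (mem_legComm hx) η
  refine ⟨normalizes_of_maps (isClosed_ltri _ _ _) (fun x hx => ?_) ?_⟩
  · refine maps_ltri (isClosed_ltri _ _ _) fun η => ?_
    rw [hr x hx]
    exact (maps_ket2 η).comp (maps_rho hx)
  · refine clSpan_le (isClosed_clSpan _) ?_
    rintro _ ⟨η, ⟨ξ, hξ⟩, rfl⟩
    have hn'' := hn'.out
    unfold Normalizes at hn''
    rw [← hn''] at hξ
    refine map_mem_of_mem_clSpan (isClosed_clSpan _) (compL ℂ 𝔎 H _ (ket2 η)) ?_ hξ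
    rintro _ ⟨x, hx, ξ', hξ', rfl⟩
    refine subset_clSpan ⟨x, hx, _, (maps_ket2 η).out ξ' hξ', ?_⟩
    rw [← comp_assoc, hr x hx]
    rfl

/-- Here `ρ` of `α ◁ γ` is `ρ_α(x) ⊗ Id`, which acts on `|ξ⟩₁` by replacing `ξ` with `ρ_α(x) ξ`.
Hence normalization of `β` by `α` is what is needed, and `δ` plays no role. -/
instance nm_ltri_rtri [hβ : Mod b β] [hγ : Mod c γ] [hα : Mod d α] [hn : Nm b β α]
    [hn' : Nm d α β] [hd : Dual b c] : Nm d (ltri β γ α) (rtri β γ δ) := by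
  have hr : ∀ x ∈ d.algd, ∀ (ξ : β) (hξ : rho α x ∘L ξ.1 ∈ β),
      rho (ltri β γ α) x ∘L ket1 ξ = ket1 (⟨rho α x ∘L ξ.1, hξ⟩ : β) := by
    intro x hx ξ hξ
    have := maps_rho (α := α) (β := β) hx
    rw [rho_ltri_eq (mem_legComm hx) (mem_legComm hx)]
    ext v
    rw [coe_comp, Function.comp_apply, rtpMap_ket1]
    rfl
  refine ⟨normalizes_of_maps (isClosed_rtri _ _ _) (fun x hx => ?_) fun y hy => ?_⟩
  · refine maps_rtri (isClosed_rtri _ _ _) fun ξ => ?_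
    rw [hr x hx ξ ((maps_rho hx).out _ ξ.2)]
    infer_instance
  -- Writing `y` as its image under the identity makes the criterion for maps out of `β ▷ δ`
  -- applicable, so that only kets of the generators `ρ_α(x) ξ'` of `β` have to be treated.
  · rw [show y = ContinuousLinearMap.id ℂ _ ∘L y from rfl]
    refine Maps.out (self := ?_) y hy
    have hn'' := hn'.out
    unfold Normalizes at hn''
    refine maps_rtri_of_clSpan hn''.symm (isClosed_clSpan _) ?_
    rintro ⟨_, hξ⟩ ⟨x, hx, ξ', hξ', rfl⟩
    refine ⟨fun η hη => subset_clSpan ⟨x, hx, _, (maps_ket1 ⟨ξ', hξ'⟩).out η hη, ?_⟩⟩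
    rw [← comp_assoc, hr x hx ⟨ξ', hξ'⟩ hξ]
    rfl

instance nm_rtri_rtri {δ' : Leg 𝔎 K} [hβ : Mod b β] [hγ : Mod c γ] [hδ : Mod d δ] [hδ' : Mod e δ']
    [hn : Nm c γ δ] [hnn : Nm c γ δ'] [hn' : Nm d δ δ'] [hd : Dual b c] :
    Nm d (rtri β γ δ) (rtri β γ δ') := by
  have := Dual.symm b c
  exact LegU.nm (legU_flip_ltri (β := γ) (γ := β) (α := δ))
    (legU_flip_ltri (β := γ) (γ := β) (α := δ'))

instance nm_rtri_ltri [hβ : Mod b β] [hγ : Mod c γ] [hδ : Mod d δ] [hα : Mod e α]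
    [hn : Nm c γ δ] [hnn : Nm b β α] [hn' : Nm d δ γ] [hd : Dual b c] :
    Nm d (rtri β γ δ) (ltri β γ α) := by
  have := Dual.symm b c
  exact LegU.nm (legU_flip_ltri (β := γ) (γ := β) (α := δ))
    (legU_flip_rtri (β := γ) (γ := β) (δ := α))

end Legs

end

section

/-! ### Functoriality of the relative tensor product -/

section Functoriality

variable {β : Leg 𝔎 H} {γ : Leg 𝔎 K} {β' : Leg 𝔎 H'} {γ' : Leg 𝔎 K'} {β'' : Leg 𝔎 L} {γ'' : Leg 𝔎 M}

theorem rtpMap_rtpMap [LC β γ] [LC β' γ'] [LC β'' γ''] [LC β' γ] [LC β'' γ'] [LC β'' γ]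
    (S : H →L[ℂ] H') (T : K →L[ℂ] K') (S' : H' →L[ℂ] L) (T' : K' →L[ℂ] M)
    [hS : Maps S β β'] [hT : Maps T γ γ'] [hS' : Maps S' β' β''] [hT' : Maps T' γ' γ'']
    (v : RTP β γ) :
    rtpMap β' γ' β'' γ'' S' T' (rtpMap β γ β' γ' S T v) =
      rtpMap β γ β'' γ'' (S' ∘L S) (T' ∘L T) v := by
  have := hS'.comp hS
  have := hT'.comp hT
  have : rtpMap β' γ' β'' γ'' S' T' ∘L rtpMap β γ β' γ' S T =
      rtpMap β γ β'' γ'' (S' ∘L S) (T' ∘L T) := rtp_ext fun ξ ζ η => by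
    rw [coe_comp, Function.comp_apply, rtpMap_tmul', rtpMap_tmul', rtpMap_tmul']
    rfl
  exact DFunLike.congr_fun this v

theorem rtpMap_id_apply [h : LC β γ] (v : RTP β γ) :
    rtpMap β γ β γ (ContinuousLinearMap.id ℂ H) (ContinuousLinearMap.id ℂ K) v = v := by
  rw [rtpMap_id h.out]; rfl

theorem adjoint_rtpMap [h1 : LC β γ] [h2 : LC β' γ'] [LC β' γ] [LC β γ']
    (S : H →L[ℂ] H') (T : K →L[ℂ] K') [hS : Maps S β β'] [hT : Maps T γ γ']
    [hS' : Maps (adjoint S) β' β] [hT' : Maps (adjoint T) γ' γ] :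
    adjoint (rtpMap β γ β' γ' S T) = rtpMap β' γ' β γ (adjoint S) (adjoint T) := by
  refine rtp_ext fun ξ' ζ' η' => ext_inner_of_dense (tmul_range β γ) ?_
  rintro _ ⟨⟨ξ, ζ, η⟩, rfl⟩
  rw [adjoint_inner_left, rtpMap_tmul', rtpMap_tmul', inner_tmul h1.out, inner_tmul h2.out]
  simp only [mapLeg, adjoint_comp, adjoint_adjoint, comp_assoc]

theorem isUnitaryOp_rtpMap [LC β γ] [LC β' γ'] [LC β' γ] [LC β γ'] (S : H →L[ℂ] H')
    (T : K →L[ℂ] K') [hS : LegU S β β'] [hT : LegU T γ γ'] :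
    IsUnitaryOp (rtpMap β γ β' γ' S T) := by
  constructor
  · ext v
    rw [adjoint_rtpMap, coe_comp, Function.comp_apply, rtpMap_rtpMap, hS.unitary.1, hT.unitary.1,
      rtpMap_id_apply]
    rfl
  · ext v
    rw [adjoint_rtpMap, coe_comp, Function.comp_apply, rtpMap_rtpMap, hS.unitary.2, hT.unitary.2,
      rtpMap_id_apply]
    rfl

instance maps_rtpMap_ltri {α : Leg 𝔎 H} {α' : Leg 𝔎 H'} [LC β γ] [LC β' γ'] [LC β' γ] [Tot β]
    [Tot β'] (S : H →L[ℂ] H') (T : K →L[ℂ] K') [Maps S β β'] [Maps T γ γ'] [hS : Maps S α α'] :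
    Maps (rtpMap β γ β' γ' S T) (ltri β γ α) (ltri β' γ' α') := by
  refine maps_ltri (isClosed_ltri _ _ _) fun η => ?_
  rw [show rtpMap β γ β' γ' S T ∘L ket2 η = ket2 (mapLeg T η : γ') ∘L S from
    ContinuousLinearMap.ext fun v => rtpMap_ket2 S T η v]
  exact (maps_ket2 _).comp hS

instance maps_rtpMap_rtri {δ : Leg 𝔎 K} {δ' : Leg 𝔎 K'} [LC β γ] [LC β' γ'] [LC β' γ] [Tot γ]
    [Tot γ'] (S : H →L[ℂ] H') (T : K →L[ℂ] K') [Maps S β β'] [Maps T γ γ'] [hT : Maps T δ δ'] :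
    Maps (rtpMap β γ β' γ' S T) (rtri β γ δ) (rtri β' γ' δ') := by
  refine maps_rtri (isClosed_rtri _ _ _) fun η => ?_
  rw [show rtpMap β γ β' γ' S T ∘L ket1 η = ket1 (mapLeg S η : β') ∘L T from
    ContinuousLinearMap.ext fun v => rtpMap_ket1 S T η v]
  exact (maps_ket1 _).comp hT

instance legU_rtpMap_ltri {α : Leg 𝔎 H} {α' : Leg 𝔎 H'} [LC β γ] [LC β' γ'] [LC β' γ] [LC β γ']
    [Tot β] [Tot β'] (S : H →L[ℂ] H') (T : K →L[ℂ] K') [LegU S β β'] [LegU T γ γ'] [LegU S α α'] :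
    LegU (rtpMap β γ β' γ' S T) (ltri β γ α) (ltri β' γ' α') :=
  ⟨isUnitaryOp_rtpMap S T, inferInstance, by rw [adjoint_rtpMap]; infer_instance⟩

instance legU_rtpMap_rtri {δ : Leg 𝔎 K} {δ' : Leg 𝔎 K'} [LC β γ] [LC β' γ'] [LC β' γ] [LC β γ']
    [Tot γ] [Tot γ'] (S : H →L[ℂ] H') (T : K →L[ℂ] K') [LegU S β β'] [LegU T γ γ'] [LegU T δ δ'] :
    LegU (rtpMap β γ β' γ' S T) (rtri β γ δ) (rtri β' γ' δ') :=
  ⟨isUnitaryOp_rtpMap S T, inferInstance, by rw [adjoint_rtpMap]; infer_instance⟩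

theorem tot_ket2 [LC β γ] [Tot β] {ι : Type*} {x : ι → H} (hx : clSpan (Set.range x) = ⊤) :
    clSpan (Set.range fun p : γ × ι => (ket2 p.1 (x p.2) : RTP β γ)) = ⊤ := by
  rw [← top_le_iff, ← tmul_dense β γ]
  refine clSpan_le (isClosed_clSpan _) ?_
  rintro _ ⟨ξ, ζ, η, rfl⟩
  rw [← ket2_apply]
  refine map_mem_of_mem_clSpan (S := Set.range x) (isClosed_clSpan _)
    (ket2 η) ?_ (by rw [hx]; trivial)
  rintro _ ⟨i, rfl⟩
  exact subset_clSpan ⟨(η, i), rfl⟩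

theorem tot_ket1 [LC β γ] [Tot γ] {ι : Type*} {x : ι → K} (hx : clSpan (Set.range x) = ⊤) :
    clSpan (Set.range fun p : β × ι => (ket1 p.1 (x p.2) : RTP β γ)) = ⊤ := by
  rw [← top_le_iff, ← tmul_dense β γ]
  refine clSpan_le (isClosed_clSpan _) ?_
  rintro _ ⟨ξ, ζ, η, rfl⟩
  rw [← ket1_apply]
  refine map_mem_of_mem_clSpan (S := Set.range x) (isClosed_clSpan _)
    (ket1 ξ) ?_ (by rw [hx]; trivial)
  rintro _ ⟨i, rfl⟩
  exact subset_clSpan ⟨(ξ, i), rfl⟩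

theorem tot_id : clSpan (Set.range (fun v : H => v)) = ⊤ :=
  top_le_iff.1 fun v _ => subset_clSpan ⟨v, rfl⟩

end Functoriality

variable {b c d e : CStarBase 𝔎}

theorem adjoint_comp_mem_algd {β : Leg 𝔎 H} {γ : Leg 𝔎 K} [Mod b β] [Mod c γ] [hd : Dual b c]
    (η η' : γ) : adjoint η.1 ∘L η'.1 ∈ b.algd := by
  obtain rfl := hd.out
  exact adjoint_comp_mem_alg (b := b.dag) η.2 η'.2

/-- The operator `ρ_α(x)` maps the leg `α'` into itself, hence commutes with everything of the form
`ρ_{α'}(y)`. -/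
theorem rho_comm {α α' : Leg 𝔎 H} [Mod b α] [Mod c α'] [Nm b α α'] {x y : 𝔎 →L[ℂ] 𝔎}
    (hx : x ∈ b.algd) (hy : y ∈ c.algd) (v : H) :
    rho α x (rho α' y v) = rho α' y (rho α x v) := by
  have := maps_rho (α := α) (β := α') hx
  exact DFunLike.congr_fun (comp_rho (T := rho α x) (β := α') (γ := α') (mem_legComm hy)
    (mem_legComm hy)) v

/-! ### The associativity isomorphism -/

section Assoc

variable {β : Leg 𝔎 H} {γ ε : Leg 𝔎 K} {φ : Leg 𝔎 L}
  [hβ : Mod b β] [hγ : Mod c γ] [hbc : Dual b c] [hε : Mod d ε] [hφ : Mod e φ] [hde : Dual d e]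
  [hγε : Nm c γ ε] [hεγ : Nm d ε γ]

include hβ hγ hbc hε hφ hde hγε hεγ

/-- The left side is `⟨ω | ρ_γ(ξ*ξ') ρ_ε(η*η') ω'⟩`, and the right side has the two `ρ`'s in the
other order. They commute because the structures `γ` and `ε` on `K` are compatible. -/
theorem inner_assoc (ξ ξ' : β) (η η' : φ) (ω ω' : K) :
    ⟪(ket2 η (ket1 ξ ω) : RTP (rtri β γ ε) φ), ket2 η' (ket1 ξ' ω')⟫_ℂ =
      ⟪(ket1 ξ (ket2 η ω) : RTP β (ltri ε φ γ)), ket1 ξ' (ket2 η' ω')⟫_ℂ := by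
  have := Dual.symm b c
  have hη : adjoint η.1 ∘L η'.1 ∈ d.algd := adjoint_comp_mem_algd (β := ε) η η'
  have hξ : adjoint ξ.1 ∘L ξ'.1 ∈ c.algd := adjoint_comp_mem_algd (β := γ) ξ ξ'
  have e1 := DFunLike.congr_fun (rho_rtri_ket1 (β := β) (γ := γ) (δ := ε) (mem_legComm hη)
    (mem_legComm hη) ξ') ω'
  have e2 := DFunLike.congr_fun (rho_ltri_ket2 (β := ε) (γ := φ) (α := γ) (mem_legComm hξ)
    (mem_legComm hξ) η') ω'
  simp only [coe_comp, Function.comp_apply] at e1 e2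
  rw [← adjoint_inner_right, adjoint_ket2_ket2, e1, ← adjoint_inner_right, adjoint_ket1_ket1,
    ← adjoint_inner_right (ket1 ξ), adjoint_ket1_ket1, e2, ← adjoint_inner_right (ket2 η),
    adjoint_ket2_ket2, rho_comm hξ hη]

@[simp] theorem assoc_ket2_ket1 (ξ : β) (η : φ) (ω : K) :
    assoc β γ ε φ (ket2 η (ket1 ξ ω)) = ket1 ξ (ket2 η ω) := by
  obtain ⟨T, hT⟩ := exists_clm_of_inner_eq _
    (fun p : φ × β × K => (ket1 p.2.1 (ket2 p.1 p.2.2) : RTP β (ltri ε φ γ)))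
    (tot_ket2 (β := rtri β γ ε) (γ := φ) (tot_ket1 (β := β) (γ := γ) tot_id))
    (fun i j => inner_assoc _ _ _ _ _ _)
  refine opOfGraph_spec ⟨T, ?_⟩ (ket2 η (ket1 ξ ω), ket1 ξ (ket2 η ω)) ⟨ω, ξ, η, rfl⟩
  rintro _ ⟨ω, ξ, η, rfl⟩
  exact hT (η, ξ, ω)

theorem isUnitaryOp_assoc : IsUnitaryOp (assoc β γ ε φ) := by
  have ht : clSpan (Set.range fun p : φ × β × K =>
      (ket1 p.2.1 (ket2 p.1 p.2.2) : RTP β (ltri ε φ γ))) = ⊤ := by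
    rw [← tot_ket1 (β := β) (γ := ltri ε φ γ) (tot_ket2 (β := ε) (γ := φ) tot_id)]
    congr 1
    ext v
    constructor
    · rintro ⟨p, rfl⟩
      exact ⟨(p.2.1, p.1, p.2.2), rfl⟩
    · rintro ⟨p, rfl⟩
      exact ⟨(p.2.1, p.1, p.2.2), rfl⟩
  exact isUnitaryOp_of_inner_eq
    (tot_ket2 (β := rtri β γ ε) (γ := φ) (tot_ket1 (β := β) (γ := γ) tot_id)) ht
    (fun i j => inner_assoc _ _ _ _ _ _) (fun i => assoc_ket2_ket1 _ _ _)

/-- Fixing the ket of the last factor, rebracketing is `Id ⊗ |η⟩₂`. This and its mirror image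
`assoc_rtpMap_ket1` yield the action on all other iterated kets. -/
theorem assoc_ket2 (η : φ) (v : RTP β γ) : assoc β γ ε φ (ket2 η v) =
    rtpMap β γ β (ltri ε φ γ) (ContinuousLinearMap.id ℂ H) (ket2 η) v := by
  have : assoc β γ ε φ ∘L ket2 η =
      rtpMap β γ β (ltri ε φ γ) (ContinuousLinearMap.id ℂ H) (ket2 η) :=
    rtp_ext1 fun ξ w => by simp
  exact DFunLike.congr_fun this v

@[simp] theorem assoc_rtpMap_ket1 (ξ : β) (w : RTP ε φ) :
    assoc β γ ε φ (rtpMap ε φ (rtri β γ ε) φ (ket1 ξ) (ContinuousLinearMap.id ℂ L) w) =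
      ket1 ξ w := by
  have : assoc β γ ε φ ∘L rtpMap ε φ (rtri β γ ε) φ (ket1 ξ) (ContinuousLinearMap.id ℂ L) =
      ket1 ξ :=
    rtp_ext2 fun η w => by simp
  exact DFunLike.congr_fun this w

@[simp] theorem assoc_ket1_ket1 (ξ : β) (x : ε) (v : L) :
    assoc β γ ε φ (ket1 (mapLeg (ket1 ξ) x : rtri β γ ε) v) = ket1 ξ (ket1 x v) := by
  have := rtpMap_ket1 (β := ε) (γ := φ) (β' := rtri β γ ε) (γ' := φ) (ket1 ξ)
    (ContinuousLinearMap.id ℂ L) x v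
  rw [← assoc_rtpMap_ket1, this]
  rfl

@[simp] theorem assoc_ket2_ket2 (η : φ) (x : γ) (v : H) :
    assoc β γ ε φ (ket2 η (ket2 x v)) = ket2 (mapLeg (ket2 η) x : ltri ε φ γ) v := by
  rw [assoc_ket2, rtpMap_ket2]
  rfl

theorem adjoint_assoc_ket1 (ξ : β) (w : RTP ε φ) :
    adjoint (assoc β γ ε φ) (ket1 ξ w) =
      rtpMap ε φ (rtri β γ ε) φ (ket1 ξ) (ContinuousLinearMap.id ℂ L) w := by
  rw [isUnitaryOp_assoc.adjoint_eq_iff, assoc_rtpMap_ket1]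

theorem adjoint_assoc_rtpMap_ket2 (η : φ) (v : RTP β γ) : adjoint (assoc β γ ε φ)
    (rtpMap β γ β (ltri ε φ γ) (ContinuousLinearMap.id ℂ H) (ket2 η) v) = ket2 η v := by
  rw [isUnitaryOp_assoc.adjoint_eq_iff, assoc_ket2]

theorem adjoint_assoc_ket1_ket2 (ξ : β) (η : φ) (ω : K) :
    adjoint (assoc β γ ε φ) (ket1 ξ (ket2 η ω)) = ket2 η (ket1 ξ ω) := by
  rw [isUnitaryOp_assoc.adjoint_eq_iff, assoc_ket2_ket1]

theorem adjoint_assoc_ket1_ket1 (ξ : β) (x : ε) (v : L) :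
    adjoint (assoc β γ ε φ) (ket1 ξ (ket1 x v)) = ket1 (mapLeg (ket1 ξ) x : rtri β γ ε) v := by
  rw [isUnitaryOp_assoc.adjoint_eq_iff, assoc_ket1_ket1]

theorem adjoint_assoc_ket2 (η : φ) (x : γ) (v : H) :
    adjoint (assoc β γ ε φ) (ket2 (mapLeg (ket2 η) x : ltri ε φ γ) v) = ket2 η (ket2 x v) := by
  rw [isUnitaryOp_assoc.adjoint_eq_iff, assoc_ket2_ket2]

instance legU_assoc_ltri {x : Leg 𝔎 H} :
    LegU (assoc β γ ε φ) (ltri (rtri β γ ε) φ (ltri β γ x)) (ltri β (ltri ε φ γ) x) := by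
  refine ⟨isUnitaryOp_assoc, ?_, ?_⟩
  · refine maps_ltri (isClosed_ltri _ _ _) fun η => maps_ltri (isClosed_ltri _ _ _) fun g => ?_
    rw [show (assoc β γ ε φ ∘L ket2 η) ∘L ket2 g = ket2 (mapLeg (ket2 η) g : ltri ε φ γ) from
      ContinuousLinearMap.ext fun v => assoc_ket2_ket2 η g v]
    infer_instance
  -- The inverse is known on `|x⟩₂` only for the generators `x = |η⟩₂ g` of `γ ◁ φ`, so the density
  -- version of the criterion is used.
  · refine maps_ltri_of_clSpan (γ := ltri ε φ γ) (S := {T | ∃ (η : φ) (ξ : γ), T = ket2 η ∘L ξ.1}) rfl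
      (isClosed_ltri _ _ _) ?_
    rintro ⟨_, hη⟩ ⟨η, g, rfl⟩
    rw [show adjoint (assoc β γ ε φ) ∘L ket2 ⟨_, hη⟩ = ket2 η ∘L ket2 g from
      ContinuousLinearMap.ext fun v => adjoint_assoc_ket2 η g v]
    exact (maps_ket2 _).comp (maps_ket2 _)

instance legU_assoc_mid {x : Leg 𝔎 K} :
    LegU (assoc β γ ε φ) (ltri (rtri β γ ε) φ (rtri β γ x)) (rtri β (ltri ε φ γ) (ltri ε φ x)) := by
  refine ⟨isUnitaryOp_assoc, ?_, ?_⟩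
  · refine maps_ltri (isClosed_rtri _ _ _) fun η => maps_rtri (isClosed_rtri _ _ _) fun ξ => ?_
    rw [show (assoc β γ ε φ ∘L ket2 η) ∘L ket1 ξ = ket1 ξ ∘L ket2 η from
      ContinuousLinearMap.ext fun v => assoc_ket2_ket1 ξ η v]
    exact (maps_ket1 _).comp (maps_ket2 _)
  · refine maps_rtri (isClosed_ltri _ _ _) fun ξ => maps_ltri (isClosed_ltri _ _ _) fun η => ?_
    rw [show (adjoint (assoc β γ ε φ) ∘L ket1 ξ) ∘L ket2 η = ket2 η ∘L ket1 ξ from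
      ContinuousLinearMap.ext fun v => adjoint_assoc_ket1_ket2 ξ η v]
    exact (maps_ket2 _).comp (maps_ket1 _)

instance legU_assoc_rtri {x : Leg 𝔎 L} :
    LegU (assoc β γ ε φ) (rtri (rtri β γ ε) φ x) (rtri β (ltri ε φ γ) (rtri ε φ x)) := by
  refine ⟨isUnitaryOp_assoc, ?_, ?_⟩
  · refine maps_rtri_of_clSpan (β := rtri β γ ε) (S := {T | ∃ (ξ : β) (η : ε), T = ket1 ξ ∘L η.1}) rfl
      (isClosed_rtri _ _ _) ?_
    rintro ⟨_, hη⟩ ⟨ξ, x, rfl⟩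
    rw [show assoc β γ ε φ ∘L ket1 ⟨_, hη⟩ = ket1 ξ ∘L ket1 x from
      ContinuousLinearMap.ext fun v => assoc_ket1_ket1 ξ x v]
    exact (maps_ket1 _).comp (maps_ket1 _)
  · refine maps_rtri (isClosed_rtri _ _ _) fun ξ => maps_rtri (isClosed_rtri _ _ _) fun x => ?_
    rw [show (adjoint (assoc β γ ε φ) ∘L ket1 ξ) ∘L ket1 x =
      ket1 (mapLeg (ket1 ξ) x : rtri β γ ε) from
      ContinuousLinearMap.ext fun v => adjoint_assoc_ket1_ket1 ξ x v]
    infer_instance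

/-- The associativity isomorphism is natural. -/
theorem assoc_naturality {β' : Leg 𝔎 H'} {γ' ε' : Leg 𝔎 K'} {φ' : Leg 𝔎 L'}
    [Mod b β'] [Mod c γ'] [Mod d ε'] [Mod e φ'] [Nm c γ' ε'] [Nm d ε' γ']
    (S : H →L[ℂ] H') (T : K →L[ℂ] K') (U : L →L[ℂ] L') [Maps S β β'] [Maps T γ γ'] [Maps T ε ε']
    [Maps U φ φ'] (v : RTP (rtri β γ ε) φ) :
    assoc β' γ' ε' φ' (rtpMap (rtri β γ ε) φ (rtri β' γ' ε') φ' (rtpMap β γ β' γ' S T) U v) =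
      rtpMap β (ltri ε φ γ) β' (ltri ε' φ' γ') S (rtpMap ε φ ε' φ' T U) (assoc β γ ε φ v) := by
  have : assoc β' γ' ε' φ' ∘L rtpMap (rtri β γ ε) φ (rtri β' γ' ε') φ' (rtpMap β γ β' γ' S T) U =
      rtpMap β (ltri ε φ γ) β' (ltri ε' φ' γ') S (rtpMap ε φ ε' φ' T U) ∘L assoc β γ ε φ := by
    refine rtp_ext2 fun η v => ?_
    have : (assoc β' γ' ε' φ' ∘L rtpMap (rtri β γ ε) φ (rtri β' γ' ε') φ' (rtpMap β γ β' γ' S T) U)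
        ∘L ket2 η = (rtpMap β (ltri ε φ γ) β' (ltri ε' φ' γ') S (rtpMap ε φ ε' φ' T U) ∘L
          assoc β γ ε φ) ∘L ket2 η := rtp_ext1 fun ξ ω => by simp
    exact DFunLike.congr_fun this v
  exact DFunLike.congr_fun this v

end Assoc

end

section

variable {b : CStarBase 𝔎}

/-! ### The isomorphism `Σ₂₃` -/

section Flip23

variable {γ δ : Leg 𝔎 K} {β : Leg 𝔎 H} {ε : Leg 𝔎 L}
  [hγ : Mod b γ] [hδ : Mod b.dag δ] [hβ : Mod b.dag β] [hε : Mod b ε]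
  [hγδ : Nm b γ δ] [hδγ : Nm b.dag δ γ]

include hγ hδ hβ hε hγδ hδγ

/-- As for rebracketing: the two sides differ by the order of `ρ_δ(η*η')` and `ρ_γ(ξ*ξ')`, which
commute. -/
theorem inner_flip23 (ξ ξ' : β) (η η' : ε) (ω ω' : K) :
    ⟪(ket2 η (ket2 ξ ω) : RTP (ltri γ β δ) ε), ket2 η' (ket2 ξ' ω')⟫_ℂ =
      ⟪(ket2 ξ (ket2 η ω) : RTP (ltri δ ε γ) β), ket2 ξ' (ket2 η' ω')⟫_ℂ := by
  have hη : adjoint η.1 ∘L η'.1 ∈ b.dag.algd := adjoint_comp_mem_algd (β := δ) η η'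
  have hξ : adjoint ξ.1 ∘L ξ'.1 ∈ b.algd := adjoint_comp_mem_algd (β := γ) ξ ξ'
  have e1 := DFunLike.congr_fun (rho_ltri_ket2 (β := γ) (γ := β) (α := δ) (mem_legComm hη)
    (mem_legComm hη) ξ') ω'
  have e2 := DFunLike.congr_fun (rho_ltri_ket2 (β := δ) (γ := ε) (α := γ) (mem_legComm hξ)
    (mem_legComm hξ) η') ω'
  simp only [coe_comp, Function.comp_apply] at e1 e2
  rw [← adjoint_inner_right, adjoint_ket2_ket2, e1, ← adjoint_inner_right, adjoint_ket2_ket2,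
    ← adjoint_inner_right (ket2 ξ), adjoint_ket2_ket2, e2, ← adjoint_inner_right (ket2 η),
    adjoint_ket2_ket2, rho_comm hξ hη]

@[simp] theorem flip23_ket2_ket2 (ξ : β) (η : ε) (ω : K) :
    flip23 γ δ β ε (ket2 η (ket2 ξ ω)) = ket2 ξ (ket2 η ω) := by
  obtain ⟨T, hT⟩ := exists_clm_of_inner_eq _
    (fun p : ε × β × K => (ket2 p.2.1 (ket2 p.1 p.2.2) : RTP (ltri δ ε γ) β))
    (tot_ket2 (β := ltri γ β δ) (γ := ε) (tot_ket2 (β := γ) (γ := β) tot_id))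
    (fun i j => inner_flip23 _ _ _ _ _ _)
  refine opOfGraph_spec ⟨T, ?_⟩ (ket2 η (ket2 ξ ω), ket2 ξ (ket2 η ω)) ⟨ω, ξ, η, rfl⟩
  rintro _ ⟨ω, ξ, η, rfl⟩
  exact hT (η, ξ, ω)

theorem isUnitaryOp_flip23 : IsUnitaryOp (flip23 γ δ β ε) := by
  have ht : clSpan (Set.range fun p : ε × β × K =>
      (ket2 p.2.1 (ket2 p.1 p.2.2) : RTP (ltri δ ε γ) β)) = ⊤ := by
    rw [← tot_ket2 (β := ltri δ ε γ) (γ := β) (tot_ket2 (β := δ) (γ := ε) tot_id)]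
    congr 1
    ext v
    constructor
    · rintro ⟨p, rfl⟩
      exact ⟨(p.2.1, p.1, p.2.2), rfl⟩
    · rintro ⟨p, rfl⟩
      exact ⟨(p.2.1, p.1, p.2.2), rfl⟩
  exact isUnitaryOp_of_inner_eq
    (tot_ket2 (β := ltri γ β δ) (γ := ε) (tot_ket2 (β := γ) (γ := β) tot_id)) ht
    (fun i j => inner_flip23 _ _ _ _ _ _) (fun i => flip23_ket2_ket2 _ _ _)

theorem flip23_ket2 (η : ε) (w : RTP γ β) : flip23 γ δ β ε (ket2 η w) =
    rtpMap γ β (ltri δ ε γ) β (ket2 η) (ContinuousLinearMap.id ℂ H) w := by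
  have : flip23 γ δ β ε ∘L ket2 η =
      rtpMap γ β (ltri δ ε γ) β (ket2 η) (ContinuousLinearMap.id ℂ H) :=
    rtp_ext2 fun ξ w => by simp
  exact DFunLike.congr_fun this w

theorem flip23_ket2_ket1 (η : ε) (x : γ) (h : H) : flip23 γ δ β ε (ket2 η (ket1 x h)) =
    ket1 (mapLeg (ket2 η) x : ltri δ ε γ) h := by
  rw [flip23_ket2, rtpMap_ket1]
  rfl

theorem flip23_rtpMap (ξ : β) (v : RTP δ ε) : flip23 γ δ β ε
    (rtpMap δ ε (ltri γ β δ) ε (ket2 ξ) (ContinuousLinearMap.id ℂ L) v) = ket2 ξ v := by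
  have : flip23 γ δ β ε ∘L rtpMap δ ε (ltri γ β δ) ε (ket2 ξ) (ContinuousLinearMap.id ℂ L) =
      ket2 ξ :=
    rtp_ext2 fun η w => by simp
  exact DFunLike.congr_fun this v

theorem flip23_ket1 (ξ : β) (x : δ) (l : L) :
    flip23 γ δ β ε (ket1 (mapLeg (ket2 ξ) x : ltri γ β δ) l) = ket2 ξ (ket1 x l) := by
  have := rtpMap_ket1 (β := δ) (γ := ε) (β' := ltri γ β δ) (γ' := ε) (ket2 ξ)
    (ContinuousLinearMap.id ℂ L) x l
  rw [← flip23_rtpMap, this]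
  rfl

instance legU_flip23_right {x : Leg 𝔎 H} :
    LegU (flip23 γ δ β ε) (ltri (ltri γ β δ) ε (rtri γ β x)) (rtri (ltri δ ε γ) β x) := by
  refine ⟨isUnitaryOp_flip23, ?_, ?_⟩
  · refine maps_ltri (isClosed_rtri _ _ _) fun η => maps_rtri (isClosed_rtri _ _ _) fun g => ?_
    rw [show (flip23 γ δ β ε ∘L ket2 η) ∘L ket1 g = ket1 (mapLeg (ket2 η) g : ltri δ ε γ) from
      ContinuousLinearMap.ext fun v => flip23_ket2_ket1 η g v]
    infer_instance
  · refine maps_rtri_of_clSpan (β := ltri δ ε γ) (S := {T | ∃ (η : ε) (ξ : γ), T = ket2 η ∘L ξ.1})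
      rfl (isClosed_ltri _ _ _) ?_
    rintro ⟨_, hη⟩ ⟨η, g, rfl⟩
    rw [show adjoint (flip23 γ δ β ε) ∘L ket1 ⟨_, hη⟩ = ket2 η ∘L ket1 g from
      ContinuousLinearMap.ext fun v =>
        isUnitaryOp_flip23.adjoint_eq_iff.2 (flip23_ket2_ket1 η g v)]
    exact (maps_ket2 _).comp (maps_ket1 _)

instance legU_flip23_mid {x : Leg 𝔎 L} :
    LegU (flip23 γ δ β ε) (rtri (ltri γ β δ) ε x) (ltri (ltri δ ε γ) β (rtri δ ε x)) := by
  refine ⟨isUnitaryOp_flip23, ?_, ?_⟩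
  · refine maps_rtri_of_clSpan (β := ltri γ β δ) (S := {T | ∃ (η : β) (ξ : δ), T = ket2 η ∘L ξ.1})
      rfl (isClosed_ltri _ _ _) ?_
    rintro ⟨_, hη⟩ ⟨ξ, x, rfl⟩
    rw [show flip23 γ δ β ε ∘L ket1 ⟨_, hη⟩ = ket2 ξ ∘L ket1 x from
      ContinuousLinearMap.ext fun v => flip23_ket1 ξ x v]
    exact (maps_ket2 _).comp (maps_ket1 _)
  · refine maps_ltri (isClosed_rtri _ _ _) fun ξ => maps_rtri (isClosed_rtri _ _ _) fun x => ?_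
    rw [show (adjoint (flip23 γ δ β ε) ∘L ket2 ξ) ∘L ket1 x =
      ket1 (mapLeg (ket2 ξ) x : ltri γ β δ) from
      ContinuousLinearMap.ext fun v => isUnitaryOp_flip23.adjoint_eq_iff.2 (flip23_ket1 ξ x v)]
    infer_instance

end Flip23

/-! ### The operator `X₁₃` -/

section Leg13

variable {γ δ : Leg 𝔎 K} {α β : Leg 𝔎 H} {ε : Leg 𝔎 L}
  [hγ : Mod b γ] [hδ : Mod b.dag δ] [hγδ : Nm b γ δ] [hδγ : Nm b.dag δ γ]
  [hα : Mod b α] [hβ : Mod b.dag β] [hαβ : Nm b α β] [hβα : Nm b.dag β α] [hε : Mod b ε]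

include hγ hδ hγδ hδγ hα hβ hαβ hβα hε

/-- The characteristic property of `X₁₃`: it commutes with the insertion of elements of `ε`. -/
theorem leg13_rtpMap_ket1 (X : RTP δ α →L[ℂ] RTP γ β) [Maps X (rtri δ α β) (ltri γ β δ)] (η : ε)
    (v : RTP δ α) :
    leg13 α β γ δ ε X
        (rtpMap δ α δ (rtri ε β α) (ContinuousLinearMap.id ℂ K) (ket1 η) v) =
      rtpMap γ β (ltri δ ε γ) β (ket2 η) (ContinuousLinearMap.id ℂ H) (X v) := by
  have : flip ε β ∘L ket1 η = ket2 η := ContinuousLinearMap.ext fun v => flip_ket1 η v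
  simp only [leg13, coe_comp, Function.comp_apply, rtpMap_rtpMap, comp_id, this,
    adjoint_assoc_rtpMap_ket2, rtpMap_ket2, flip23_ket2, mapLeg_id]

omit hγ hγδ hδγ in
-- Vectors with a fixed `η ∈ ε` inserted in the middle are total. Combined with the characteristic
-- property of `X₁₃`, this reduces statements about it to `X` itself.
theorem leg13_ext {S T : RTP δ (rtri ε β α) →L[ℂ] M}
    (h : ∀ (η : ε) (v : RTP δ α),
      S (rtpMap δ α δ (rtri ε β α) (ContinuousLinearMap.id ℂ K) (ket1 η) v) =
      T (rtpMap δ α δ (rtri ε β α) (ContinuousLinearMap.id ℂ K) (ket1 η) v)) : S = T := by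
  refine rtp_ext1 fun ξ w => ?_
  have : S ∘L ket1 ξ = T ∘L ket1 ξ := rtp_ext1 fun η v => by
    have := h η (ket1 ξ v)
    rw [rtpMap_ket1] at this
    exact this
  exact DFunLike.congr_fun this w

/-- The leg is followed through the four factors of `X₁₃`: `Id ⊗ Σ` keeps the outer shape, the
inverse rebracketing moves to `(γ ◁ α) ◁ ε`, then `X` turns `γ ◁ α` into `γ ▷ α`, and `Σ₂₃` produces
the target. The other two legs are treated in the same way. -/
theorem legU_leg13_left (X : RTP δ α →L[ℂ] RTP γ β) [LegU X (rtri δ α β) (ltri γ β δ)]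
    [LegU X (ltri δ α γ) (rtri γ β α)] :
    LegU (leg13 α β γ δ ε X) (ltri δ (rtri ε β α) γ) (rtri (ltri δ ε γ) β α) := by
  have h1 : LegU (flip ε β) (rtri ε β α) (ltri β ε α) := inferInstance
  exact (legU_flip23_right (x := α)).comp <| (inferInstance : LegU _
    (ltri (rtri δ α β) ε (ltri δ α γ)) (ltri (ltri γ β δ) ε (rtri γ β α))).comp <|
    (legU_assoc_ltri (x := γ)).adjoint.comp (inferInstance : LegU _
      (ltri δ (rtri ε β α) γ) (ltri δ (ltri β ε α) γ))

theorem legU_leg13_mid (X : RTP δ α →L[ℂ] RTP γ β) [LegU X (rtri δ α β) (ltri γ β δ)]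
    (x : Leg 𝔎 L) :
    LegU (leg13 α β γ δ ε X) (rtri δ (rtri ε β α) (ltri ε β x)) (ltri (ltri δ ε γ) β (rtri δ ε x)) := by
  exact (legU_flip23_mid (x := x)).comp <| (inferInstance : LegU _
    (rtri (rtri δ α β) ε x) (rtri (ltri γ β δ) ε x)).comp <|
    (legU_assoc_rtri (x := x)).adjoint.comp (inferInstance : LegU _
      (rtri δ (rtri ε β α) (ltri ε β x)) (rtri δ (ltri β ε α) (rtri β ε x)))

theorem legU_leg13_right (X : RTP δ α →L[ℂ] RTP γ β) [LegU X (rtri δ α β) (ltri γ β δ)]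
    (y : Leg 𝔎 H) [LegU X (rtri δ α y) (rtri γ β y)] :
    LegU (leg13 α β γ δ ε X) (rtri δ (rtri ε β α) (rtri ε β y)) (rtri (ltri δ ε γ) β y) := by
  exact (legU_flip23_right (x := y)).comp <| (inferInstance : LegU _
    (ltri (rtri δ α β) ε (rtri δ α y)) (ltri (ltri γ β δ) ε (rtri γ β y))).comp <|
    (legU_assoc_mid (x := y)).adjoint.comp (inferInstance : LegU _
      (rtri δ (rtri ε β α) (rtri ε β y)) (rtri δ (ltri β ε α) (ltri β ε y)))

/-- Naturality of `X₁₃` in all spaces on which `X` does not depend, and for intertwiners. -/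
theorem leg13_naturality {γ' δ' : Leg 𝔎 K'} [Mod b γ'] [Mod b.dag δ'] [Nm b γ' δ'] [Nm b.dag δ' γ']
    {ε' : Leg 𝔎 L'} [Mod b ε'] (X : RTP δ α →L[ℂ] RTP γ β) (X' : RTP δ' α →L[ℂ] RTP γ' β)
    [Maps X (rtri δ α β) (ltri γ β δ)] [Maps X' (rtri δ' α β) (ltri γ' β δ')]
    (S : K →L[ℂ] K') (T : L →L[ℂ] L') [hS : Maps S γ γ'] [Maps S δ δ'] [hT : Maps T ε ε']
    (hX : ∀ v, X' (rtpMap δ α δ' α S (ContinuousLinearMap.id ℂ H) v) =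
      rtpMap γ β γ' β S (ContinuousLinearMap.id ℂ H) (X v)) (v : RTP δ (rtri ε β α)) :
    leg13 α β γ' δ' ε' X' (rtpMap δ (rtri ε β α) δ' (rtri ε' β α) S
        (rtpMap ε β ε' β T (ContinuousLinearMap.id ℂ H)) v) =
      rtpMap (ltri δ ε γ) β (ltri δ' ε' γ') β (rtpMap δ ε δ' ε' S T) (ContinuousLinearMap.id ℂ H)
        (leg13 α β γ δ ε X v) := by
  have : leg13 α β γ' δ' ε' X' ∘L rtpMap δ (rtri ε β α) δ' (rtri ε' β α) S
        (rtpMap ε β ε' β T (ContinuousLinearMap.id ℂ H)) =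
      rtpMap (ltri δ ε γ) β (ltri δ' ε' γ') β (rtpMap δ ε δ' ε' S T) (ContinuousLinearMap.id ℂ H)
        ∘L leg13 α β γ δ ε X := by
    refine leg13_ext fun η v => ?_
    simp only [coe_comp, Function.comp_apply, leg13_rtpMap_ket1, rtpMap_rtpMap, comp_id]
    have e1 : rtpMap ε β ε' β T (ContinuousLinearMap.id ℂ H) ∘L ket1 η =
        ket1 (mapLeg T η : ε') := ContinuousLinearMap.ext fun v => by simp
    have e2 : rtpMap δ ε δ' ε' S T ∘L ket2 η = ket2 (mapLeg T η : ε') ∘L S :=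
      ContinuousLinearMap.ext fun v => by simp
    rw [e1, e2]
    have e3 := leg13_rtpMap_ket1 (ε := ε') X' (mapLeg T η)
      (rtpMap δ α δ' α S (ContinuousLinearMap.id ℂ H) v)
    rw [hX, rtpMap_rtpMap, rtpMap_rtpMap, comp_id, comp_id, id_comp] at e3
    exact e3
  exact DFunLike.congr_fun this v

end Leg13

end

section

variable {b : CStarBase 𝔎}

theorem rtp_ext21 {β : Leg 𝔎 H} {γ ε : Leg 𝔎 K} {φ : Leg 𝔎 L} [LC β γ] [Tot γ]
    [LC (rtri β γ ε) φ] [Tot (rtri β γ ε)] {S T : RTP (rtri β γ ε) φ →L[ℂ] M}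
    (h : ∀ (η : φ) (ξ : β) (v : K), S (ket2 η (ket1 ξ v)) = T (ket2 η (ket1 ξ v))) : S = T :=
  rtp_ext2 fun η v => by
    have : S ∘L ket2 η = T ∘L ket2 η := rtp_ext1 (h η)
    exact DFunLike.congr_fun this v

theorem rtp_ext211 {β : Leg 𝔎 H} {γ : Leg 𝔎 K} {δ : Leg 𝔎 L} {φ : Leg 𝔎 M}
    {γ' ε : Leg 𝔎 (RTP γ δ)} [LC β γ'] [Tot γ'] [LC γ δ] [Tot δ]
    [LC (rtri β γ' ε) φ] [Tot (rtri β γ' ε)] {S T : RTP (rtri β γ' ε) φ →L[ℂ] H'}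
    (h : ∀ (η : φ) (ξ : β) (ω : γ) (v : L),
      S (ket2 η (ket1 ξ (ket1 ω v))) = T (ket2 η (ket1 ξ (ket1 ω v)))) : S = T :=
  rtp_ext21 fun η ξ v => by
    have : S ∘L ket2 η ∘L ket1 ξ = T ∘L ket2 η ∘L ket1 ξ := rtp_ext1 (h η ξ)
    exact DFunLike.congr_fun this v

/-! ### Tensor products of representations -/

/-- The operator `X₁₃ Y₂₃`. -/
def tensorX (α β : Leg 𝔎 H) (γ δ : Leg 𝔎 K) (ε φ : Leg 𝔎 L) (X : RTP δ α →L[ℂ] RTP γ β)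
    (Y : RTP φ α →L[ℂ] RTP ε β) : RTP (rtri δ ε φ) α →L[ℂ] RTP (ltri δ ε γ) β :=
  leg13 α β γ δ ε X ∘L rtpMap δ (ltri φ α ε) δ (rtri ε β α) (ContinuousLinearMap.id ℂ K) Y
    ∘L assoc δ ε φ α

theorem tensorX_apply {α β : Leg 𝔎 H} {γ δ : Leg 𝔎 K} {ε φ : Leg 𝔎 L} (X : RTP δ α →L[ℂ] RTP γ β)
    (Y : RTP φ α →L[ℂ] RTP ε β) (v : RTP (rtri δ ε φ) α) : tensorX α β γ δ ε φ X Y v =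
    leg13 α β γ δ ε X (rtpMap δ (ltri φ α ε) δ (rtri ε β α) (ContinuousLinearMap.id ℂ K) Y
      (assoc δ ε φ α v)) := rfl

section TensorX

variable {α β : Leg 𝔎 H} {γ δ : Leg 𝔎 K} {ε φ : Leg 𝔎 L} {μ ν : Leg 𝔎 M}
  [hα : Mod b α] [hβ : Mod b.dag β] [hαβ : Nm b α β] [hβα : Nm b.dag β α]
  [hγ : Mod b γ] [hδ : Mod b.dag δ] [hγδ : Nm b γ δ] [hδγ : Nm b.dag δ γ]
  [hε : Mod b ε] [hφ : Mod b.dag φ] [hεφ : Nm b ε φ] [hφε : Nm b.dag φ ε]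
  [hμ : Mod b μ] [hν : Mod b.dag ν] [hμν : Nm b μ ν] [hνμ : Nm b.dag ν μ]
  (X : RTP δ α →L[ℂ] RTP γ β) [hX : LegU X (ltri δ α γ) (rtri γ β α)]
  [hX' : LegU X (rtri δ α β) (ltri γ β δ)]
  (Y : RTP φ α →L[ℂ] RTP ε β) [hY : LegU Y (ltri φ α ε) (rtri ε β α)]
  [hY' : LegU Y (rtri φ α β) (ltri ε β φ)]

include hα hβ hαβ hβα hγ hδ hγδ hδγ hε hφ hεφ hφε hX hX' hY

theorem legU_tensorX_left :
    LegU (tensorX α β γ δ ε φ X Y) (ltri (rtri δ ε φ) α (ltri δ ε γ)) (rtri (ltri δ ε γ) β α) :=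
  (legU_leg13_left X).comp <| (inferInstance : LegU _ (ltri δ (ltri φ α ε) γ)
    (ltri δ (rtri ε β α) γ)).comp (legU_assoc_ltri (x := γ))

include hY'

theorem legU_tensorX_mid :
    LegU (tensorX α β γ δ ε φ X Y) (rtri (rtri δ ε φ) α β) (ltri (ltri δ ε γ) β (rtri δ ε φ)) :=
  (legU_leg13_mid X φ).comp <| (inferInstance : LegU _ (rtri δ (ltri φ α ε) (rtri φ α β))
    (rtri δ (rtri ε β α) (ltri ε β φ))).comp (legU_assoc_rtri (x := β))

omit hY'

theorem legU_tensorX_right (x : Leg 𝔎 H) [LegU X (rtri δ α x) (rtri γ β x)]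
    [LegU Y (rtri φ α x) (rtri ε β x)] :
    LegU (tensorX α β γ δ ε φ X Y) (rtri (rtri δ ε φ) α x) (rtri (ltri δ ε γ) β x) :=
  (legU_leg13_right X x).comp <| (inferInstance : LegU _ (rtri δ (ltri φ α ε) (rtri φ α x))
    (rtri δ (rtri ε β α) (rtri ε β x))).comp (legU_assoc_rtri (x := x))

include hμ hY'

/-- `(X ⊠ Y)₁₃` is the composition of `X₁₃` and `Y₁₃`. -/
theorem leg13_tensorX (v : RTP (rtri δ ε φ) (rtri μ β α)) :
    rtpMap (ltri (rtri δ ε φ) μ (ltri δ ε γ)) β (ltri δ (ltri φ μ ε) γ) β (assoc δ ε φ μ)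
        (ContinuousLinearMap.id ℂ H)
        (leg13 α β (ltri δ ε γ) (rtri δ ε φ) μ (tensorX α β γ δ ε φ X Y) v) =
      leg13 α β γ δ (ltri φ μ ε) X
        (rtpMap δ (ltri φ (rtri μ β α) ε) δ (rtri (ltri φ μ ε) β α) (ContinuousLinearMap.id ℂ K)
          (leg13 α β ε φ μ Y) (assoc δ ε φ (rtri μ β α) v)) := by
  have h1 := legU_tensorX_mid (α := α) (β := β) X Y
  have h2 := legU_leg13_left (ε := μ) Y
  have : rtpMap (ltri (rtri δ ε φ) μ (ltri δ ε γ)) β (ltri δ (ltri φ μ ε) γ) β (assoc δ ε φ μ)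
        (ContinuousLinearMap.id ℂ H) ∘L
        leg13 α β (ltri δ ε γ) (rtri δ ε φ) μ (tensorX α β γ δ ε φ X Y) =
      leg13 α β γ δ (ltri φ μ ε) X ∘L
        rtpMap δ (ltri φ (rtri μ β α) ε) δ (rtri (ltri φ μ ε) β α) (ContinuousLinearMap.id ℂ K)
          (leg13 α β ε φ μ Y) ∘L assoc δ ε φ (rtri μ β α) := by
    -- After insertion of `η` the left side is `X₁₃ Y₂₃ v` with `η` inserted afterwards, while on
    -- the right the insertion has passed `Y` only. The remaining equality is naturality of `X₁₃`
    -- along `|η⟩₂ : L → L ⊗ M`.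
    refine leg13_ext fun η v => ?_
    simp only [coe_comp, Function.comp_apply]
    have e1 : assoc δ ε φ μ ∘L ket2 η =
        rtpMap δ ε δ (ltri φ μ ε) (ContinuousLinearMap.id ℂ K) (ket2 η) :=
      ContinuousLinearMap.ext fun v => assoc_ket2 η v
    have e2 : leg13 α β ε φ μ Y ∘L
        rtpMap φ α φ (rtri μ β α) (ContinuousLinearMap.id ℂ L) (ket1 η) =
        rtpMap ε β (ltri φ μ ε) β (ket2 η) (ContinuousLinearMap.id ℂ H) ∘L Y :=
      ContinuousLinearMap.ext fun v => leg13_rtpMap_ket1 Y η v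
    have e3 := assoc_naturality (β := δ) (γ := ε) (ε := φ) (φ := α) (β' := δ) (γ' := ε) (ε' := φ)
      (φ' := rtri μ β α) (ContinuousLinearMap.id ℂ K) (ContinuousLinearMap.id ℂ L) (ket1 η) v
    have e4 : rtpMap δ ε δ ε (ContinuousLinearMap.id ℂ K) (ContinuousLinearMap.id ℂ L) =
      ContinuousLinearMap.id ℂ _ := rtpMap_id LC.out
    rw [e4] at e3
    rw [leg13_rtpMap_ket1, rtpMap_rtpMap, e1, e3, rtpMap_rtpMap, e2, tensorX_apply]
    have e5 := leg13_naturality (α := α) (β := β) (γ := γ) (δ := δ) (ε := ε) (γ' := γ) (δ' := δ)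
      (ε' := ltri φ μ ε) X X (ContinuousLinearMap.id ℂ K) (ket2 η)
      (fun v => by rw [rtpMap_id_apply, rtpMap_id_apply])
      (rtpMap δ (ltri φ α ε) δ (rtri ε β α) (ContinuousLinearMap.id ℂ K) Y (assoc δ ε φ α v))
    rw [rtpMap_rtpMap] at e5
    exact e5.symm
  exact DFunLike.congr_fun this v

end TensorX

/-! ### The pentagon equation -/

/-- The operator on `(L_ε ⊗ _βH)_{ε ▷ β̂} ⊗ _αH` that acts like `V` on the last two factors. -/
def leg23 (βh α β : Leg 𝔎 H) (V : RTP βh α →L[ℂ] RTP α β) (ε : Leg 𝔎 L) :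
    RTP (rtri ε β βh) α →L[ℂ] RTP (rtri ε β α) β :=
  adjoint (assoc ε β α β) ∘L rtpMap ε (ltri βh α β) ε (ltri α β β) (ContinuousLinearMap.id ℂ L) V
    ∘L assoc ε β βh α

section Pentagon

variable {βh α β : Leg 𝔎 H} {γ δ : Leg 𝔎 K} {ε φ : Leg 𝔎 L}
  [hβh : Mod b.dag βh] [hα : Mod b α] [hβ : Mod b.dag β] [hαβ : Nm b α β] [hβα : Nm b.dag β α]
  [hβhα : Nm b.dag βh α] [hαβh : Nm b α βh] [hββh : Nm b.dag β βh] [hβhβ : Nm b.dag βh β]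
  (V : RTP βh α →L[ℂ] RTP α β) [hV : LegU V (ltri βh α β) (ltri α β β)]
  [hV' : LegU V (ltri βh α α) (rtri α β α)]

include hβh hα hβ hαβ hβα hβhα hαβh hββh hβhβ

theorem leg23_ext [hε : Mod b ε] {S T : RTP (rtri ε β βh) α →L[ℂ] M}
    (h : ∀ (η : ε) (v : RTP βh α),
      S (rtpMap βh α (rtri ε β βh) α (ket1 η) (ContinuousLinearMap.id ℂ H) v) =
      T (rtpMap βh α (rtri ε β βh) α (ket1 η) (ContinuousLinearMap.id ℂ H) v)) : S = T := by
  refine rtp_ext2 fun x w => ?_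
  have : S ∘L ket2 x = T ∘L ket2 x := rtp_ext1 fun η v => by
    have := h η (ket2 x v)
    rw [rtpMap_ket2] at this
    exact this
  exact DFunLike.congr_fun this w

include hV

/-- Both rebracketings turn `|η⟩₁ ⊗ Id` into a plain ket `|η⟩₁`, past which `Id ⊗ V` acts as `V`.
This property characterizes the operator, by `leg23_ext`. -/
theorem leg23_rtpMap_ket1 [hε : Mod b ε] (η : ε) (v : RTP βh α) :
    leg23 βh α β V ε (rtpMap βh α (rtri ε β βh) α (ket1 η) (ContinuousLinearMap.id ℂ H) v) =
      rtpMap α β (rtri ε β α) β (ket1 η) (ContinuousLinearMap.id ℂ H) (V v) := by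
  simp only [leg23, coe_comp, Function.comp_apply]
  rw [assoc_rtpMap_ket1, rtpMap_ket1, adjoint_assoc_ket1]
  rfl

theorem leg23_naturality [hε : Mod b ε] {ε' : Leg 𝔎 L'} [Mod b ε'] (T : L →L[ℂ] L') [Maps T ε ε']
    (v : RTP (rtri ε β βh) α) :
    leg23 βh α β V ε' (rtpMap (rtri ε β βh) α (rtri ε' β βh) α
      (rtpMap ε β ε' β T (ContinuousLinearMap.id ℂ H)) (ContinuousLinearMap.id ℂ H) v) =
    rtpMap (rtri ε β α) β (rtri ε' β α) β
      (rtpMap ε β ε' β T (ContinuousLinearMap.id ℂ H)) (ContinuousLinearMap.id ℂ H)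
      (leg23 βh α β V ε v) := by
  have : leg23 βh α β V ε' ∘L rtpMap (rtri ε β βh) α (rtri ε' β βh) α
      (rtpMap ε β ε' β T (ContinuousLinearMap.id ℂ H)) (ContinuousLinearMap.id ℂ H) =
    rtpMap (rtri ε β α) β (rtri ε' β α) β
      (rtpMap ε β ε' β T (ContinuousLinearMap.id ℂ H)) (ContinuousLinearMap.id ℂ H) ∘L
      leg23 βh α β V ε := by
    refine leg23_ext fun η v => ?_
    have e1 : rtpMap ε β ε' β T (ContinuousLinearMap.id ℂ H) ∘L ket1 η =
        ket1 (mapLeg T η : ε') := ContinuousLinearMap.ext fun v => by simp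
    simp only [coe_comp, Function.comp_apply, leg23_rtpMap_ket1, rtpMap_rtpMap, comp_id, e1]
  exact DFunLike.congr_fun this v

include hV'

theorem legU_leg23 [hε : Mod b ε] :
    LegU (leg23 βh α β V ε) (ltri (rtri ε β βh) α (rtri ε β α)) (rtri (rtri ε β α) β α) :=
  (legU_assoc_rtri (x := α)).adjoint.comp <| (inferInstance : LegU _
    (rtri ε (ltri βh α β) (ltri βh α α)) (rtri ε (ltri α β β) (rtri α β α))).comp
    (legU_assoc_mid (x := α))

omit hV' in
-- The final rebracketing on the right is unitary and can be moved to the other side, where it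
-- completes `Id ⊗ V` to the operator `leg23`.
theorem pentagon_iff [hγ : Mod b γ] (X : RTP δ α →L[ℂ] RTP γ β) :
    Pentagon βh α β V γ δ X ↔ ∀ v, leg23 βh α β V γ (rtpMap (rtri δ α βh) α (rtri γ β βh) α X
        (ContinuousLinearMap.id ℂ H) v) =
      rtpMap (ltri δ α γ) β (rtri γ β α) β X (ContinuousLinearMap.id ℂ H) (leg13 α β γ δ α X
        (rtpMap δ (ltri βh α α) δ (rtri α β α) (ContinuousLinearMap.id ℂ K) V
          (assoc δ α βh α v))) := by
  have hu : IsUnitaryOp (assoc γ β α β) := isUnitaryOp_assoc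
  constructor
  · intro h v
    simp only [leg23, coe_comp, Function.comp_apply]
    rw [hu.adjoint_eq_iff]
    exact (DFunLike.congr_fun h v).symm
  · intro h
    refine ContinuousLinearMap.ext fun v => ?_
    have := h v
    simp only [leg23, coe_comp, Function.comp_apply] at this
    rw [hu.adjoint_eq_iff] at this
    exact this.symm

/-- The pentagon equation with an additional space `L` between the first and the second factor. -/
theorem pentagon_leg [hγ : Mod b γ] [hδ : Mod b.dag δ] [hγδ : Nm b γ δ] [hδγ : Nm b.dag δ γ]
    [hε : Mod b ε] (X : RTP δ α →L[ℂ] RTP γ β)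
    [hX : LegU X (ltri δ α γ) (rtri γ β α)] [hX' : LegU X (rtri δ α β) (ltri γ β δ)]
    [hX'' : LegU X (rtri δ α βh) (rtri γ β βh)]
    (h : Pentagon βh α β V γ δ X) (v : RTP (rtri δ (rtri ε β α) (rtri ε β βh)) α) :
    leg23 βh α β V (ltri δ ε γ)
      (rtpMap (rtri δ (rtri ε β α) (rtri ε β βh)) α (rtri (ltri δ ε γ) β βh) α
        (leg13 α β γ δ ε X) (ContinuousLinearMap.id ℂ H) v) =
    rtpMap (ltri δ (rtri ε β α) γ) β (rtri (ltri δ ε γ) β α) β (leg13 α β γ δ ε X)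
      (ContinuousLinearMap.id ℂ H) (leg13 α β γ δ (rtri ε β α) X
        (rtpMap δ (ltri (rtri ε β βh) α (rtri ε β α)) δ (rtri (rtri ε β α) β α)
          (ContinuousLinearMap.id ℂ K) (leg23 βh α β V ε)
          (assoc δ (rtri ε β α) (rtri ε β βh) α v))) := by
  have l1 := legU_leg13_left (ε := ε) X
  have l2 := legU_leg13_right (ε := ε) X βh
  have l3 := legU_leg23 (βh := βh) (ε := ε) V
  rw [pentagon_iff] at h
  have : leg23 βh α β V (ltri δ ε γ) ∘L
      rtpMap (rtri δ (rtri ε β α) (rtri ε β βh)) α (rtri (ltri δ ε γ) β βh) α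
        (leg13 α β γ δ ε X) (ContinuousLinearMap.id ℂ H) =
    rtpMap (ltri δ (rtri ε β α) γ) β (rtri (ltri δ ε γ) β α) β (leg13 α β γ δ ε X)
      (ContinuousLinearMap.id ℂ H) ∘L leg13 α β γ δ (rtri ε β α) X ∘L
        rtpMap δ (ltri (rtri ε β βh) α (rtri ε β α)) δ (rtri (rtri ε β α) β α)
          (ContinuousLinearMap.id ℂ K) (leg23 βh α β V ε) ∘L
          assoc δ (rtri ε β α) (rtri ε β βh) α := by
    refine rtp_ext211 fun x ξ η h' => ?_
    -- Each test vector arises from a vector `u` of `(K ⊗ H) ⊗ H` by inserting `η`. Every operator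
    -- in the equation commutes with the insertion, which leaves the pentagon equation for `X` at
    -- `u`.
    obtain ⟨u, hu⟩ : ∃ u, (ket2 x (ket1 ξ (ket1 η h')) :
        RTP (rtri δ (rtri ε β α) (rtri ε β βh)) α) =
        rtpMap (rtri δ α βh) α (rtri δ (rtri ε β α) (rtri ε β βh)) α
          (rtpMap δ α δ (rtri ε β α) (ContinuousLinearMap.id ℂ K) (ket1 η))
          (ContinuousLinearMap.id ℂ H) u :=
      ⟨ket2 x (ket1 ξ h'), by rw [rtpMap_ket2, rtpMap_ket1]; rfl⟩
    simp only [coe_comp, Function.comp_apply, hu]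
    have e1 : leg13 α β γ δ ε X ∘L
        rtpMap δ α δ (rtri ε β α) (ContinuousLinearMap.id ℂ K) (ket1 η) =
        rtpMap γ β (ltri δ ε γ) β (ket2 η) (ContinuousLinearMap.id ℂ H) ∘L X :=
      ContinuousLinearMap.ext fun v => leg13_rtpMap_ket1 X η v
    have e2 : leg23 βh α β V ε ∘L
        rtpMap βh α (rtri ε β βh) α (ket1 η) (ContinuousLinearMap.id ℂ H) =
        rtpMap α β (rtri ε β α) β (ket1 η) (ContinuousLinearMap.id ℂ H) ∘L V :=
      ContinuousLinearMap.ext fun v => leg23_rtpMap_ket1 V η v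
    have n1 := assoc_naturality (β := δ) (γ := α) (ε := βh) (φ := α) (β' := δ) (γ' := rtri ε β α)
      (ε' := rtri ε β βh) (φ' := α) (ContinuousLinearMap.id ℂ K) (ket1 η)
      (ContinuousLinearMap.id ℂ H) u
    have n2 := leg13_naturality (α := α) (β := β) (γ := γ) (δ := δ) (ε := α) (γ' := γ) (δ' := δ)
      (ε' := rtri ε β α) X X (ContinuousLinearMap.id ℂ K) (ket1 η)
      (fun v => by rw [rtpMap_id_apply, rtpMap_id_apply])
      (rtpMap δ (ltri βh α α) δ (rtri α β α) (ContinuousLinearMap.id ℂ K) V (assoc δ α βh α u))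
    rw [rtpMap_rtpMap] at n2
    calc leg23 βh α β V (ltri δ ε γ)
          (rtpMap (rtri δ (rtri ε β α) (rtri ε β βh)) α (rtri (ltri δ ε γ) β βh) α
          (leg13 α β γ δ ε X) (ContinuousLinearMap.id ℂ H)
          (rtpMap (rtri δ α βh) α (rtri δ (rtri ε β α) (rtri ε β βh)) α
            (rtpMap δ α δ (rtri ε β α) (ContinuousLinearMap.id ℂ K) (ket1 η))
            (ContinuousLinearMap.id ℂ H) u))
        = leg23 βh α β V (ltri δ ε γ)
          (rtpMap (rtri γ β βh) α (rtri (ltri δ ε γ) β βh) α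
            (rtpMap γ β (ltri δ ε γ) β (ket2 η) (ContinuousLinearMap.id ℂ H))
            (ContinuousLinearMap.id ℂ H)
          (rtpMap (rtri δ α βh) α (rtri γ β βh) α X (ContinuousLinearMap.id ℂ H) u)) := by
          rw [rtpMap_rtpMap, rtpMap_rtpMap, e1]
      _ = rtpMap (ltri δ (rtri ε β α) γ) β (rtri (ltri δ ε γ) β α) β (leg13 α β γ δ ε X)
          (ContinuousLinearMap.id ℂ H) (leg13 α β γ δ (rtri ε β α) X
          (rtpMap δ (ltri (rtri ε β βh) α (rtri ε β α)) δ (rtri (rtri ε β α) β α)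
          (ContinuousLinearMap.id ℂ K) (leg23 βh α β V ε)
          (assoc δ (rtri ε β α) (rtri ε β βh) α
          (rtpMap (rtri δ α βh) α (rtri δ (rtri ε β α) (rtri ε β βh)) α
            (rtpMap δ α δ (rtri ε β α) (ContinuousLinearMap.id ℂ K) (ket1 η))
            (ContinuousLinearMap.id ℂ H) u)))) := by
          rw [leg23_naturality, h, n1, rtpMap_rtpMap, rtpMap_rtpMap, e2]
          refine Eq.trans ?_ (congrArg _ n2.symm)
          rw [rtpMap_rtpMap, e1]
  exact DFunLike.congr_fun this v

end Pentagon

end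

section

variable {b : CStarBase 𝔎}

section AssocPentagon

variable {δ : Leg 𝔎 K} {ε φ : Leg 𝔎 L} {μ ν : Leg 𝔎 M} {κ : Leg 𝔎 H}
  [hδ : Mod b.dag δ]
  [hε : Mod b ε] [hφ : Mod b.dag φ] [hεφ : Nm b ε φ] [hφε : Nm b.dag φ ε]
  [hμ : Mod b μ] [hν : Mod b.dag ν] [hμν : Nm b μ ν] [hνμ : Nm b.dag ν μ] [hκ : Mod b κ]

include hδ hε hφ hεφ hφε hμ hν hμν hνμ hκ

/-- The pentagon identity for the associativity isomorphisms. -/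
theorem assoc_pentagon (v : RTP (rtri (rtri δ ε φ) μ ν) κ) :
    rtpMap δ (ltri (rtri φ μ ν) κ (ltri φ μ ε)) δ (ltri φ (ltri ν κ μ) ε)
      (ContinuousLinearMap.id ℂ K) (assoc φ μ ν κ)
      (assoc δ (ltri φ μ ε) (rtri φ μ ν) κ
        (rtpMap (rtri (rtri δ ε φ) μ ν) κ (rtri δ (ltri φ μ ε) (rtri φ μ ν)) κ (assoc δ ε φ μ)
          (ContinuousLinearMap.id ℂ H) v)) =
    assoc δ ε φ (ltri ν κ μ) (assoc (rtri δ ε φ) μ ν κ v) := by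
  have : rtpMap δ (ltri (rtri φ μ ν) κ (ltri φ μ ε)) δ (ltri φ (ltri ν κ μ) ε)
      (ContinuousLinearMap.id ℂ K) (assoc φ μ ν κ) ∘L
      assoc δ (ltri φ μ ε) (rtri φ μ ν) κ ∘L
        rtpMap (rtri (rtri δ ε φ) μ ν) κ (rtri δ (ltri φ μ ε) (rtri φ μ ν)) κ (assoc δ ε φ μ)
          (ContinuousLinearMap.id ℂ H) =
    assoc δ ε φ (ltri ν κ μ) ∘L assoc (rtri δ ε φ) μ ν κ := by
    refine rtp_ext2 fun n w => ?_
    have : (rtpMap δ (ltri (rtri φ μ ν) κ (ltri φ μ ε)) δ (ltri φ (ltri ν κ μ) ε)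
      (ContinuousLinearMap.id ℂ K) (assoc φ μ ν κ) ∘L
      assoc δ (ltri φ μ ε) (rtri φ μ ν) κ ∘L
        rtpMap (rtri (rtri δ ε φ) μ ν) κ (rtri δ (ltri φ μ ε) (rtri φ μ ν)) κ (assoc δ ε φ μ)
          (ContinuousLinearMap.id ℂ H)) ∘L ket2 n =
      (assoc δ ε φ (ltri ν κ μ) ∘L assoc (rtri δ ε φ) μ ν κ) ∘L ket2 n :=
      -- Both sides send `|n⟩₂ |m⟩₂ |k⟩₁ l` to `|k⟩₁ |x⟩₂ l` with `x = |n⟩₂ m`.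
      rtp_ext21 fun m k l => by
        simp only [coe_comp, Function.comp_apply, rtpMap_ket2, mapLeg_id, assoc_ket2_ket1,
          assoc_ket2_ket2, rtpMap_ket1]
    exact DFunLike.congr_fun this w
  exact DFunLike.congr_fun this v

end AssocPentagon

section TensorPentagon

variable {βh α β : Leg 𝔎 H} {γ δ : Leg 𝔎 K} {ε φ : Leg 𝔎 L} {μ ν : Leg 𝔎 M}
  [hα : Mod b α] [hβ : Mod b.dag β] [hαβ : Nm b α β] [hβα : Nm b.dag β α]
  [hγ : Mod b γ] [hδ : Mod b.dag δ] [hγδ : Nm b γ δ] [hδγ : Nm b.dag δ γ]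
  [hε : Mod b ε] [hφ : Mod b.dag φ] [hεφ : Nm b ε φ] [hφε : Nm b.dag φ ε]
  [hμ : Mod b μ] [hν : Mod b.dag ν] [hμν : Nm b μ ν] [hνμ : Nm b.dag ν μ]
  (X : RTP δ α →L[ℂ] RTP γ β) [hX : LegU X (ltri δ α γ) (rtri γ β α)]
  [hX' : LegU X (rtri δ α β) (ltri γ β δ)]
  (Y : RTP φ α →L[ℂ] RTP ε β) [hY : LegU Y (ltri φ α ε) (rtri ε β α)]
  [hY' : LegU Y (rtri φ α β) (ltri ε β φ)]

include hα hβ hαβ hβα hγ hδ hγδ hδγ hε hφ hεφ hφε hX hX' hY hY'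

/-- `X ⊠ Y` satisfies the pentagon equation. -/
theorem pentagon_tensorX [hβh : Mod b.dag βh] [hβhα : Nm b.dag βh α] [hαβh : Nm b α βh]
    [hββh : Nm b.dag β βh] [hβhβ : Nm b.dag βh β]
    (V : RTP βh α →L[ℂ] RTP α β) [hV : LegU V (ltri βh α β) (ltri α β β)]
    [hV' : LegU V (ltri βh α α) (rtri α β α)]
    [hX'' : LegU X (rtri δ α βh) (rtri γ β βh)] [hY'' : LegU Y (rtri φ α βh) (rtri ε β βh)]
    (hPX : Pentagon βh α β V γ δ X) (hPY : Pentagon βh α β V ε φ Y) :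
    Pentagon βh α β V (ltri δ ε γ) (rtri δ ε φ) (tensorX α β γ δ ε φ X Y) := by
  have l1 := legU_leg13_left (ε := ε) X
  have l2 := legU_leg13_right (ε := ε) X βh
  have l3 := legU_leg23 (βh := βh) (ε := ε) V
  have l4 := legU_leg13_left (ε := α) Y
  have l5 := legU_tensorX_mid (α := α) (β := β) X Y
  have l6 := legU_tensorX_left (α := α) (β := β) X Y
  have l7 := legU_tensorX_right (α := α) (β := β) X Y βh
  rw [pentagon_iff] at hPY ⊢
  intro v
  have idid : rtpMap δ ε δ ε (ContinuousLinearMap.id ℂ K) (ContinuousLinearMap.id ℂ L) =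
      ContinuousLinearMap.id ℂ _ := rtpMap_id LC.out
  -- Below, `w₁` is `v` rebracketed, `w₂` is the result of applying `Y` to `L` and the first `H`,
  -- and `u` is the result of applying `V` to the last two factors of `v`. The target is reached by
  -- rewriting both sides in terms of them.
  obtain ⟨w₁, hw₁⟩ : ∃ w, w = rtpMap (rtri (rtri δ ε φ) α βh) α
    (rtri δ (ltri φ α ε) (rtri φ α βh)) α (assoc δ ε φ α) (ContinuousLinearMap.id ℂ H) v := ⟨_, rfl⟩
  obtain ⟨w₂, hw₂⟩ : ∃ w, w = rtpMap (rtri δ (ltri φ α ε) (rtri φ α βh)) α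
    (rtri δ (rtri ε β α) (rtri ε β βh)) α
    (rtpMap δ (ltri φ α ε) δ (rtri ε β α) (ContinuousLinearMap.id ℂ K) Y)
    (ContinuousLinearMap.id ℂ H) w₁ := ⟨_, rfl⟩
  have s1 : rtpMap (rtri (rtri δ ε φ) α βh) α (rtri (ltri δ ε γ) β βh) α
      (tensorX α β γ δ ε φ X Y) (ContinuousLinearMap.id ℂ H) v =
      rtpMap (rtri δ (rtri ε β α) (rtri ε β βh)) α (rtri (ltri δ ε γ) β βh) α
        (leg13 α β γ δ ε X) (ContinuousLinearMap.id ℂ H) w₂ := by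
    have m := l2.maps.comp (inferInstance : Maps (rtpMap δ (ltri φ α ε) δ (rtri ε β α)
      (ContinuousLinearMap.id ℂ K) Y) (rtri δ (ltri φ α ε) (rtri φ α βh))
      (rtri δ (rtri ε β α) (rtri ε β βh)))
    rw [hw₂, hw₁, rtpMap_rtpMap, rtpMap_rtpMap]
    rfl
  have hY₀ : leg23 βh α β V ε ∘L
      rtpMap (rtri φ α βh) α (rtri ε β βh) α Y (ContinuousLinearMap.id ℂ H) =
      rtpMap (ltri φ α ε) β (rtri ε β α) β Y (ContinuousLinearMap.id ℂ H) ∘L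
        leg13 α β ε φ α Y ∘L rtpMap φ (ltri βh α α) φ (rtri α β α) (ContinuousLinearMap.id ℂ L) V ∘L
        assoc φ α βh α := ContinuousLinearMap.ext hPY
  obtain ⟨u, hu⟩ : ∃ u, u = rtpMap (rtri δ ε φ) (ltri βh α α) (rtri δ ε φ) (rtri α β α)
    (ContinuousLinearMap.id ℂ _) V (assoc (rtri δ ε φ) α βh α v) := ⟨_, rfl⟩
  have s2 : assoc δ (rtri ε β α) (rtri ε β βh) α w₂ =
      rtpMap δ (ltri (rtri φ α βh) α (ltri φ α ε)) δ (ltri (rtri ε β βh) α (rtri ε β α))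
        (ContinuousLinearMap.id ℂ K)
        (rtpMap (rtri φ α βh) α (rtri ε β βh) α Y (ContinuousLinearMap.id ℂ H))
        (assoc δ (ltri φ α ε) (rtri φ α βh) α w₁) := by
    rw [hw₂, assoc_naturality]
  have s3 : assoc δ ε φ (rtri α β α) u =
      rtpMap δ (ltri φ (ltri βh α α) ε) δ (ltri φ (rtri α β α) ε) (ContinuousLinearMap.id ℂ K)
        (rtpMap φ (ltri βh α α) φ (rtri α β α) (ContinuousLinearMap.id ℂ L) V)
        (rtpMap δ (ltri (rtri φ α βh) α (ltri φ α ε)) δ (ltri φ (ltri βh α α) ε)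
          (ContinuousLinearMap.id ℂ K) (assoc φ α βh α)
          (assoc δ (ltri φ α ε) (rtri φ α βh) α w₁)) := by
    have := assoc_naturality (β := δ) (γ := ε) (ε := φ) (φ := ltri βh α α) (β' := δ) (γ' := ε)
      (ε' := φ) (φ' := rtri α β α) (ContinuousLinearMap.id ℂ K) (ContinuousLinearMap.id ℂ L) V
      (assoc (rtri δ ε φ) α βh α v)
    rw [idid, ← hu] at this
    rw [this, hw₁, assoc_pentagon]
  -- The pentagon equation for `Y` inside the last three factors: `V₃₄ Y₂₃ = Y₂₃ Y₂₄ V₃₄`. The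
  -- auxiliary facts move `Y` and `V` through the rebracketings by naturality and the pentagon
  -- identity.
  have s4 : rtpMap δ (ltri (rtri ε β βh) α (rtri ε β α)) δ (rtri (rtri ε β α) β α)
      (ContinuousLinearMap.id ℂ K) (leg23 βh α β V ε)
      (assoc δ (rtri ε β α) (rtri ε β βh) α w₂) =
      rtpMap δ (rtri (ltri φ α ε) β α) δ (rtri (rtri ε β α) β α) (ContinuousLinearMap.id ℂ K)
        (rtpMap (ltri φ α ε) β (rtri ε β α) β Y (ContinuousLinearMap.id ℂ H))
        (rtpMap δ (ltri φ (rtri α β α) ε) δ (rtri (ltri φ α ε) β α) (ContinuousLinearMap.id ℂ K)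
          (leg13 α β ε φ α Y) (assoc δ ε φ (rtri α β α) u)) := by
    have m1 : Maps (rtpMap (ltri φ α ε) β (rtri ε β α) β Y (ContinuousLinearMap.id ℂ H) ∘L
        leg13 α β ε φ α Y) (ltri φ (rtri α β α) ε) (rtri (rtri ε β α) β α) :=
      Maps.comp inferInstance l4.maps
    have m2 := m1.comp (inferInstance : Maps (rtpMap φ (ltri βh α α) φ (rtri α β α)
      (ContinuousLinearMap.id ℂ L) V) (ltri φ (ltri βh α α) ε) (ltri φ (rtri α β α) ε))
    rw [s3, s2, rtpMap_rtpMap, hY₀, rtpMap_rtpMap, rtpMap_rtpMap, rtpMap_rtpMap]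
    rfl
  -- This is the exchange `X₁₄ Y₂₃ = Y₂₃ X₁₄`: for `X₁₄` the space on which `Y₂₃` acts is an idle
  -- middle factor.
  have n := leg13_naturality (α := α) (β := β) (γ := γ) (δ := δ) (ε := ltri φ α ε) (γ' := γ)
    (δ' := δ) (ε' := rtri ε β α) X X (ContinuousLinearMap.id ℂ K) Y
    (fun v => by rw [rtpMap_id_apply, rtpMap_id_apply])
    (rtpMap δ (ltri φ (rtri α β α) ε) δ (rtri (ltri φ α ε) β α) (ContinuousLinearMap.id ℂ K)
          (leg13 α β ε φ α Y) (assoc δ ε φ (rtri α β α) u))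
  rw [s1, pentagon_leg V X hPX, s4]
  refine (congrArg _ n).trans ?_
  have m := l1.maps.comp (inferInstance : Maps (rtpMap δ (ltri φ α ε) δ (rtri ε β α)
      (ContinuousLinearMap.id ℂ K) Y) (ltri δ (ltri φ α ε) γ) (ltri δ (rtri ε β α) γ))
  -- Now `X₁₄ Y₂₄` is reassembled into the tensor product acting on the first and last factor, and
  -- `X₁₃ Y₂₃` into the one acting on the first two.
  rw [← leg13_tensorX, rtpMap_rtpMap, rtpMap_rtpMap, ← hu]
  rfl

include hμ hν hμν hνμ

/-- The associativity isomorphisms intertwine the tensor products of representations. -/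
theorem tensorX_assoc (Z : RTP ν α →L[ℂ] RTP μ β) [hZ : LegU Z (ltri ν α μ) (rtri μ β α)]
    [hZ' : LegU Z (rtri ν α β) (ltri μ β ν)] (v : RTP (rtri (rtri δ ε φ) μ ν) α) :
    tensorX α β γ δ (ltri φ μ ε) (rtri φ μ ν) X (tensorX α β ε φ μ ν Y Z)
      (rtpMap (rtri (rtri δ ε φ) μ ν) α (rtri δ (ltri φ μ ε) (rtri φ μ ν)) α (assoc δ ε φ μ)
        (ContinuousLinearMap.id ℂ H) v) =
    rtpMap (ltri (rtri δ ε φ) μ (ltri δ ε γ)) β (ltri δ (ltri φ μ ε) γ) β (assoc δ ε φ μ)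
      (ContinuousLinearMap.id ℂ H)
      (tensorX α β (ltri δ ε γ) (rtri δ ε φ) μ ν (tensorX α β γ δ ε φ X Y) Z v) := by
  have l1 := legU_leg13_left (ε := μ) Y
  have l5 := legU_tensorX_mid (α := α) (β := β) X Y
  have l6 := legU_tensorX_left (α := α) (β := β) X Y
  have l7 := legU_tensorX_left (α := α) (β := β) Y Z
  have idid : rtpMap δ ε δ ε (ContinuousLinearMap.id ℂ K) (ContinuousLinearMap.id ℂ L) =
      ContinuousLinearMap.id ℂ _ := rtpMap_id LC.out
  have n := assoc_naturality (β := δ) (γ := ε) (ε := φ) (φ := ltri ν α μ) (β' := δ) (γ' := ε)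
      (ε' := φ) (φ' := rtri μ β α) (ContinuousLinearMap.id ℂ K) (ContinuousLinearMap.id ℂ L) Z
      (assoc (rtri δ ε φ) μ ν α v)
  rw [idid] at n
  have m := l1.maps.comp (inferInstance : Maps (rtpMap φ (ltri ν α μ) φ (rtri μ β α)
      (ContinuousLinearMap.id ℂ L) Z) (ltri φ (ltri ν α μ) ε) (ltri φ (rtri μ β α) ε))
  -- On the right, the leg of `X ⊠ Y` splits into those of `X` and `Y`. On the left, the pentagon
  -- identity and naturality move the rebracketing past `Z`; then both sides apply `Z`, `Y` and `X`
  -- in this order.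
  rw [tensorX_apply X, tensorX_apply (tensorX α β γ δ ε φ X Y), leg13_tensorX, n, ← assoc_pentagon,
    rtpMap_rtpMap, rtpMap_rtpMap]
  rfl

end TensorPentagon

section TensorHom

variable {α β : Leg 𝔎 H} {γ δ : Leg 𝔎 K} {ε φ : Leg 𝔎 L} {γ' δ' : Leg 𝔎 K'} {ε' φ' : Leg 𝔎 L'}
  [hα : Mod b α] [hβ : Mod b.dag β] [hαβ : Nm b α β] [hβα : Nm b.dag β α]
  [hγ : Mod b γ] [hδ : Mod b.dag δ] [hγδ : Nm b γ δ] [hδγ : Nm b.dag δ γ]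
  [hε : Mod b ε] [hφ : Mod b.dag φ] [hεφ : Nm b ε φ] [hφε : Nm b.dag φ ε]
  [hγ' : Mod b γ'] [hδ' : Mod b.dag δ'] [hγδ' : Nm b γ' δ'] [hδγ' : Nm b.dag δ' γ']
  [hε' : Mod b ε'] [hφ' : Mod b.dag φ'] [hεφ' : Nm b ε' φ'] [hφε' : Nm b.dag φ' ε']
  (X : RTP δ α →L[ℂ] RTP γ β) [hX : LegU X (ltri δ α γ) (rtri γ β α)]
  [hX' : LegU X (rtri δ α β) (ltri γ β δ)]
  (Y : RTP φ α →L[ℂ] RTP ε β) [hY : LegU Y (ltri φ α ε) (rtri ε β α)]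
  (X' : RTP δ' α →L[ℂ] RTP γ' β) [hX₁ : LegU X' (ltri δ' α γ') (rtri γ' β α)]
  [hX₁' : LegU X' (rtri δ' α β) (ltri γ' β δ')]
  (Y' : RTP φ' α →L[ℂ] RTP ε' β) [hY₁ : LegU Y' (ltri φ' α ε') (rtri ε' β α)]

include hα hβ hαβ hβα hγ hδ hγδ hδγ hε hφ hεφ hφε hγ' hδ' hγδ' hδγ' hε' hφ' hεφ' hφε' hX hX' hY
  hX₁ hX₁' hY₁

/-- The tensor product of intertwiners is an intertwiner. -/
theorem tensorX_naturality (S : K →L[ℂ] K') (T : L →L[ℂ] L') [Maps S γ γ'] [Maps S δ δ']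
    [Maps T ε ε'] [Maps T φ φ']
    (hS : ∀ v, X' (rtpMap δ α δ' α S (ContinuousLinearMap.id ℂ H) v) =
      rtpMap γ β γ' β S (ContinuousLinearMap.id ℂ H) (X v))
    (hT : Y' ∘L rtpMap φ α φ' α T (ContinuousLinearMap.id ℂ H) =
      rtpMap ε β ε' β T (ContinuousLinearMap.id ℂ H) ∘L Y) (v : RTP (rtri δ ε φ) α) :
    tensorX α β γ' δ' ε' φ' X' Y' (rtpMap (rtri δ ε φ) α (rtri δ' ε' φ') α
      (rtpMap δ ε δ' ε' S T) (ContinuousLinearMap.id ℂ H) v) =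
    rtpMap (ltri δ ε γ) β (ltri δ' ε' γ') β (rtpMap δ ε δ' ε' S T) (ContinuousLinearMap.id ℂ H)
      (tensorX α β γ δ ε φ X Y v) := by
  rw [tensorX_apply, tensorX_apply, assoc_naturality, ← leg13_naturality X X' S T hS,
    rtpMap_rtpMap, rtpMap_rtpMap, hT]
  rfl

end TensorHom

end

section

variable {b c d e : CStarBase 𝔎}

/-! ### The algebras of the base as legs -/

/-- `A` is the first algebra of the base `b`. -/
class IsAlg (b : outParam (CStarBase 𝔎)) (A : Leg 𝔎 𝔎) : Prop where
  out : A = b.B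

instance (b : CStarBase 𝔎) : IsAlg b b.B := ⟨rfl⟩
instance (b : CStarBase 𝔎) : IsAlg b.dag b.Bd := ⟨rfl⟩

/-- If there is a module over `b`, then the algebra `𝔅` is a module over `b`. -/
theorem IsAlg.mod {A : Leg 𝔎 𝔎} [hA : IsAlg b A] (α : Leg 𝔎 H) [hα : Mod b α] : Mod b A := by
  obtain rfl := hA.out
  have hcl : IsClosed (b.B : Set (𝔎 →L[ℂ] 𝔎)) := b.isClosed_alg
  have hright : clSpan {T : 𝔎 →L[ℂ] 𝔎 | ∃ ξ ∈ b.B, ∃ a ∈ b.alg, T = ξ ∘L a} = b.B := by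
    refine le_antisymm (clSpan_le hcl ?_) ?_
    · rintro _ ⟨x, hx, a, ha, rfl⟩
      exact mul_mem (S := NonUnitalStarSubalgebra ℂ (𝔎 →L[ℂ] 𝔎)) (s := b.alg) hx ha
    -- An approximate unit is not needed: `𝔅 = [α*α] = [α*α𝔅]` is contained in `[𝔅𝔅]`.
    · refine hα.out.full.symm.le.trans (clSpan_le (isClosed_clSpan _) ?_)
      rintro _ ⟨ξ, hξ, ξ', hξ', rfl⟩
      rw [← hα.out.right] at hξ'
      refine map_mem_of_mem_clSpan (isClosed_clSpan _) (compL ℂ 𝔎 H 𝔎 (adjoint ξ)) ?_ hξ'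
      rintro _ ⟨ξ'', hξ'', a, ha, rfl⟩
      exact subset_clSpan ⟨_, adjoint_comp_mem_alg (b := b) hξ hξ'', a, ha, rfl⟩
  have hstar : ∀ x ∈ b.B, adjoint x ∈ b.B := fun x hx => by
    have : star x ∈ b.alg := star_mem (show x ∈ b.alg from hx)
    rwa [star_eq_adjoint] at this
  refine ⟨hcl, b.nondeg_alg, hright, ?_⟩
  conv_rhs => rw [← hright]
  congr 1
  ext x
  constructor
  · rintro ⟨ξ, hξ, ξ', hξ', rfl⟩
    exact ⟨adjoint ξ, hstar ξ hξ, ξ', hξ', rfl⟩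
  · rintro ⟨ξ, hξ, ξ', hξ', rfl⟩
    exact ⟨adjoint ξ, hstar ξ hξ, ξ', hξ', by rw [adjoint_adjoint]⟩

/-- As the two algebras commute, `ρ_𝔅(x) = x` for `x ∈ 𝔅†`; the condition then reads `[𝔅†𝔅†] = 𝔅†`,
which is a module axiom. -/
theorem IsAlg.nm {A A' : Leg 𝔎 𝔎} [hA : IsAlg b A] [hA' : IsAlg c A'] [hd : Dual b c] [Mod b A]
    [h : Mod c A'] : Nm b A A' := by
  obtain rfl := hA.out
  obtain rfl := hA'.out
  obtain rfl := hd.out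
  have hrho : ∀ x ∈ b.algd, rho b.B x = x := fun x hx =>
    ext_of_tot b.B fun ξ ζ => by
      rw [rho_apply (mem_legComm hx)]
      exact DFunLike.congr_fun (b.comm _ ξ.2 x hx) ζ
  constructor
  unfold Normalizes
  refine Eq.trans ?_ h.out.right
  congr 1
  ext x
  constructor
  · rintro ⟨c, hc, ξ, hξ, rfl⟩
    exact ⟨c, hc, ξ, hξ, by rw [hrho c hc]⟩
  · rintro ⟨c, hc, ξ, hξ, rfl⟩
    exact ⟨c, hc, ξ, hξ, by rw [hrho c hc]⟩

section Unit

variable {A : Leg 𝔎 𝔎} {γ : Leg 𝔎 K}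
  [hA : IsAlg c A] [hA' : Mod c A] [hγ : Mod b γ] [hd : Dual c b] [hd' : Dual b c]

include hA hd in
theorem IsAlg.mem_algd (a : A) : a.1 ∈ b.algd := by
  obtain rfl := hA.out
  obtain rfl := hd.out
  exact a.2

include hA hA' hγ hd hd'

theorem unitL_spec_of_isAlg :
    (∀ (a : A) (ζ : 𝔎) (η : γ), unitL A γ (tmul a ζ η) = η.1 (a.1 ζ)) ∧
      IsUnitaryOp (unitL A γ) := by
  refine unitL_spec (fun a η η' => mem_legComm (IsAlg.mem_algd a) _ η.2 _ η'.2) ?_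
  rw [← top_le_iff, ← tot_range γ]
  refine clSpan_le (isClosed_clSpan _) ?_
  rintro _ ⟨⟨η, ζ⟩, rfl⟩
  refine map_mem_of_mem_clSpan (S := Set.range fun p : A × 𝔎 => p.1.1 p.2) (isClosed_clSpan _)
    η.1 ?_ (by rw [tot_range A]; trivial)
  rintro _ ⟨⟨a, ζ⟩, rfl⟩
  exact subset_clSpan ⟨(a, ζ, η), rfl⟩

theorem isUnitaryOp_unitL : IsUnitaryOp (unitL A γ) := unitL_spec_of_isAlg.2

theorem unitL_tmul (a : A) (ζ : 𝔎) (η : γ) : unitL A γ (tmul a ζ η) = η.1 (a.1 ζ) :=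
  unitL_spec_of_isAlg.1 a ζ η

@[simp] theorem unitL_ket1 (a : A) (v : K) : unitL A γ (ket1 a v) = rho γ a.1 v := by
  have : unitL A γ ∘L ket1 a = rho γ a.1 := ext_of_tot γ fun η ζ => by
    rw [coe_comp, Function.comp_apply, ket1_apply, unitL_tmul,
      rho_apply (mem_legComm (IsAlg.mem_algd a))]
  exact DFunLike.congr_fun this v

@[simp] theorem unitL_ket2 (η : γ) (ζ : 𝔎) : unitL A γ (ket2 η ζ) = η.1 ζ := by
  have : unitL A γ ∘L ket2 η = η.1 := ext_of_tot A fun a ζ => by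
    rw [coe_comp, Function.comp_apply, ket2_apply, unitL_tmul]
  exact DFunLike.congr_fun this ζ

theorem unitL_naturality {γ' : Leg 𝔎 K'} [hγ' : Mod b γ'] (T : K →L[ℂ] K') [Maps T γ γ'] (v : RTP A γ) :
    unitL A γ' (rtpMap A γ A γ' (ContinuousLinearMap.id ℂ 𝔎) T v) = T (unitL A γ v) := by
  have : unitL A γ' ∘L rtpMap A γ A γ' (ContinuousLinearMap.id ℂ 𝔎) T = T ∘L unitL A γ :=
    rtp_ext2 fun η ζ => by simp
  exact DFunLike.congr_fun this v

/-- Multiplication takes `|a⟩₁ ξ` to `ρ_γ(a) ξ`, so the claim is precisely that `γ` normalizes `x`.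
-/
instance legU_unitL_rtri {x : Leg 𝔎 K} [hx : Mod e x] [hn : Nm b γ x] :
    LegU (unitL A γ) (rtri A γ x) x := by
  refine ⟨isUnitaryOp_unitL, maps_rtri hx.out.isClosed fun a => ?_, ⟨fun ξ hξ => ?_⟩⟩
  · rw [show unitL A γ ∘L ket1 a = rho γ a.1 from ContinuousLinearMap.ext fun v => unitL_ket1 a v]
    exact maps_rho (IsAlg.mem_algd a)
  · have hn' := hn.out
    unfold Normalizes at hn'
    rw [← hn'] at hξ
    refine map_mem_of_mem_clSpan (isClosed_rtri _ _ _) (compL ℂ 𝔎 _ _ (adjoint (unitL A γ))) ?_ hξ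
    rintro _ ⟨a, ha, ξ, hξ, rfl⟩
    have ha' : a ∈ A := by
      obtain rfl := hA.out
      obtain rfl := hd.out
      exact ha
    have : adjoint (unitL A γ) ∘L rho γ a = ket1 (⟨a, ha'⟩ : A) :=
      ContinuousLinearMap.ext fun v => by
        rw [coe_comp, Function.comp_apply, isUnitaryOp_unitL.adjoint_eq_iff, unitL_ket1]
    rw [compL_apply, ← comp_assoc, this]
    exact (maps_ket1 _).out ξ hξ

/-- Multiplication takes `|η⟩₂ a` to `η a`, so the claim is the module axiom on right multiplication
for `γ`. -/
instance legU_unitL_ltri {A' : Leg 𝔎 𝔎} [hA'' : IsAlg b A'] : LegU (unitL A γ) (ltri A γ A') γ := by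
  obtain rfl := hA''.out
  have h : ∀ η : γ, unitL A γ ∘L ket2 η = η.1 := fun η =>
    ContinuousLinearMap.ext fun v => unitL_ket2 η v
  refine ⟨isUnitaryOp_unitL, maps_ltri hγ.out.isClosed fun η => ⟨fun a ha => ?_⟩, ⟨fun ξ hξ => ?_⟩⟩
  · rw [h]
    exact comp_mem_of_mod η.2 ha
  · rw [← hγ.out.right] at hξ
    refine map_mem_of_mem_clSpan (isClosed_ltri _ _ _) (compL ℂ 𝔎 _ _ (adjoint (unitL A γ))) ?_ hξ
    rintro _ ⟨η, hη, a, ha, rfl⟩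
    have : adjoint (unitL A γ) ∘L η = ket2 (⟨η, hη⟩ : γ) :=
      ContinuousLinearMap.ext fun v => by
        rw [coe_comp, Function.comp_apply, isUnitaryOp_unitL.adjoint_eq_iff, unitL_ket2]
    rw [compL_apply, ← comp_assoc, this]
    exact (maps_ket2 _).out a ha

theorem unitR_tmul (η : γ) (ζ : 𝔎) (a : A) : unitR γ A (tmul η ζ a) = η.1 (a.1 ζ) := by
  refine opOfGraph_spec ⟨unitL A γ ∘L flip γ A, ?_⟩ (tmul η ζ a, η.1 (a.1 ζ)) ⟨η, ζ, a, rfl⟩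
  rintro _ ⟨η, ζ, a, rfl⟩
  rw [coe_comp, Function.comp_apply, flip_tmul, unitL_tmul]

theorem unitR_eq : unitR γ A = unitL A γ ∘L flip γ A := rtp_ext fun η ζ a => by
  rw [coe_comp, Function.comp_apply, flip_tmul, unitL_tmul, unitR_tmul]

theorem isUnitaryOp_unitR : IsUnitaryOp (unitR γ A) := by
  rw [unitR_eq]
  exact isUnitaryOp_unitL.comp isUnitaryOp_flip

@[simp] theorem unitR_ket1 (η : γ) (ζ : 𝔎) : unitR γ A (ket1 η ζ) = η.1 ζ := by
  rw [unitR_eq, coe_comp, Function.comp_apply, flip_ket1, unitL_ket2]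

@[simp] theorem unitR_ket2 (a : A) (v : K) : unitR γ A (ket2 a v) = rho γ a.1 v := by
  rw [unitR_eq, coe_comp, Function.comp_apply, flip_ket2, unitL_ket1]

theorem unitR_naturality {γ' : Leg 𝔎 K'} [hγ' : Mod b γ'] (T : K →L[ℂ] K') [Maps T γ γ'] (v : RTP γ A) :
    unitR γ' A (rtpMap γ A γ' A T (ContinuousLinearMap.id ℂ 𝔎) v) = T (unitR γ A v) := by
  have : unitR γ' A ∘L rtpMap γ A γ' A T (ContinuousLinearMap.id ℂ 𝔎) = T ∘L unitR γ A :=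
    rtp_ext1 fun η ζ => by simp
  exact DFunLike.congr_fun this v

instance legU_unitR_ltri {x : Leg 𝔎 K} [hx : Mod e x] [hn : Nm b γ x] :
    LegU (unitR γ A) (ltri γ A x) x := by
  rw [unitR_eq]
  exact (legU_unitL_rtri (x := x)).comp legU_flip_ltri

instance legU_unitR_rtri {A' : Leg 𝔎 𝔎} [hA'' : IsAlg b A'] : LegU (unitR γ A) (rtri γ A A') γ := by
  rw [unitR_eq]
  exact (legU_unitL_ltri (A' := A')).comp legU_flip_rtri

/-- On kets both sides apply `ρ` of the element `a`: after rebracketing it acts on the whole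
product, before on its first factor, and these agree because `ρ` slides through `|η⟩₂`. -/
theorem unitL_assoc {x : Leg 𝔎 K} {φ : Leg 𝔎 L} [hx : Mod d x] [Mod e φ] [Dual d e] [Nm b γ x]
    [Nm d x γ] (v : RTP (rtri A γ x) φ) :
    unitL A (ltri x φ γ) (assoc A γ x φ v) =
      rtpMap (rtri A γ x) φ x φ (unitL A γ) (ContinuousLinearMap.id ℂ L) v := by
  have : unitL A (ltri x φ γ) ∘L assoc A γ x φ =
      rtpMap (rtri A γ x) φ x φ (unitL A γ) (ContinuousLinearMap.id ℂ L) :=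
    rtp_ext21 fun η a ω => by
      have ha := IsAlg.mem_algd (b := b) a
      simp only [coe_comp, Function.comp_apply, assoc_ket2_ket1, unitL_ket1, rtpMap_ket2,
        mapLeg_id]
      exact DFunLike.congr_fun (rho_ltri_ket2 (β := x) (γ := φ) (α := γ) (mem_legComm ha)
        (mem_legComm ha) η) ω
  exact DFunLike.congr_fun this v

/-- The triangle identity. -/
theorem assoc_triangle {A' : Leg 𝔎 𝔎} [IsAlg b A'] [Mod b A'] [Nm b A' A] [Nm c A A']
    {δ : Leg 𝔎 L} [Mod c δ] (v : RTP (rtri δ A' A) γ) :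
    rtpMap δ (ltri A γ A') δ γ (ContinuousLinearMap.id ℂ L) (unitL A γ) (assoc δ A' A γ v) =
      rtpMap (rtri δ A' A) γ δ γ (unitR δ A') (ContinuousLinearMap.id ℂ K) v := by
  have : rtpMap δ (ltri A γ A') δ γ (ContinuousLinearMap.id ℂ L) (unitL A γ) ∘L assoc δ A' A γ =
      rtpMap (rtri δ A' A) γ δ γ (unitR δ A') (ContinuousLinearMap.id ℂ K) :=
    rtp_ext21 fun η ξ ζ => by simp [ket1_leg_apply]
  exact DFunLike.congr_fun this v

end Unit

end

section

variable {b : CStarBase 𝔎}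

/-! ### The trivial representation -/

/-- The operator `Ψ*Φ`. -/
def trivX (B D : Leg 𝔎 𝔎) (α β : Leg 𝔎 H) : RTP D α →L[ℂ] RTP B β :=
  adjoint (unitL B β) ∘L unitL D α

section Triv

variable {B D : Leg 𝔎 𝔎} {βh α β : Leg 𝔎 H} {γ δ : Leg 𝔎 K} {ε φ : Leg 𝔎 L}
  [hB : IsAlg b B] [hD : IsAlg b.dag D] [hB' : Mod b B] [hD' : Mod b.dag D] [hBD : Nm b B D]
  [hDB : Nm b.dag D B]
  [hα : Mod b α] [hβ : Mod b.dag β] [hαβ : Nm b α β] [hβα : Nm b.dag β α]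

include hB hD hB' hD' hBD hDB hα hβ hαβ hβα

instance legU_trivX_left : LegU (trivX B D α β) (ltri D α B) (rtri B β α) :=
  (legU_unitL_rtri (A := B) (γ := β) (x := α)).adjoint.comp
    (legU_unitL_ltri (A := D) (γ := α) (A' := B))

instance legU_trivX_mid : LegU (trivX B D α β) (rtri D α β) (ltri B β D) :=
  (legU_unitL_ltri (A := B) (γ := β) (A' := D)).adjoint.comp
    (legU_unitL_rtri (A := D) (γ := α) (x := β))

instance legU_trivX_right [Mod b.dag βh] [Nm b α βh] [Nm b.dag β βh] :
    LegU (trivX B D α β) (rtri D α βh) (rtri B β βh) :=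
  (legU_unitL_rtri (A := B) (γ := β) (x := βh)).adjoint.comp
    (legU_unitL_rtri (A := D) (γ := α) (x := βh))

theorem unitL_trivX (v : RTP D α) : unitL B β (trivX B D α β v) = unitL D α v :=
  (isUnitaryOp_unitL (A := B) (γ := β)).apply_adjoint_apply _

omit hD hD' hBD hDB hα hαβ hβα in
theorem rtpMap_leg_unitL [hε : Mod b ε] (η : ε) (w : RTP B β) [Maps η.1 B ε] :
    rtpMap B β ε β η.1 (ContinuousLinearMap.id ℂ H) w = ket1 η (unitL B β w) := by
  have : rtpMap B β ε β η.1 (ContinuousLinearMap.id ℂ H) = ket1 η ∘L unitL B β :=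
    rtp_ext2 fun x ζ => by
      rw [rtpMap_ket2, coe_comp, Function.comp_apply, unitL_ket2, ket1_leg_apply, mapLeg_id]
  exact DFunLike.congr_fun this w

/-- Once both ends are identified with `L ⊗ H`, the operator `(1_V)₁₃` is the identity. It suffices
to insert `η`, where the assertion is naturality of multiplication along `|η⟩₁`. -/
theorem leg13_trivX [hε : Mod b ε] (v : RTP D (rtri ε β α)) :
    rtpMap (ltri D ε B) β ε β (unitL D ε) (ContinuousLinearMap.id ℂ H)
      (leg13 α β B D ε (trivX B D α β) v) = unitL D (rtri ε β α) v := by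
  have : rtpMap (ltri D ε B) β ε β (unitL D ε) (ContinuousLinearMap.id ℂ H) ∘L
      leg13 α β B D ε (trivX B D α β) = unitL D (rtri ε β α) := by
    refine leg13_ext fun η v => ?_
    have hη : Maps η.1 B ε := ⟨fun x hx => comp_mem_of_mod η.2 (by
      obtain rfl := hB.out; exact hx)⟩
    have e : unitL D ε ∘L ket2 η = η.1 := ContinuousLinearMap.ext fun v => unitL_ket2 η v
    rw [coe_comp, Function.comp_apply, leg13_rtpMap_ket1, rtpMap_rtpMap, e, comp_id,
      rtpMap_leg_unitL, unitL_trivX, unitL_naturality]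
  exact DFunLike.congr_fun this v

section Pentagon

variable [hβh : Mod b.dag βh] [hβhα : Nm b.dag βh α] [hαβh : Nm b α βh] [hββh : Nm b.dag β βh]
  [hβhβ : Nm b.dag βh β]
  (V : RTP βh α →L[ℂ] RTP α β) [hV : LegU V (ltri βh α β) (ltri α β β)]
  [hV' : LegU V (ltri βh α α) (rtri α β α)]

include hβh hβhα hαβh hββh hβhβ hV

omit hD hD' hBD hDB in
-- On `|a⟩₁ ⊗ Id` the multiplication is `ρ_β(a) ⊗ Id`, which is `ρ` of the leg `β ◁ α` before `V`
-- and of `β ◁ β` after it. Since `V` maps the first leg onto the second, it intertwines the two.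
theorem leg23_unitL (w : RTP (rtri B β βh) α) :
    rtpMap (rtri B β α) β α β (unitL B β) (ContinuousLinearMap.id ℂ H) (leg23 βh α β V B w) =
      V (rtpMap (rtri B β βh) α βh α (unitL B β) (ContinuousLinearMap.id ℂ H) w) := by
  have : rtpMap (rtri B β α) β α β (unitL B β) (ContinuousLinearMap.id ℂ H) ∘L
      leg23 βh α β V B =
      V ∘L rtpMap (rtri B β βh) α βh α (unitL B β) (ContinuousLinearMap.id ℂ H) := by
    refine leg23_ext fun a v => ?_
    have ha : a.1 ∈ b.dag.algd := IsAlg.mem_algd a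
    have e : unitL B β ∘L ket1 a = rho β a.1 := ContinuousLinearMap.ext fun v => unitL_ket1 a v
    have m1 : Maps (rho β a.1) α α := maps_rho ha
    have m2 : Maps (rho β a.1) βh βh := maps_rho ha
    rw [coe_comp, Function.comp_apply, coe_comp, Function.comp_apply, leg23_rtpMap_ket1,
      rtpMap_rtpMap, rtpMap_rtpMap, e, comp_id,
      ← rho_ltri_eq (mem_legComm ha) (mem_legComm ha),
      ← rho_ltri_eq (mem_legComm ha) (mem_legComm ha)]
    exact DFunLike.congr_fun (comp_rho (T := V) (mem_legComm ha) (mem_legComm ha)).symm v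
  exact DFunLike.congr_fun this w

include hV'

theorem pentagon_trivX : Pentagon βh α β V B D (trivX B D α β) := by
  rw [pentagon_iff]
  intro v
  have hu : IsUnitaryOp (rtpMap (rtri B β α) β α β (unitL B β) (ContinuousLinearMap.id ℂ H)) :=
    isUnitaryOp_rtpMap _ _
  have e : unitL B β ∘L trivX B D α β = unitL D α := ContinuousLinearMap.ext unitL_trivX
  -- After `Ψ ⊗ Id` is applied, both sides become `V (Φ ⊗ Id) v`.
  apply hu.injective
  rw [leg23_unitL, rtpMap_rtpMap, rtpMap_rtpMap, e, comp_id, leg13_trivX, unitL_naturality,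
    unitL_assoc]

end Pentagon

/-- The left unit isomorphisms intertwine. -/
theorem unitL_tensorX [hε : Mod b ε] [hφ : Mod b.dag φ] [hεφ : Nm b ε φ] [hφε : Nm b.dag φ ε]
    (Y : RTP φ α →L[ℂ] RTP ε β) [hY : LegU Y (ltri φ α ε) (rtri ε β α)]
    (v : RTP (rtri D ε φ) α) :
    rtpMap (ltri D ε B) β ε β (unitL D ε) (ContinuousLinearMap.id ℂ H)
      (tensorX α β B D ε φ (trivX B D α β) Y v) =
    Y (rtpMap (rtri D ε φ) α φ α (unitL D ε) (ContinuousLinearMap.id ℂ H) v) := by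
  rw [tensorX_apply, leg13_trivX, unitL_naturality, unitL_assoc]

section Right

variable [hγ : Mod b γ] [hδ : Mod b.dag δ] [hγδ : Nm b γ δ] [hδγ : Nm b.dag δ γ]
  (X : RTP δ α →L[ℂ] RTP γ β) [hX : LegU X (rtri δ α β) (ltri γ β δ)]

include hγ hδ hγδ hδγ hX

omit hD hD' hBD hDB in
-- Inserting `a` in the middle and multiplying gives `ρ_β(a)` on `H` before `X` and `ρ_δ(a)` on `K`
-- after it. The operator `X` intertwines them because it maps `δ ▷ β` onto `δ`'s leg `δ ◁ β` on the
-- target.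
theorem leg13_unitR (w : RTP δ (rtri B β α)) :
    rtpMap (ltri δ B γ) β γ β (unitR δ B) (ContinuousLinearMap.id ℂ H) (leg13 α β γ δ B X w) =
      X (rtpMap δ (rtri B β α) δ α (ContinuousLinearMap.id ℂ K) (unitL B β) w) := by
  have : rtpMap (ltri δ B γ) β γ β (unitR δ B) (ContinuousLinearMap.id ℂ H) ∘L
      leg13 α β γ δ B X =
      X ∘L rtpMap δ (rtri B β α) δ α (ContinuousLinearMap.id ℂ K) (unitL B β) := by
    refine leg13_ext fun a v => ?_
    have ha : a.1 ∈ b.dag.algd := IsAlg.mem_algd a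
    have e1 : unitL B β ∘L ket1 a = rho β a.1 := ContinuousLinearMap.ext fun v => unitL_ket1 a v
    have e2 : unitR δ B ∘L ket2 a = rho δ a.1 := ContinuousLinearMap.ext fun v => unitR_ket2 a v
    have m1 : Maps (rho β a.1) α α := maps_rho ha
    have m2 : Maps (rho δ a.1) γ γ := maps_rho ha
    rw [coe_comp, Function.comp_apply, coe_comp, Function.comp_apply, leg13_rtpMap_ket1,
      rtpMap_rtpMap, rtpMap_rtpMap, e1, e2, comp_id, comp_id,
      ← rho_ltri_eq (mem_legComm ha) (mem_legComm ha),
      ← rho_rtri_eq (mem_legComm ha) (mem_legComm ha)]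
    exact DFunLike.congr_fun (comp_rho (T := X) (mem_legComm ha) (mem_legComm ha)).symm v
  exact DFunLike.congr_fun this w

/-- The right unit isomorphisms intertwine. -/
theorem unitR_tensorX (v : RTP (rtri δ B D) α) :
    rtpMap (ltri δ B γ) β γ β (unitR δ B) (ContinuousLinearMap.id ℂ H)
      (tensorX α β γ δ B D X (trivX B D α β) v) =
    X (rtpMap (rtri δ B D) α δ α (unitR δ B) (ContinuousLinearMap.id ℂ H) v) := by
  have e : unitL B β ∘L trivX B D α β = unitL D α := ContinuousLinearMap.ext unitL_trivX
  rw [tensorX_apply, leg13_unitR, rtpMap_rtpMap, e, comp_id, assoc_triangle]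

end Right

end Triv

end

section

variable {b : CStarBase 𝔎}

/-! ### Well-definedness of the tensor structure -/

section Unitary

variable (V : PMU b H)

instance : Mod b.dag V.βh := ⟨V.bimodule_βh_α.left⟩
instance : Mod b V.α := ⟨V.bimodule_α_β.left⟩
instance : Mod b.dag V.β := ⟨V.bimodule_α_β.right⟩
instance : Nm b.dag V.βh V.α := ⟨V.bimodule_βh_α.left_right⟩
instance : Nm b V.α V.βh := ⟨V.bimodule_βh_α.right_left⟩
instance : Nm b V.α V.β := ⟨V.bimodule_α_β.left_right⟩
instance : Nm b.dag V.β V.α := ⟨V.bimodule_α_β.right_left⟩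
instance : Nm b.dag V.βh V.β := ⟨V.bimodule_βh_β.left_right⟩
instance : Nm b.dag V.β V.βh := ⟨V.bimodule_βh_β.right_left⟩
instance : LegU V.V (ltri V.βh V.α V.α) (rtri V.α V.β V.α) :=
  LegU.of_mapsLegOnto V.unitary V.map_α_α
instance : LegU V.V (ltri V.βh V.α V.β) (ltri V.α V.β V.β) :=
  LegU.of_mapsLegOnto V.unitary V.map_β_α

end Unitary

variable {V : PMU b H}

section RepData

variable (R : RepData V) [h : Fact (IsRep V R)]

instance : Mod b R.γ := ⟨h.out.bimodule.left⟩
instance : Mod b.dag R.δ := ⟨h.out.bimodule.right⟩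
instance : Nm b R.γ R.δ := ⟨h.out.bimodule.left_right⟩
instance : Nm b.dag R.δ R.γ := ⟨h.out.bimodule.right_left⟩
instance : LegU R.X (ltri R.δ V.α R.γ) (rtri R.γ V.β V.α) :=
  LegU.of_mapsLegOnto h.out.unitary h.out.map_γ_α
instance : LegU R.X (rtri R.δ V.α V.β) (ltri R.γ V.β R.δ) :=
  LegU.of_mapsLegOnto h.out.unitary h.out.map_δ_β
instance : LegU R.X (rtri R.δ V.α V.βh) (rtri R.γ V.β V.βh) :=
  LegU.of_mapsLegOnto h.out.unitary h.out.map_δ_βh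

end RepData

instance {k : MorKind} (R : Rep V k) : Fact (IsRep V R.data) := ⟨R.isRep⟩

theorem isRep_of_legU {R : RepData V} [h₁ : Mod b R.γ] [h₂ : Mod b.dag R.δ] [h₃ : Nm b R.γ R.δ]
    [h₄ : Nm b.dag R.δ R.γ] (h : LegU R.X (ltri R.δ V.α R.γ) (rtri R.γ V.β V.α))
    (h' : LegU R.X (rtri R.δ V.α V.β) (ltri R.γ V.β R.δ))
    (h'' : LegU R.X (rtri R.δ V.α V.βh) (rtri R.γ V.β V.βh))
    (hP : Pentagon V.βh V.α V.β V.V R.γ R.δ R.X) : IsRep V R where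
  bimodule := ⟨h₁.out, h₂.out, h₃.out, h₄.out⟩
  unitary := h.unitary
  map_γ_α := h.mapsLegOnto
  map_δ_β := h'.mapsLegOnto
  map_δ_βh := h''.mapsLegOnto
  pentagon := hP

theorem isRep_tensor (R S : RepData V) [Fact (IsRep V R)] [hS : Fact (IsRep V S)] :
    IsRep V (R.tensor S) := by
  have h₁ : Mod b (R.tensor S).γ := mod_ltri (β := R.δ) (γ := S.γ) (α := R.γ)
  have h₂ : Mod b.dag (R.tensor S).δ := mod_rtri (β := R.δ) (γ := S.γ) (δ := S.δ)
  have h₃ : Nm b (R.tensor S).γ (R.tensor S).δ :=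
    nm_ltri_rtri (β := R.δ) (γ := S.γ) (α := R.γ) (δ := S.δ)
  have h₄ : Nm b.dag (R.tensor S).δ (R.tensor S).γ :=
    nm_rtri_ltri (β := R.δ) (γ := S.γ) (α := R.γ) (δ := S.δ)
  exact isRep_of_legU (legU_tensorX_left R.X S.X) (legU_tensorX_mid R.X S.X)
    (legU_tensorX_right R.X S.X V.βh)
    (pentagon_tensorX R.X S.X V.V (Fact.out : IsRep V R).pentagon hS.out.pentagon)

section Base

variable (V)

include V

/-- The module `α` belonging to `V` supplies the identity `𝔅 = [α*α]` needed to see that `𝔅` is a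
module over the base. -/
theorem mod_B : Mod b b.B := IsAlg.mod V.α
theorem mod_Bd : Mod b.dag b.Bd := IsAlg.mod V.β

theorem nm_B_Bd : Nm b b.B b.Bd :=
  have := mod_B V
  have := mod_Bd V
  IsAlg.nm

theorem nm_Bd_B : Nm b.dag b.Bd b.B :=
  have := mod_B V
  have := mod_Bd V
  IsAlg.nm

theorem isRep_triv : IsRep V (RepData.triv V) := by
  have h₁ : Mod b b.B := mod_B V
  have h₂ : Mod b.dag b.Bd := mod_Bd V
  have h₃ : Nm b b.B b.Bd := nm_B_Bd V
  have h₄ : Nm b.dag b.Bd b.B := nm_Bd_B V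
  exact isRep_of_legU (R := RepData.triv V) (h₁ := h₁) (h₂ := h₂) (h₃ := h₃) (h₄ := h₄)
    (legU_trivX_left (B := b.B) (D := b.Bd)) (legU_trivX_mid (B := b.B) (D := b.Bd))
    (legU_trivX_right (B := b.B) (D := b.Bd)) (pentagon_trivX (B := b.B) (D := b.Bd) V.V)

end Base

/-! ### Morphisms between representations and their adjoints -/

theorem IsMor.weaken {R S : RepData V} {T : R.K →L[ℂ] S.K} (h : IsMor .morphism R S T)
    (k : MorKind) : IsMor k R S T :=
  ⟨h.map_γ, h.map_δ, fun _ => h.adjoint_γ rfl, fun _ => h.adjoint_δ rfl, h.intertwines⟩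

theorem isMor_of_legU {R S : RepData V} {T : R.K →L[ℂ] S.K} (hγ : LegU T R.γ S.γ)
    (hδ : LegU T R.δ S.δ) (h : ∀ v, S.X (rtpMap R.δ V.α S.δ V.α T (ContinuousLinearMap.id ℂ H) v) =
      rtpMap R.γ V.β S.γ V.β T (ContinuousLinearMap.id ℂ H) (R.X v)) : IsMor .morphism R S T where
  map_γ := hγ.maps.out
  map_δ := hδ.maps.out
  adjoint_γ _ := hγ.maps_adjoint.out
  adjoint_δ _ := hδ.maps_adjoint.out
  intertwines := ContinuousLinearMap.ext h

/-- The adjoint of a morphism is a morphism. -/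
theorem IsMor.adjoint {R S : RepData V} [hR : Fact (IsRep V R)] [hS : Fact (IsRep V S)]
    {T : R.K →L[ℂ] S.K} (h : IsMor .morphism R S T) :
    IsMor .morphism S R (ContinuousLinearMap.adjoint T) where
  map_γ := h.adjoint_γ rfl
  map_δ := h.adjoint_δ rfl
  adjoint_γ _ := by rw [adjoint_adjoint]; exact h.map_γ
  adjoint_δ _ := by rw [adjoint_adjoint]; exact h.map_δ
  intertwines := by
    have m1 : Maps T R.γ S.γ := ⟨h.map_γ⟩
    have m2 : Maps T R.δ S.δ := ⟨h.map_δ⟩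
    have m3 : Maps (ContinuousLinearMap.adjoint T) S.γ R.γ := ⟨h.adjoint_γ rfl⟩
    have m4 : Maps (ContinuousLinearMap.adjoint T) S.δ R.δ := ⟨h.adjoint_δ rfl⟩
    have m5 : ∀ α : Leg 𝔎 H, Maps (ContinuousLinearMap.adjoint (ContinuousLinearMap.id ℂ H)) α α :=
      fun α => by rw [adjoint_id]; infer_instance
    -- The adjoint relation `(T* ⊗ Id) Y* = X* (T* ⊗ Id)` is multiplied by `X` from the left and by
    -- `Y` from the right; unitarity of `X` and `Y` then gives the relation for `T*`.
    have hi := congrArg ContinuousLinearMap.adjoint h.intertwines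
    rw [adjoint_comp, adjoint_comp, adjoint_rtpMap, adjoint_rtpMap, adjoint_id] at hi
    have hRX := hR.out.unitary.2
    have hSX := hS.out.unitary.1
    calc _ = R.X ∘L (rtpMap S.δ V.α R.δ V.α (ContinuousLinearMap.adjoint T)
          (ContinuousLinearMap.id ℂ H) ∘L ContinuousLinearMap.adjoint S.X) ∘L S.X := by
          rw [comp_assoc, hSX, comp_id]
      _ = _ := by rw [hi, ← comp_assoc, ← comp_assoc, hRX, id_comp]

theorem isMor_assoc (P R S : RepData V) [Fact (IsRep V P)] [Fact (IsRep V R)] [Fact (IsRep V S)] :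
    IsMor .morphism ((P.tensor R).tensor S) (P.tensor (R.tensor S)) (assoc P.δ R.γ R.δ S.γ) :=
  isMor_of_legU (R := (P.tensor R).tensor S) (S := P.tensor (R.tensor S))
    (legU_assoc_ltri (x := P.γ)) (legU_assoc_rtri (x := S.δ))
    (tensorX_assoc P.X R.X S.X)

theorem isMor_unitL (R : RepData V) [Fact (IsRep V R)] :
    IsMor .morphism ((RepData.triv V).tensor R) R (unitL b.Bd R.γ) := by
  have := mod_B V
  have := mod_Bd V
  have := nm_B_Bd V
  have := nm_Bd_B V
  exact isMor_of_legU (R := (RepData.triv V).tensor R) (legU_unitL_ltri (A' := b.B))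
    (legU_unitL_rtri (x := R.δ)) fun v =>
      (unitL_tensorX (B := b.B) (D := b.Bd) R.X v).symm

theorem isMor_unitR (R : RepData V) [Fact (IsRep V R)] :
    IsMor .morphism (R.tensor (RepData.triv V)) R (unitR R.δ b.B) := by
  have := mod_B V
  have := mod_Bd V
  have := nm_B_Bd V
  have := nm_Bd_B V
  exact isMor_of_legU (R := R.tensor (RepData.triv V)) (legU_unitR_ltri (x := R.γ))
    (legU_unitR_rtri (A' := b.Bd)) fun v =>
      (unitR_tensorX (B := b.B) (D := b.Bd) R.X v).symm

theorem isMor_tensorHom {k : MorKind} {R S R' S' : RepData V} [Fact (IsRep V R)]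
    [Fact (IsRep V S)] [Fact (IsRep V R')] [Fact (IsRep V S')] {f : R.K →L[ℂ] R'.K}
    {g : S.K →L[ℂ] S'.K} (hf : IsMor k R R' f) (hg : IsMor k S S' g) :
    IsMor k (R.tensor S) (R'.tensor S') (rtpMap R.δ S.γ R'.δ S'.γ f g) := by
  have f1 : Maps f R.γ R'.γ := ⟨hf.map_γ⟩
  have f2 : Maps f R.δ R'.δ := ⟨hf.map_δ⟩
  have g1 : Maps g S.γ S'.γ := ⟨hg.map_γ⟩
  have g2 : Maps g S.δ S'.δ := ⟨hg.map_δ⟩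
  refine ⟨(maps_rtpMap_ltri f g).out, (maps_rtpMap_rtri f g).out, fun hk => ?_, fun hk => ?_,
    ContinuousLinearMap.ext (tensorX_naturality R.X S.X R'.X S'.X f g
      (DFunLike.congr_fun hf.intertwines) hg.intertwines)⟩
  all_goals
    have f3 : Maps (adjoint f) R'.γ R.γ := ⟨hf.adjoint_γ hk⟩
    have f4 : Maps (adjoint f) R'.δ R.δ := ⟨hf.adjoint_δ hk⟩
    have g3 : Maps (adjoint g) S'.γ S.γ := ⟨hg.adjoint_γ hk⟩
    have g4 : Maps (adjoint g) S'.δ S.δ := ⟨hg.adjoint_δ hk⟩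
  · have : Maps (adjoint (rtpMap R.δ S.γ R'.δ S'.γ f g)) (ltri R'.δ S'.γ R'.γ)
        (ltri R.δ S.γ R.γ) := by
      rw [adjoint_rtpMap]; infer_instance
    exact this.out
  · have : Maps (adjoint (rtpMap R.δ S.γ R'.δ S'.γ f g)) (rtri R'.δ S'.γ S'.δ)
        (rtri R.δ S.γ S.δ) := by
      rw [adjoint_rtpMap]; infer_instance
    exact this.out

variable {k : MorKind}

instance {R S : Rep V k} (f : R ⟶ S) : Maps (op f) R.data.γ S.data.γ := ⟨(op_mem f).map_γ⟩
instance {R S : Rep V k} (f : R ⟶ S) : Maps (op f) R.data.δ S.data.δ := ⟨(op_mem f).map_δ⟩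

variable (V k)

theorem tensorStructureWellDefined : TensorStructureWellDefined V k := by
  have := mod_B V
  have := mod_Bd V
  have := nm_B_Bd V
  have := nm_Bd_B V
  have hT : ∀ R S : Rep V k, Fact (IsRep V (R.data.tensor S.data)) :=
    fun R S => ⟨isRep_tensor _ _⟩
  have h1 : Fact (IsRep V (RepData.triv V)) := ⟨isRep_triv V⟩
  exact
    { tensor_isRep := fun R S hR hS =>
        have : Fact (IsRep V R) := ⟨hR⟩
        have : Fact (IsRep V S) := ⟨hS⟩
        isRep_tensor R S
      triv_isRep := isRep_triv V
      tensorHom_isMor := fun R S R' S' f g => isMor_tensorHom (op_mem f) (op_mem g)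
      tensorHom_apply := fun R S R' S' f g => rtpMap_tmul' (op f) (op g)
      assoc_unitary := fun P R S => isUnitaryOp_assoc
      assoc_apply := fun P R S ω ξ η => assoc_ket2_ket1 ξ η ω
      assoc_isMor := fun P R S => (isMor_assoc P.data R.data S.data).weaken k
      assoc_inv_isMor := fun P R S =>
        have : Fact (IsRep V ((P.data.tensor R.data).tensor S.data)) := ⟨isRep_tensor _ _⟩
        have : Fact (IsRep V (P.data.tensor (R.data.tensor S.data))) := ⟨isRep_tensor _ _⟩
        (isMor_assoc P.data R.data S.data).adjoint.weaken k
      unitL_unitary := fun R => isUnitaryOp_unitL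
      unitL_apply := fun R => unitL_tmul
      unitL_isMor := fun R => (isMor_unitL R.data).weaken k
      unitL_inv_isMor := fun R =>
        have : Fact (IsRep V ((RepData.triv V).tensor R.data)) := ⟨isRep_tensor _ _⟩
        (isMor_unitL R.data).adjoint.weaken k
      unitR_unitary := fun R => isUnitaryOp_unitR
      unitR_apply := fun R => unitR_tmul
      unitR_isMor := fun R => (isMor_unitR R.data).weaken k
      unitR_inv_isMor := fun R =>
        have : Fact (IsRep V (R.data.tensor (RepData.triv V))) := ⟨isRep_tensor _ _⟩
        (isMor_unitR R.data).adjoint.weaken k }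

end

section

variable {b : CStarBase 𝔎} {V : PMU b H} {k : MorKind}

/-! ### The monoidal structure -/

attribute [local irreducible] instNormedAddCommGroupRTP instInnerProductSpaceComplexRTP RTP assoc
  rtpMap ltri rtri

theorem hom_ext {R S : Rep V k} {f g : R ⟶ S} (h : ∀ v, op f v = op g v) : f = g :=
  Subtype.ext (ContinuousLinearMap.ext h)

theorem tensorHom_eq_comp {P P' Q R R' S : Rep V k} (f : P ⟶ P') (f' : P' ⟶ Q) (g : R ⟶ R')
    (g' : R' ⟶ S) :
    rtpMap P'.data.δ R'.data.γ Q.data.δ S.data.γ (op f') (op g') ∘L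
        rtpMap P.data.δ R.data.γ P'.data.δ R'.data.γ (op f) (op g) =
      rtpMap P.data.δ R.data.γ Q.data.δ S.data.γ (op (f ≫ f')) (op (g ≫ g')) :=
  ContinuousLinearMap.ext (rtpMap_rtpMap (op f) (op g) (op f') (op g'))

variable (V k)

/-- The monoidal structure on the category of representations of `V`. -/
@[reducible] def monoidalCategory : MonoidalCategory (Rep V k) where
  __ := (tensorStructureWellDefined V k).monoidalStruct
  tensorHom_def {P P' R R'} f g := Subtype.ext <| by
    refine Eq.trans ?_ (tensorHom_eq_comp f (𝟙 P') (𝟙 R) g).symm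
    rw [Category.comp_id, Category.id_comp]
    rfl
  id_tensorHom_id R S := Subtype.ext (rtpMap_id (LC.out (β := R.data.δ) (γ := S.data.γ)))
  tensorHom_comp_tensorHom f g f' g' := Subtype.ext (tensorHom_eq_comp f f' g g')
  whiskerLeft_id R S := Subtype.ext (rtpMap_id (LC.out (β := R.data.δ) (γ := S.data.γ)))
  id_whiskerRight R S := Subtype.ext (rtpMap_id (LC.out (β := R.data.δ) (γ := S.data.γ)))
  associator_naturality f g h := hom_ext fun v => assoc_naturality (op f) (op g) (op h) v
  leftUnitor_naturality {R S} f :=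
    have := mod_B V
    have := mod_Bd V
    hom_ext fun v => unitL_naturality (A := b.Bd) (op f) v
  rightUnitor_naturality f :=
    have := mod_B V
    have := mod_Bd V
    hom_ext fun v => unitR_naturality (A := b.B) (op f) v
  pentagon P Q R S := hom_ext fun v => assoc_pentagon (δ := P.data.δ) (ε := Q.data.γ)
    (φ := Q.data.δ) (μ := R.data.γ) (ν := R.data.δ) (κ := S.data.γ) v
  triangle R S :=
    have := mod_B V
    have := mod_Bd V
    have := nm_B_Bd V
    have := nm_Bd_B V
    hom_ext fun v => assoc_triangle (A := b.Bd) (A' := b.B) (δ := R.data.δ) (γ := S.data.γ) v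

end

section

variable {b : CStarBase 𝔎} {V : PMU b H} {k : MorKind}

/-! ### Bilinearity and the `C*`-structure -/

section Bilinear

variable {β : Leg 𝔎 H} {β' : Leg 𝔎 H'} {γ : Leg 𝔎 K} {γ' : Leg 𝔎 K'}

theorem rtpMap_sub_left [LC β γ] [LC β' γ] [Tot β] [Tot β'] (S T : H →L[ℂ] H') [Maps S β β']
    [Maps T β β'] : rtpMap β γ β' γ (S - T) (ContinuousLinearMap.id ℂ K) =
      rtpMap β γ β' γ S (ContinuousLinearMap.id ℂ K) -
        rtpMap β γ β' γ T (ContinuousLinearMap.id ℂ K) := by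
  have : Maps (S - T) β β' := ⟨fun ξ hξ => by
    rw [sub_comp]; exact sub_mem (Maps.out ξ hξ) (Maps.out ξ hξ)⟩
  exact rtp_ext2 fun η v => by simp

theorem rtpMap_add_right [LC β γ] [LC β γ'] [Tot γ] [Tot γ'] (S T : K →L[ℂ] K') [Maps S γ γ']
    [Maps T γ γ'] : rtpMap β γ β γ' (ContinuousLinearMap.id ℂ H) (S + T) =
      rtpMap β γ β γ' (ContinuousLinearMap.id ℂ H) S +
        rtpMap β γ β γ' (ContinuousLinearMap.id ℂ H) T := by
  have : Maps (S + T) γ γ' := ⟨fun ξ hξ => by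
    rw [add_comp]; exact add_mem (Maps.out ξ hξ) (Maps.out ξ hξ)⟩
  exact rtp_ext1 fun η v => by simp

theorem rtpMap_smul_right [LC β γ] [LC β γ'] [Tot γ] [Tot γ'] (c : ℂ) (S : K →L[ℂ] K')
    [Maps S γ γ'] : rtpMap β γ β γ' (ContinuousLinearMap.id ℂ H) (c • S) =
      c • rtpMap β γ β γ' (ContinuousLinearMap.id ℂ H) S := by
  have : Maps (c • S) γ γ' := ⟨fun ξ hξ => by
    rw [smul_comp]; exact Submodule.smul_mem _ _ (Maps.out ξ hξ)⟩
  exact rtp_ext1 fun η v => by simp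

theorem norm_rtpMap_sub_le [LC β γ] [LC β' γ] [Tot β] [Tot β'] (S T : H →L[ℂ] H') [Maps S β β']
    [Maps T β β'] : ‖rtpMap β γ β' γ S (ContinuousLinearMap.id ℂ K) -
      rtpMap β γ β' γ T (ContinuousLinearMap.id ℂ K)‖ ≤ ‖S - T‖ := by
  have : Maps (S - T) β β' := ⟨fun ξ hξ => by
    rw [sub_comp]; exact sub_mem (Maps.out ξ hξ) (Maps.out ξ hξ)⟩
  rw [← rtpMap_sub_left]
  exact norm_rtpMap_le _

end Bilinear

section MonoidalLinear

attribute [local irreducible] instNormedAddCommGroupRTP instInnerProductSpaceComplexRTP RTP assoc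
  rtpMap ltri rtri

variable (V k)

attribute [local instance] monoidalCategory

theorem monoidalPreadditive : MonoidalPreadditive (Rep V k) where
  whiskerLeft_zero {R S T} := Subtype.ext <| by
    have := rtpMap_smul_right (β := R.data.δ) 0 (op (0 : S ⟶ T)) (γ := S.data.γ) (γ' := T.data.γ)
    rw [zero_smul, zero_smul] at this
    exact this
  zero_whiskerRight {R S T} := Subtype.ext <|
    rtpMap_zero (β := S.data.δ) (β' := T.data.δ) (γ := R.data.γ) LC.out LC.out
  whiskerLeft_add {R S T} f g := Subtype.ext <|
    rtpMap_add_right (β := R.data.δ) (γ := S.data.γ) (γ' := T.data.γ) (op f) (op g)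
  add_whiskerRight {R S T} f g := Subtype.ext <|
    rtpMap_add (β := S.data.δ) (β' := T.data.δ) (γ := R.data.γ) LC.out LC.out
      (op_mem f).map_δ (op_mem g).map_δ

theorem monoidalLinear :
    @MonoidalLinear ℂ _ (Rep V k) _ _ _ (monoidalCategory V k) (monoidalPreadditive V k) :=
  let _ := monoidalPreadditive V k
  { whiskerLeft_smul := fun R S T c f => Subtype.ext <|
      rtpMap_smul_right (β := R.data.δ) (γ := S.data.γ) (γ' := T.data.γ) c (op f)
    smul_whiskerRight := fun c S T f R => Subtype.ext <|
      rtpMap_smul (β := S.data.δ) (β' := T.data.δ) (γ := R.data.γ) LC.out LC.out c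
        (op_mem f).map_δ }

end MonoidalLinear

/-! ### Completeness of the spaces of arrows and positivity -/

open Filter Topology in
-- Each condition passes to norm limits: the target legs are closed, the adjoint is continuous, and
-- `‖S ⊗ Id - T ⊗ Id‖ ≤ ‖S - T‖` makes both sides of the intertwining relation continuous.
theorem isClosed_homs (R S : Rep V k) : IsClosed (homs R S : Set (R.data.K →L[ℂ] S.data.K)) := by
  refine IsSeqClosed.isClosed fun f T hf hT => ?_
  have m : ∀ {E F : Type u} [NormedAddCommGroup E] [InnerProductSpace ℂ E]
      [NormedAddCommGroup F] [InnerProductSpace ℂ F] {α : Leg 𝔎 E} {β : Leg 𝔎 F}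
      (_ : IsClosed (β : Set (𝔎 →L[ℂ] F))) {g : ℕ → E →L[ℂ] F} {A : E →L[ℂ] F}
      (_ : Tendsto g atTop (𝓝 A)) (_ : ∀ n, ∀ ξ ∈ α, g n ∘L ξ ∈ β), ∀ ξ ∈ α, A ∘L ξ ∈ β :=
    fun hβ g A hA h ξ hξ => hβ.mem_of_tendsto
      (((compL ℂ 𝔎 _ _).flip ξ).continuous.tendsto A |>.comp hA) (.of_forall fun n => h n ξ hξ)
  have hA : Tendsto (fun n => adjoint (f n)) atTop (𝓝 (adjoint T)) :=
    (adjoint.continuous.tendsto T).comp hT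
  have hγ := m S.isRep.bimodule.left.isClosed hT fun n => (hf n).map_γ
  have hδ := m S.isRep.bimodule.right.isClosed hT fun n => (hf n).map_δ
  have m1 : ∀ n, Maps (f n) R.data.γ S.data.γ := fun n => ⟨(hf n).map_γ⟩
  have m2 : ∀ n, Maps (f n) R.data.δ S.data.δ := fun n => ⟨(hf n).map_δ⟩
  have m3 : Maps T R.data.γ S.data.γ := ⟨hγ⟩
  have m4 : Maps T R.data.δ S.data.δ := ⟨hδ⟩
  have hT' := tendsto_iff_norm_sub_tendsto_zero.1 hT
  have t1 : Tendsto (fun n => rtpMap R.data.δ V.α S.data.δ V.α (f n)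
      (ContinuousLinearMap.id ℂ H)) atTop
      (𝓝 (rtpMap R.data.δ V.α S.data.δ V.α T (ContinuousLinearMap.id ℂ H))) :=
    tendsto_iff_norm_sub_tendsto_zero.2 <|
      squeeze_zero (fun _ => norm_nonneg _) (fun n => norm_rtpMap_sub_le (f n) T) hT'
  have t2 : Tendsto (fun n => rtpMap R.data.γ V.β S.data.γ V.β (f n)
      (ContinuousLinearMap.id ℂ H)) atTop
      (𝓝 (rtpMap R.data.γ V.β S.data.γ V.β T (ContinuousLinearMap.id ℂ H))) :=
    tendsto_iff_norm_sub_tendsto_zero.2 <|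
      squeeze_zero (fun _ => norm_nonneg _) (fun n => norm_rtpMap_sub_le (f n) T) hT'
  refine ⟨hγ, hδ, fun hk => m R.isRep.bimodule.left.isClosed hA fun n => (hf n).adjoint_γ hk,
    fun hk => m R.isRep.bimodule.right.isClosed hA fun n => (hf n).adjoint_δ hk, ?_⟩
  have l1 := ((compL ℂ _ _ _ S.data.X).continuous.tendsto _).comp t1
  have l2 := (((compL ℂ _ _ _).flip R.data.X).continuous.tendsto _).comp t2
  refine tendsto_nhds_unique l1 (l2.congr fun n => ?_)
  exact (hf n).intertwines.symm

/-- The `C*`-algebra of endomorphisms of a representation. -/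
def endAlg (R : Rep V .morphism) : StarSubalgebra ℂ (R.data.K →L[ℂ] R.data.K) where
  __ := homs R R
  mul_mem' hS hT := comp_mem_homs hT hS
  one_mem' := id_mem_homs R
  algebraMap_mem' c := by
    rw [Algebra.algebraMap_eq_smul_one]
    exact (homs R R).smul_mem c (id_mem_homs R)
  star_mem' hT := IsMor.adjoint hT

/-- The adjoint of a morphism. -/
def homAdjoint {R S : Rep V .morphism} (f : R ⟶ S) : S ⟶ R :=
  ⟨adjoint (op f), IsMor.adjoint (op_mem f)⟩

/-- The witness is `g = (f*f)^{1/2}`, formed in `L(K)`; the issue is that it is again a morphism. -/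
theorem exists_comp_homAdjoint_eq {R S : Rep V .morphism} (f : R ⟶ S) :
    ∃ g : R ⟶ R, f ≫ homAdjoint f = g ≫ homAdjoint g := by
  have h0 : 0 ≤ adjoint (op f) ∘L op f :=
    (nonneg_iff_isPositive _).2 (isPositive_adjoint_comp_self (op f))
  have hmem : CFC.sqrt (adjoint (op f) ∘L op f) ∈ endAlg R := by
    have : IsClosed (endAlg R : Set (R.data.K →L[ℂ] R.data.K)) := isClosed_homs R R
    rw [CFC.sqrt_eq_real_sqrt _ h0]
    -- The endomorphisms form a closed `*`-subalgebra containing `f*f`, and functional calculus does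
    -- not leave such an algebra.
    exact cfcₙ_mem (𝕜' := ℂ) _ (op_mem (f ≫ homAdjoint f))
  refine ⟨⟨_, hmem⟩, Subtype.ext ?_⟩
  change adjoint (op f) ∘L op f = adjoint (CFC.sqrt (adjoint (op f) ∘L op f)) ∘L
    CFC.sqrt (adjoint (op f) ∘L op f)
  rw [← star_eq_adjoint (CFC.sqrt _), (CFC.sqrt_nonneg _).isSelfAdjoint.star_eq]
  exact (CFC.sqrt_mul_sqrt_self _ h0).symm

variable (V)

/-- The `C*`-category of representations and morphisms. -/
@[reducible] def cstarCategory : CStarCategory (Rep V .morphism) where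
  nrm f := ‖op f‖
  inv f := homAdjoint f
  nrm_eq_zero_iff f := norm_eq_zero.trans ⟨fun h => Subtype.ext h, fun h => congrArg Subtype.val h⟩
  nrm_add_le f g := norm_add_le (op f) (op g)
  nrm_smul c f := norm_smul c (op f)
  complete {R S} f hf := by
    have : CompleteSpace (homs R S) := (isClosed_homs R S).completeSpace_coe
    have hc : CauchySeq (α := homs R S) f := by
      refine Metric.cauchySeq_iff.2 fun ε hε => ?_
      obtain ⟨N, hN⟩ := hf ε hε
      exact ⟨N, fun m hm n hn => (dist_eq_norm (E := homs R S) _ _).trans_lt (hN m hm n hn)⟩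
    obtain ⟨g, hg⟩ := cauchySeq_tendsto_of_complete hc
    refine ⟨g, fun ε hε => ?_⟩
    obtain ⟨N, hN⟩ := Metric.tendsto_atTop.1 hg ε hε
    exact ⟨N, fun n hn => (dist_eq_norm (E := homs R S) _ _).symm.trans_lt (hN n hn)⟩
  nrm_comp_le f g := opNorm_comp_le (op g) (op f)
  inv_inv f := Subtype.ext (adjoint_adjoint (op f))
  inv_add f g := Subtype.ext (map_add adjoint (op f) (op g))
  inv_smul c f := Subtype.ext (map_smulₛₗ adjoint c (op f))
  inv_comp f g := Subtype.ext (adjoint_comp (op g) (op f))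
  nrm_inv_comp f := (norm_adjoint_comp_self (op f)).trans (sq _).symm
  positive f := exists_comp_homAdjoint_eq f

section Tensor

attribute [local irreducible] instNormedAddCommGroupRTP instInnerProductSpaceComplexRTP RTP assoc
  rtpMap ltri rtri

/-- The `C*`-tensor category of representations and morphisms. -/
@[reducible] def cstarTensorCategory :
    @CStarTensorCategory (Rep V .morphism) _ _ _ (monoidalCategory V .morphism) :=
  let _ := monoidalCategory V .morphism
  { cstarCategory V with
    bilinear := ⟨monoidalPreadditive V _, monoidalLinear V _⟩
    inv_tensor := fun {X Y X' Y'} f g => Subtype.ext <| by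
      have m1 : Maps (adjoint (op f)) X'.data.δ X.data.δ := ⟨(op_mem f).adjoint_δ rfl⟩
      have m2 : Maps (adjoint (op g)) Y'.data.γ Y.data.γ := ⟨(op_mem g).adjoint_γ rfl⟩
      change adjoint (rtpMap X.data.δ Y.data.γ X'.data.δ Y'.data.γ (op f) (op g)) =
        rtpMap X'.data.δ Y'.data.γ X.data.δ Y.data.γ (adjoint (op f)) (adjoint (op g))
      exact adjoint_rtpMap (β := X.data.δ) (γ := Y.data.γ) (β' := X'.data.δ) (γ' := Y'.data.γ)
        (op f) (op g)
    inv_associator := fun _ _ _ => rfl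
    inv_leftUnitor := fun _ => rfl
    inv_rightUnitor := fun R => Subtype.ext <| by
      change adjoint (unitR R.data.δ b.B) = adjoint (unitR R.data.δ b.B)
      rfl }

end Tensor

end

end CStarPMU

end

theorem mainTheorem7 {𝔎 : Type u} [NormedAddCommGroup 𝔎] [InnerProductSpace ℂ 𝔎] [CompleteSpace 𝔎]
    {b : CStarPMU.CStarBase 𝔎}
    {H : Type u} [NormedAddCommGroup H] [InnerProductSpace ℂ H] [CompleteSpace H]
    (V : CStarPMU.PMU b H) :
    (∃ (h : CStarPMU.TensorStructureWellDefined V CStarPMU.MorKind.morphism)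
        (M : MonoidalCategory (CStarPMU.Rep V CStarPMU.MorKind.morphism))
        (C : CStarPMU.CStarTensorCategory (CStarPMU.Rep V CStarPMU.MorKind.morphism)),
      M.toMonoidalCategoryStruct = h.monoidalStruct ∧
      ∀ (R S : CStarPMU.Rep V CStarPMU.MorKind.morphism) (f : R ⟶ S),
        C.nrm f = ‖CStarPMU.op f‖ ∧ CStarPMU.op (C.inv f) = adjoint (CStarPMU.op f)) ∧
    (∃ (h : CStarPMU.TensorStructureWellDefined V CStarPMU.MorKind.semi)
        (M : MonoidalCategory (CStarPMU.Rep V CStarPMU.MorKind.semi)),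
      M.toMonoidalCategoryStruct = h.monoidalStruct ∧
      ∃ _ : MonoidalPreadditive (CStarPMU.Rep V CStarPMU.MorKind.semi),
        MonoidalLinear ℂ (CStarPMU.Rep V CStarPMU.MorKind.semi)) := by
  exact ⟨⟨CStarPMU.tensorStructureWellDefined V _, CStarPMU.monoidalCategory V _,
      CStarPMU.cstarTensorCategory V, rfl, fun _ _ _ => ⟨rfl, rfl⟩⟩,
    CStarPMU.tensorStructureWellDefined V _, CStarPMU.monoidalCategory V _, rfl,
    CStarPMU.monoidalPreadditive V _, CStarPMU.monoidalLinear V _⟩
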